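/- **Theorem (existence of the spectral shift function for trace class perturbations).** Let $\mathcal H$ be a complex separable Hilbert space, $H_0$ a self-adjoint operator on $\mathcal H$ that is bounded from below, $V$ a trace class operator on $\mathcal H$, and $H:=H_0+V$ with domain $\mathcal D(H_0)$. For a closed operator $A$ let $\rho(A)$ be its resolvent set and $\mathcal R_A(z)=(A-z)^{-1}$; write $\langle x\rangle=(1+x^2)^{1/2}$. Let $I\subset\mathbb R$ be an open interval such that 1. $H$ has only finitely many non-real eigenvalues with real part in $I$; 2. there are $a,n,c>0$ such that every $z$ with $\operatorname{Re}z\in I$, $0<|\operatorname{Im}z|<a$ lies in $\rho(H)$ and satisfies $$\|\mathcal R_H(z)\|\le c\,|\operatorname{Im}z|^{-1}\Big(\frac{\langle\operatorname{Re}z\rangle}{|\operatorname{Im}z|}\Big)^{n}.$$ For $f\in D(I)=C_c^\infty(I,\mathbb C)$, $N\in\mathbb N$ and $\tau\in C_c^\infty(\mathbb R,\mathbb C)$ equal to $1$ near $0$, put $$\chi(x+iy)=\tau\big(y/\langle x\rangle\big),\qquad \tilde f(x+iy)=\Big(\sum_{k=0}^N\frac{f^{(k)}(x)}{k!}(iy)^k\Big)\chi(x+iy).$$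 Call $\tau$ admissible for $A\in\{H,H_0\}$ if $\operatorname{supp}\chi$ contains no non-real eigenvalue of $A$ with real part in $I$. Then, for every $f\in D(I)$ and $A\in\{H,H_0\}$, admissible $\tau$ exist, and the integral $$f(A):=\frac1\pi\int_{\mathbb C}\partial_{\bar z}\tilde f(z)\,\mathcal R_A(z)\,dx\,dy$$ converges absolutely in operator norm for all $N>n$ and all admissible $\tau$, with a value that does not depend on $N$ and $\tau$. Moreover: * For every $f\in D(I)$ the operator $f(H)-f(H_0)$ is trace class, and $f\mapsto \operatorname{Tr}(f(H)-f(H_0))$ is a distribution on $I$, which vanishes on $I\cap\rho(H)\cap\rho(H_0)$. * There is a distribution $\xi\in D'(I)$ (the spectral shift function), unique up to an additive constant, with $\langle\xi',f\rangle=\operatorname{Tr}(f(H)-f(H_0))$ for all $f\in D(I)$. * For $z\in\rho(H)\cap\rho(H_0)$ the operator $\mathcal R_H(z)-\mathcal R_{H_0}(z)$ is trace class; let $\sigma(z)$ be its trace. For all small $\varepsilon>0$ the functions $\sigma(\cdot\pm i\varepsilon)$ are defined on $I$ and locally integrable there, and $$\xi'=\frac1{2\pi i}\lim_{\varepsilon\to0^+}\big(\sigma(\cdot+i\varepsilon)-\sigma(\cdot-i\varepsilon)\big)\quad\text{in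 } D'(I),$$ that is, $\langle\xi',f\rangle=\frac1{2\pi i}\lim_{\varepsilon\to0^+}\int_I f(\lambda)\big(\sigma(\lambda+i\varepsilon)-\sigma(\lambda-i\varepsilon)\big)\,d\lambda$ for every $f\in D(I)$. -/

import Mathlib

open scoped Distributions ContDiff Topology

namespace SSF

noncomputable section

/-! ### Trace class operators and the trace -/

section TraceClass

variable {E : Type*} [NormedAddCommGroup E] [InnerProductSpace ℂ E] [CompleteSpace E]

/-- `T` is trace class: `∑ᵢ ⟨bᵢ, |T| bᵢ⟩ < ∞` for an orthonormal (Hilbert) basis `b`, where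
`|T| = (T* T)^{1/2}`. The terms are nonnegative and the sum does not depend on the basis. -/
def IsTraceClass (T : E →L[ℂ] E) : Prop :=
  ∃ (w : Set E) (b : HilbertBasis w ℂ E),
    Summable fun i : w => (inner ℂ (b i) ((CFC.abs T) (b i))).re

variable (E) in
/-- The index set of a fixed Hilbert basis of `E`. -/
def basisIndex : Set E := (exists_hilbertBasis ℂ E).choose

variable (E) in
/-- A fixed Hilbert basis of `E`. -/
def basis : HilbertBasis (basisIndex E) ℂ E := (exists_hilbertBasis ℂ E).choose_spec.choose

/-- The trace `Tr T = ∑ᵢ ⟨bᵢ, T bᵢ⟩`. For trace class `T` the series converges absolutely and its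
sum does not depend on the Hilbert basis. -/
def trace (T : E →L[ℂ] E) : ℂ := ∑' i, inner ℂ (basis E i) (T (basis E i))

end TraceClass

/-! ### Unbounded operators: resolvent and eigenvalues -/

section Operators

variable {E : Type*} [NormedAddCommGroup E] [InnerProductSpace ℂ E]

/-- The operator `H₀ + V` with domain `𝒟(H₀)`. -/
def perturb (H₀ : E →ₗ.[ℂ] E) (V : E →L[ℂ] E) : E →ₗ.[ℂ] E := (V : E →ₗ[ℂ] E) +ᵥ H₀

/-- The quadratic form of `A` is bounded from below. -/
def IsBoundedBelow (A : E →ₗ.[ℂ] E) : Prop :=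
  ∃ γ : ℝ, ∀ x : A.domain, γ * ‖(x : E)‖ ^ 2 ≤ (inner ℂ (x : E) (A x)).re

/-- The bounded operator `R` is a two-sided inverse of `A - z : 𝒟(A) → E`. -/
def IsResolventAt (A : E →ₗ.[ℂ] E) (z : ℂ) (R : E →L[ℂ] E) : Prop :=
  (∀ u : E, ∃ h : R u ∈ A.domain, A ⟨R u, h⟩ - z • R u = u) ∧
    ∀ v : A.domain, R (A v - z • (v : E)) = v

/-- The resolvent set `ρ(A)`. -/
def resolventSet (A : E →ₗ.[ℂ] E) : Set ℂ := {z | ∃ R : E →L[ℂ] E, IsResolventAt A z R}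

open Classical in
/-- The resolvent `(A - z)⁻¹` for `z ∈ ρ(A)` (and `0` otherwise). -/
def resolvent (A : E →ₗ.[ℂ] E) (z : ℂ) : E →L[ℂ] E :=
  if h : ∃ R : E →L[ℂ] E, IsResolventAt A z R then h.choose else 0

/-- `z` is an eigenvalue of `A`. -/
def IsEigenvalue (A : E →ₗ.[ℂ] E) (z : ℂ) : Prop :=
  ∃ v : A.domain, (v : E) ≠ 0 ∧ A v = z • (v : E)

/-- The non-real eigenvalues of `A` whose real part lies in `I`. -/
def nonrealEigenvalues (A : E →ₗ.[ℂ] E) (I : Set ℝ) : Set ℂ :=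
  {z | IsEigenvalue A z ∧ z.im ≠ 0 ∧ z.re ∈ I}

end Operators

/-- The Japanese bracket `⟨x⟩ = (1 + x²)^{1/2}`. -/
def bracket (x : ℝ) : ℝ := Real.sqrt (1 + x ^ 2)

/-- `S_a(I) = {z | Re z ∈ I, 0 < |Im z| < a}`. -/
def strip (a : ℝ) (I : Set ℝ) : Set ℂ := {z | z.re ∈ I ∧ 0 < |z.im| ∧ |z.im| < a}

/-- Polynomial resolvent estimate with exponent `n` in a punctured neighbourhood of `I`. -/
def ResolventEstimate {E : Type*} [NormedAddCommGroup E] [InnerProductSpace ℂ E]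
    (A : E →ₗ.[ℂ] E) (I : Set ℝ) (n : ℝ) : Prop :=
  ∃ a > 0, ∃ c > 0, strip a I ⊆ resolventSet A ∧
    ∀ z ∈ strip a I, ‖resolvent A z‖ ≤ c * |z.im|⁻¹ * (bracket z.re / |z.im|) ^ n

/-! ### Helffer–Sjöstrand functional calculus -/

/-- `∂_{z̄} F = (∂ₓ F + i ∂_y F) / 2`. -/
def dbar (F : ℂ → ℂ) (z : ℂ) : ℂ :=
  (1 / 2) * (fderiv ℝ F z 1 + Complex.I * fderiv ℝ F z Complex.I)

/-- A cut-off function on `ℝ`: smooth, compactly supported, equal to `1` near `0`. -/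
def IsCutoff (τ : ℝ → ℂ) : Prop :=
  ContDiff ℝ ∞ τ ∧ HasCompactSupport τ ∧ ∀ᶠ s in 𝓝 0, τ s = 1

/-- `χ(x + iy) = τ(y / ⟨x⟩)`. -/
def chi (τ : ℝ → ℂ) (z : ℂ) : ℂ := τ (z.im / bracket z.re)

/-- The almost analytic extension of `f` of order `N` with cut-off `τ`. -/
def almostAnalyticExt (f : ℝ → ℂ) (N : ℕ) (τ : ℝ → ℂ) (z : ℂ) : ℂ :=
  (∑ k ∈ Finset.range (N + 1),
    iteratedDeriv k f z.re / (k.factorial : ℂ) * (Complex.I * (z.im : ℂ)) ^ k) * chi τ z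

section FunctionalCalculus

variable {E : Type*} [NormedAddCommGroup E] [InnerProductSpace ℂ E]

/-- The cut-off `τ` is admissible for `A` on `I`: the support of `χ` contains no non-real
eigenvalue of `A` whose real part lies in `I`. -/
def IsAdmissible (A : E →ₗ.[ℂ] E) (I : Set ℝ) (τ : ℝ → ℂ) : Prop :=
  IsCutoff τ ∧ Disjoint (tsupport (chi τ)) (nonrealEigenvalues A I)

/-- The integrand `∂_{z̄} f̃(z) (A - z)⁻¹`. -/
def hsIntegrand (A : E →ₗ.[ℂ] E) (f : ℝ → ℂ) (N : ℕ) (τ : ℝ → ℂ) (z : ℂ) : E →L[ℂ] E :=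
  dbar (almostAnalyticExt f N τ) z • resolvent A z

/-- `F` is the value of the Helffer–Sjöstrand integral `π⁻¹ ∫ ∂_{z̄} f̃(z) (A - z)⁻¹ dx dy`
(convergent in operator norm), for every order `N > n` and every admissible cut-off, of which
there is at least one. -/
def IsHSValue (A : E →ₗ.[ℂ] E) (I : Set ℝ) (n : ℝ) (f : ℝ → ℂ) (F : E →L[ℂ] E) : Prop :=
  (∃ τ, IsAdmissible A I τ) ∧
    ∀ N : ℕ, n < N → ∀ τ, IsAdmissible A I τ →
      MeasureTheory.Integrable (hsIntegrand A f N τ) ∧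
        F = (Real.pi : ℂ)⁻¹ • ∫ z : ℂ, hsIntegrand A f N τ z

open Classical in
/-- The operator `f(A)`: the common value of the Helffer–Sjöstrand integrals of all sufficiently
large orders and all admissible cut-offs (and `0` if there is no such common value). -/
def funcCalc (A : E →ₗ.[ℂ] E) (I : Set ℝ) (f : ℝ → ℂ) : E →L[ℂ] E :=
  if h : ∃ F : E →L[ℂ] E, ∃ n : ℝ, IsHSValue A I n f F then h.choose else 0

/-- `σ(z) = Tr((H - z)⁻¹ - (H₀ - z)⁻¹)`. -/
def sigma [CompleteSpace E] (H H₀ : E →ₗ.[ℂ] E) (z : ℂ) : ℂ :=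
  trace (resolvent H z - resolvent H₀ z)

end FunctionalCalculus

/-- The distributional derivative: `⟨ξ', f⟩ = -⟨ξ, f'⟩`. -/
def distDeriv {Ω : TopologicalSpace.Opens ℝ} (ξ : 𝓓(Ω, ℂ) →L[ℂ] ℂ) : 𝓓(Ω, ℂ) →L[ℂ] ℂ :=
  -(ξ.comp (TestFunction.lineDerivCLM ℂ (1 : ℝ) : 𝓓(Ω, ℂ) →L[ℂ] 𝓓(Ω, ℂ)))

end

end SSF

/-! Everything rests on two facts about a non-real `z` over `I`. Since `V` is compact and `H - z =
(1 + V R₀(z))(H₀ - z)`, the Fredholm alternative puts `z` in `ρ(H)` unless it is an eigenvalue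
(`mem_resolventSet_perturb_of_not_isEigenvalue`). The second resolvent identity `R_H - R₀ = -R_H V
R₀` bounds the trace norm of the difference by a constant times `‖R_H‖ ‖R₀‖`, which over compact
subsets of `I` and near the axis is `O(|Im z|^(-(n+2)))` (`exists_traceControl`).

The form `∂_{z̄} f̃` vanishes to order `N` at the real axis while `R_H = O(|Im z|^(-(n+1)))`, so the
integral converges for `N > n`. Two extensions of the same `f` differ by a function `k = O(|Im
z|^(N+1))`. Then `k R_H` is continuous across the axis, and Stokes' formula shows that `∂_{z̄} k
R_H` has integral zero (`integral_hsIntegrand_eq_of_le`). The same formula gives `f(A) = 0` when the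
support of `f` lies in `ρ(A)`.

As the value is independent of `N`, one may take `N > n + 1`. The integral of the resolvent
difference then converges in trace norm, the trace passes inside, and `Tr(f(H) - f(H₀)) = π⁻¹ ∫
∂_{z̄} f̃ σ` (`TraceControl.trace_funcCalc`). This formula is linear in `f` and is bounded by
finitely many derivatives of `f`, so it defines a distribution `T`. On an interval `T` is integrated
by splitting a test function into a derivative and a multiple of a fixed function of integral one
(`exists_distribution_primitive`).

For the boundary values, `R_H - R₀` is replaced by its translate by `±iε`, which is holomorphic up
to the axis. Stokes' formula on each half plane turns the area integral into `±(2i)⁻¹ ∫ f σ(· ±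
iε)`. Translating away from the axis only improves the bound on the trace norm, so dominated
convergence gives the limit `ε → 0` (`TraceControl.tendsto_integral_jump`). -/

namespace SSF

/-! ### Resolvents under bounded perturbations; the Fredholm alternative. -/

section ResolventTheory

variable {E : Type*} [NormedAddCommGroup E] [InnerProductSpace ℂ E]

theorem IsResolventAt.unique {A : E →ₗ.[ℂ] E} {z : ℂ} {R R' : E →L[ℂ] E}
    (h : IsResolventAt A z R) (h' : IsResolventAt A z R') : R = R' := by
  ext u
  obtain ⟨hu, e⟩ := h.1 u
  have := h'.2 ⟨R u, hu⟩
  rw [e] at this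
  exact this.symm

theorem isResolventAt_resolvent {A : E →ₗ.[ℂ] E} {z : ℂ} (hz : z ∈ resolventSet A) :
    IsResolventAt A z (resolvent A z) := by
  have h : ∃ R : E →L[ℂ] E, IsResolventAt A z R := hz
  rw [resolvent, dif_pos h]
  exact h.choose_spec

theorem IsResolventAt.mem {A : E →ₗ.[ℂ] E} {z : ℂ} {R : E →L[ℂ] E} (h : IsResolventAt A z R) :
    z ∈ resolventSet A := ⟨R, h⟩

theorem IsResolventAt.eq {A : E →ₗ.[ℂ] E} {z : ℂ} {R : E →L[ℂ] E} (h : IsResolventAt A z R) :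
    resolvent A z = R := (isResolventAt_resolvent h.mem).unique h

theorem perturb_apply (A : E →ₗ.[ℂ] E) (V : E →L[ℂ] E) (v : A.domain) :
    perturb A V v = V v + A v := rfl

/-- Since `A + (w - z) - w = A - z`, moving the spectral parameter is a bounded perturbation; this
lets the perturbation lemma also give openness of `ρ(A)`. -/
theorem isResolventAt_perturb_smul {A : E →ₗ.[ℂ] E} {z w : ℂ} {R : E →L[ℂ] E}
    (h : IsResolventAt (perturb A ((w - z) • (1 : E →L[ℂ] E))) w R) : IsResolventAt A z R := by
  have key (v : A.domain) :
      perturb A ((w - z) • (1 : E →L[ℂ] E)) v - w • (v : E) = A v - z • (v : E) := by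
    change (w - z) • (v : E) + A v - w • (v : E) = _
    rw [sub_smul]
    abel
  refine ⟨fun u => ?_, fun v => ?_⟩
  · obtain ⟨hu, e⟩ := h.1 u
    exact ⟨hu, (key ⟨R u, hu⟩).symm.trans e⟩
  · rw [← key]
    exact h.2 v

/-- On `𝒟(A)` one has `A + V - z = (1 + V R)(A - z)`, and `W` inverts the bounded factor. -/
theorem IsResolventAt.perturb {A : E →ₗ.[ℂ] E} {z : ℂ} {R : E →L[ℂ] E} (h : IsResolventAt A z R)
    {V W : E →L[ℂ] E} (h₁ : (1 + V * R) * W = 1) (h₂ : W * (1 + V * R) = 1) :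
    IsResolventAt (perturb A V) z (R * W) := by
  refine ⟨fun u => ?_, fun v => ?_⟩
  · obtain ⟨hu, e⟩ := h.1 (W u)
    refine ⟨hu, ?_⟩
    have : V (R (W u)) + A ⟨R (W u), hu⟩ - z • R (W u) = u := by
      rw [add_sub_assoc, e, add_comm]
      exact DFunLike.congr_fun h₁ u
    exact this
  · have hv := h.2 v
    set u := A v - z • (v : E)
    have e : SSF.perturb A V v - z • (v : E) = (1 + V * R) u := by
      change V v + A v - z • (v : E) = u + V (R u)
      rw [hv, add_sub_assoc, add_comm]
    rw [e]
    change R ((W * (1 + V * R)) u) = v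
    rw [h₂]
    exact hv

theorem resolvent_perturb_sub {A : E →ₗ.[ℂ] E} {V : E →L[ℂ] E} {z : ℂ}
    (hz : z ∈ resolventSet A) (hz' : z ∈ resolventSet (perturb A V)) :
    resolvent (perturb A V) z - resolvent A z =
      -(resolvent (perturb A V) z * V * resolvent A z) := by
  ext u
  obtain ⟨hu, e⟩ := (isResolventAt_resolvent hz).1 u
  have := (isResolventAt_resolvent hz').2 (⟨_, hu⟩ : A.domain)
  rw [perturb_apply, add_sub_assoc, e, map_add] at this
  have this' : resolvent (perturb A V) z (V (resolvent A z u)) + resolvent (perturb A V) z u =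
    resolvent A z u := this
  change resolvent (perturb A V) z u - resolvent A z u =
    -resolvent (perturb A V) z (V (resolvent A z u))
  linear_combination (norm := module) this'

/-- The factor `1 + (w - z) R(w)` is the identity at `z = w`, and units are open. Holomorphy of the
resolvent is then inherited from inversion in the Banach algebra. -/
theorem resolvent_eq_mul_inverse [CompleteSpace E] {A : E →ₗ.[ℂ] E} {w : ℂ}
    (hw : w ∈ resolventSet A) :
    ∀ᶠ z in 𝓝 w, z ∈ resolventSet A ∧
      resolvent A z = resolvent A w * Ring.inverse (1 + ((w - z) • 1) * resolvent A w) := by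
  have hc : Continuous fun z : ℂ => (1 : E →L[ℂ] E) + ((w - z) • 1) * resolvent A w := by fun_prop
  have hu : IsUnit ((1 : E →L[ℂ] E) + ((w - w) • 1) * resolvent A w) := by simp
  filter_upwards [hc.continuousAt.preimage_mem_nhds (Units.isOpen.mem_nhds hu)] with z hz
  have h := (isResolventAt_resolvent hw).perturb (V := (w - z) • 1)
    (Ring.mul_inverse_cancel _ hz) (Ring.inverse_mul_cancel _ hz)
  have h' := isResolventAt_perturb_smul h
  exact ⟨h'.mem, h'.eq⟩

theorem isOpen_resolventSet [CompleteSpace E] (A : E →ₗ.[ℂ] E) : IsOpen (resolventSet A) := by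
  rw [isOpen_iff_mem_nhds]
  intro w hw
  filter_upwards [resolvent_eq_mul_inverse hw] with z hz using hz.1

theorem differentiableAt_resolvent [CompleteSpace E] {A : E →ₗ.[ℂ] E} {w : ℂ}
    (hw : w ∈ resolventSet A) : DifferentiableAt ℂ (resolvent A) w := by
  have h : resolvent A =ᶠ[𝓝 w]
      fun z => resolvent A w * Ring.inverse (1 + ((w - z) • 1) * resolvent A w) := by
    filter_upwards [resolvent_eq_mul_inverse hw] with z hz using hz.2
  refine DifferentiableAt.congr_of_eventuallyEq ?_ h
  refine DifferentiableAt.const_mul ?_ _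
  have h1 : DifferentiableAt ℂ (fun z : ℂ => (1 : E →L[ℂ] E) + ((w - z) • 1) * resolvent A w)
      w := by
    fun_prop
  have h2 : DifferentiableAt ℂ (Ring.inverse : (E →L[ℂ] E) → _)
      ((1 : E →L[ℂ] E) + ((w - w) • 1) * resolvent A w) := by
    have : (1 : E →L[ℂ] E) + ((w - w) • 1) * resolvent A w = ((1 : (E →L[ℂ] E)ˣ) : E →L[ℂ] E) := by
      simp
    rw [this]
    exact differentiableAt_inverse (𝕜 := ℂ) (R := E →L[ℂ] E) (Units.isUnit 1)
  exact DifferentiableAt.comp w h2 h1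

theorem continuousOn_resolvent [CompleteSpace E] (A : E →ₗ.[ℂ] E) :
    ContinuousOn (resolvent A) (resolventSet A) :=
  fun _ hz => (differentiableAt_resolvent hz).continuousAt.continuousWithinAt

/-- If `1 + V R` is not invertible then, `V R` being compact, there is `u ≠ 0` with `-V R u = u`;
the vector `R u` is then an eigenvector of the perturbed operator at `z`. -/
theorem mem_resolventSet_perturb_of_not_isEigenvalue [CompleteSpace E] {A : E →ₗ.[ℂ] E}
    {V : E →L[ℂ] E} (hV : IsCompactOperator V) {z : ℂ} (hz : z ∈ resolventSet A)
    (h : ¬ IsEigenvalue (perturb A V) z) : z ∈ resolventSet (perturb A V) := by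
  have hR := isResolventAt_resolvent hz
  set R := resolvent A z
  have hc : IsCompactOperator (-(V * R) : E →L[ℂ] E) :=
    (hV.comp_clm R).neg
  have hm : (1 : ℂ) ∈ _root_.resolventSet ℂ (-(V * R) : E →L[ℂ] E) := by
    refine (hc.hasEigenvalue_or_mem_resolventSet one_ne_zero).resolve_left ?_
    intro he
    obtain ⟨u, hu⟩ := he.exists_hasEigenvector
    have hu1 : -(V (R u)) = u := by simpa using hu.apply_eq_smul
    obtain ⟨hd, e⟩ := hR.1 u
    refine h ⟨(⟨R u, hd⟩ : A.domain), ?_, ?_⟩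
    · intro h0
      have h0' : R u = 0 := h0
      rw [h0'] at hu1
      exact hu.2 (by simpa using hu1.symm)
    · rw [perturb_apply, ← sub_eq_zero, add_sub_assoc]
      change V (R u) + (A ⟨R u, hd⟩ - z • R u) = 0
      rw [e]
      nth_rw 2 [← hu1]
      abel
  rw [spectrum.mem_resolventSet_iff] at hm
  have hm' : IsUnit (1 + V * R) := by simpa using hm
  exact (hR.perturb (Ring.mul_inverse_cancel _ hm') (Ring.inverse_mul_cancel _ hm')).mem

end ResolventTheory

/-! ### Self-adjoint operators off the real axis. -/

section SelfAdjoint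

variable {E : Type*} [NormedAddCommGroup E] [InnerProductSpace ℂ E] [CompleteSpace E]

/-- `⟨v, A v⟩` is real, so `⟨v, (A - z) v⟩` has imaginary part `-Im z ‖v‖²`; Cauchy–Schwarz does the
rest. -/
theorem _root_.IsSelfAdjoint.abs_im_mul_norm_le {A : E →ₗ.[ℂ] E} (hA : IsSelfAdjoint A) (z : ℂ)
    (v : A.domain) : |z.im| * ‖(v : E)‖ ≤ ‖A v - z • (v : E)‖ := by
  have hs : inner ℂ (A v) (v : E) = inner ℂ (v : E) (A v) := by
    have := LinearPMap.adjoint_isFormalAdjoint hA.dense_domain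
    rw [LinearPMap.isSelfAdjoint_def.1 hA] at this
    exact this v v
  have him : (inner ℂ (v : E) (A v)).im = 0 := by
    rw [← Complex.conj_eq_iff_im, inner_conj_symm, hs]
  have h1 : (inner ℂ (v : E) (A v - z • (v : E))).im = -(z.im * ‖(v : E)‖ ^ 2) := by
    have hn : inner ℂ (v : E) (v : E) = ((‖(v : E)‖ ^ 2 : ℝ) : ℂ) := by
      rw [inner_self_eq_norm_sq_to_K, Complex.ofReal_pow]
      rfl
    rw [inner_sub_right, inner_smul_right, hn, Complex.sub_im, him, Complex.mul_im,
      Complex.ofReal_re, Complex.ofReal_im]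
    ring
  have h2 : |z.im| * ‖(v : E)‖ ^ 2 ≤ ‖(v : E)‖ * ‖A v - z • (v : E)‖ := by
    calc |z.im| * ‖(v : E)‖ ^ 2 = |(inner ℂ (v : E) (A v - z • (v : E))).im| := by
          rw [h1, abs_neg, abs_mul, abs_of_nonneg (sq_nonneg ‖(v : E)‖)]
      _ ≤ ‖inner ℂ (v : E) (A v - z • (v : E))‖ := Complex.abs_im_le_norm _
      _ ≤ _ := norm_inner_le_norm _ _
  rcases eq_or_ne (v : E) 0 with h0 | h0
  · simp [h0]
  · have : 0 < ‖(v : E)‖ := norm_pos_iff.2 h0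
    nlinarith

/-- The graph of `A` is complete, and `(v, A v) ↦ (A - z) v` is bounded below on it, so its range is
closed. A vector `y` orthogonal to the range satisfies `A y = z̄ y` by self-adjointness, hence `y =
0`. -/
theorem _root_.IsSelfAdjoint.isResolventAt_of_im_ne_zero {A : E →ₗ.[ℂ] E} (hA : IsSelfAdjoint A)
    {z : ℂ} (hz : z.im ≠ 0) : z ∈ resolventSet A ∧ ‖resolvent A z‖ ≤ |z.im|⁻¹ := by
  have hz' : 0 < |z.im| := abs_pos.2 hz
  have hcl : IsClosed (A.graph : Set (E × E)) := hA.isClosed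
  have : CompleteSpace A.graph := hcl.completeSpace_coe
  let φ : A.graph →L[ℂ] E :=
    (ContinuousLinearMap.snd ℂ E E - z • ContinuousLinearMap.fst ℂ E E) ∘L A.graph.subtypeL
  have hφ (v : A.domain) : φ ⟨((v : E), A v), A.mem_graph v⟩ = A v - z • (v : E) := rfl
  have hp (p : A.graph) : ∃ v : A.domain, p = ⟨((v : E), A v), A.mem_graph v⟩ := by
    obtain ⟨p, hp⟩ := p
    obtain ⟨y, h1, h2⟩ := (LinearPMap.mem_graph_iff A).1 hp
    exact ⟨y, by ext <;> simp [h1, h2]⟩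
  have hfst (v : A.domain) : ‖(v : E)‖ ≤ |z.im|⁻¹ * ‖A v - z • (v : E)‖ := by
    rw [inv_mul_eq_div, le_div_iff₀ hz', mul_comm]
    exact hA.abs_im_mul_norm_le z v
  have hK : ∃ K, AntilipschitzWith K φ := by
    rw [antilipschitzWith_iff_exists_mul_le_norm]
    refine ⟨(1 + |z.im|⁻¹ + ‖z‖ * |z.im|⁻¹)⁻¹, by positivity, fun p => ?_⟩
    rw [inv_mul_le_iff₀ (by positivity)]
    obtain ⟨v, rfl⟩ := hp p
    rw [hφ]
    set t := ‖A v - z • (v : E)‖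
    have h1 := hfst v
    have h2 : ‖A v‖ ≤ t + ‖z‖ * ‖(v : E)‖ := by
      have := norm_add_le (A v - z • (v : E)) (z • (v : E))
      rwa [sub_add_cancel, norm_smul] at this
    have h3 : ‖z‖ * ‖(v : E)‖ ≤ ‖z‖ * (|z.im|⁻¹ * t) := by gcongr
    have h0 : 0 ≤ t := norm_nonneg _
    have h4 : 0 ≤ |z.im|⁻¹ * t := by positivity
    have h5 : 0 ≤ ‖z‖ * (|z.im|⁻¹ * t) := by positivity
    refine max_le ?_ ?_
    · change ‖(v : E)‖ ≤ _
      nlinarith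
    · change ‖A v‖ ≤ _
      nlinarith
  obtain ⟨K, hK⟩ := hK
  have hrc : IsClosed (φ.range : Set E) := hK.isClosed_range φ.uniformContinuous
  have hr : φ.range = ⊤ := by
    have : CompleteSpace φ.range := hrc.completeSpace_coe
    rw [← Submodule.orthogonal_eq_bot_iff, Submodule.eq_bot_iff]
    intro y hy
    have hy' (v : A.domain) : inner ℂ y (A v) = z * inner ℂ y (v : E) := by
      have := Submodule.inner_left_of_mem_orthogonal (LinearMap.mem_range_self φ.toLinearMap _ :
        φ ⟨((v : E), A v), A.mem_graph v⟩ ∈ φ.range) hy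
      change inner ℂ y (A v - z • (v : E)) = 0 at this
      rwa [inner_sub_right, inner_smul_right, sub_eq_zero] at this
    have hw (v : A.domain) : inner ℂ ((starRingEnd ℂ z) • y) (v : E) = inner ℂ y (A v) := by
      rw [hy', inner_smul_left, Complex.conj_conj]
    have hyd := LinearPMap.mem_adjoint_domain_of_exists y ⟨_, hw⟩
    have hya := LinearPMap.adjoint_apply_eq hA.dense_domain ⟨y, hyd⟩ hw
    have hAA := LinearPMap.isSelfAdjoint_def.1 hA
    have hyA : ∃ h : y ∈ A.domain, A ⟨y, h⟩ = (starRingEnd ℂ z) • y := by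
      -- The equality `A† = A` is applied through a variable operator, because the membership proof
      -- for `y` depends on the operator.
      have : ∀ B : E →ₗ.[ℂ] E, B = A → ∀ h : y ∈ B.domain, B ⟨y, h⟩ = (starRingEnd ℂ z) • y →
          ∃ h : y ∈ A.domain, A ⟨y, h⟩ = (starRingEnd ℂ z) • y := by
        rintro B rfl h e
        exact ⟨h, e⟩
      exact this _ hAA hyd hya
    obtain ⟨hd, e⟩ := hyA
    have := hA.abs_im_mul_norm_le (starRingEnd ℂ z) ⟨y, hd⟩
    rw [e, sub_self, norm_zero, Complex.conj_im, abs_neg] at this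
    exact norm_le_zero_iff.1 (nonpos_of_mul_nonpos_right this hz')
  let e := ContinuousLinearEquiv.ofBijective φ (LinearMap.ker_eq_bot.2 hK.injective) hr
  have hres : IsResolventAt A z
      ((ContinuousLinearMap.fst ℂ E E ∘L A.graph.subtypeL) ∘L (e.symm : E →L[ℂ] A.graph)) := by
    refine ⟨fun u => ?_, fun v => ?_⟩
    · obtain ⟨v, hv⟩ := hp (e.symm u)
      have h1 : e (e.symm u) = u := e.apply_symm_apply u
      have h2 : ((ContinuousLinearMap.fst ℂ E E ∘L A.graph.subtypeL) ∘L
          (e.symm : E →L[ℂ] A.graph)) u = (v : E) := by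
        change ((e.symm u : A.graph) : E × E).1 = v
        rw [hv]
      rw [hv] at h1
      simp only [h2]
      exact ⟨v.2, h1⟩
    · change ((e.symm (e ⟨((v : E), A v), A.mem_graph v⟩) : A.graph) : E × E).1 = v
      rw [e.symm_apply_apply]
  refine ⟨hres.mem, ?_⟩
  refine ContinuousLinearMap.opNorm_le_bound _ (by positivity) fun u => ?_
  obtain ⟨hd, h⟩ := (isResolventAt_resolvent hres.mem).1 u
  have := hfst ⟨_, hd⟩
  rwa [h] at this

theorem _root_.IsSelfAdjoint.nonrealEigenvalues_eq_empty {A : E →ₗ.[ℂ] E} (hA : IsSelfAdjoint A)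
    (I : Set ℝ) : nonrealEigenvalues A I = ∅ := by
  rw [Set.eq_empty_iff_forall_notMem]
  rintro z ⟨⟨v, hv, e⟩, hz, -⟩
  have := hA.abs_im_mul_norm_le z v
  rw [e, sub_self, norm_zero] at this
  exact hv (norm_le_zero_iff.1 (nonpos_of_mul_nonpos_right this (abs_pos.2 hz)))

theorem one_le_bracket (x : ℝ) : 1 ≤ bracket x := by
  rw [bracket, Real.one_le_sqrt]
  nlinarith [sq_nonneg x]

/-- In the strip `|Im z| < 1 ≤ ⟨Re z⟩` the extra factor is at least one, so `H₀` satisfies the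
estimate with whatever exponent is prescribed for `H`. -/
theorem _root_.IsSelfAdjoint.resolventEstimate {A : E →ₗ.[ℂ] E} (hA : IsSelfAdjoint A)
    (I : Set ℝ) {n : ℝ} (hn : 0 < n) : ResolventEstimate A I n := by
  refine ⟨1, one_pos, 1, one_pos, fun z hz => ?_, fun z hz => ?_⟩
  · exact (hA.isResolventAt_of_im_ne_zero (abs_pos.1 hz.2.1)).1
  · refine (hA.isResolventAt_of_im_ne_zero (abs_pos.1 hz.2.1)).2.trans ?_
    rw [one_mul]
    refine le_mul_of_one_le_right (by positivity) (Real.one_le_rpow ?_ hn.le)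
    rw [le_div_iff₀ hz.2.1, one_mul]
    exact hz.2.2.le.trans (one_le_bracket _)

end SelfAdjoint

/-! ### Douglas factorization and polar decomposition. -/

section Douglas

variable {E : Type*} [NormedAddCommGroup E] [InnerProductSpace ℂ E] [CompleteSpace E]

/-- Douglas factorization: if `‖B x‖ ≤ ‖A x‖` for all `x` then `B = U A` for a contraction `U`. -/
theorem exists_mul_eq_of_norm_le (A B : E →L[ℂ] E) (h : ∀ x, ‖B x‖ ≤ ‖A x‖) :
    ∃ U : E →L[ℂ] E, ‖U‖ ≤ 1 ∧ U * A = B := by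
  let R : Submodule ℂ E := A.range
  -- `s` is a merely algebraic section of `A` over its range. The composite `B s` is nevertheless a
  -- contraction, since `‖B s y‖ ≤ ‖A s y‖ = ‖y‖`. It extends to the closure of the range and by
  -- zero to the orthogonal complement.
  obtain ⟨s, hs⟩ := (A.toLinearMap.rangeRestrict).exists_rightInverse_of_surjective
    (LinearMap.range_rangeRestrict _)
  have hs' (y : R) : A (s y) = y := congrArg Subtype.val (LinearMap.congr_fun hs y)
  let f : R →L[ℂ] E := (B.toLinearMap ∘ₗ s).mkContinuous 1 fun y => by
    rw [one_mul]
    exact (h _).trans_eq (by rw [hs']; rfl)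
  have hf : ‖f‖ ≤ 1 := LinearMap.mkContinuous_norm_le _ zero_le_one _
  have hfA (x : E) : f ⟨A x, LinearMap.mem_range_self _ x⟩ = B x := by
    change B (s ⟨A x, _⟩) = B x
    rw [← sub_eq_zero, ← map_sub, ← norm_le_zero_iff]
    refine (h _).trans_eq ?_
    rw [map_sub, hs', sub_self, norm_zero]
  let S : Submodule ℂ E := R.topologicalClosure
  let e : R →L[ℂ] S :=
    R.subtypeL.codRestrict S fun y => R.le_topologicalClosure y.2
  have he (y : R) : ‖y‖ ≤ (1 : NNReal) * ‖e y‖ := by rw [NNReal.coe_one, one_mul]; rfl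
  have hd : DenseRange e := by
    intro y
    rw [closure_subtype, ← Set.range_comp]
    have : Subtype.val ∘ e = (Subtype.val : R → E) := rfl
    rw [this, Subtype.range_coe]
    exact y.2
  have hi : IsUniformInducing e :=
    (AddMonoidHomClass.isometry_of_norm e fun _ => rfl).isUniformInducing
  have : CompleteSpace S := R.isClosed_topologicalClosure.completeSpace_coe
  refine ⟨(f.extend e) ∘L S.orthogonalProjectionOnto, ?_, ?_⟩
  · refine (ContinuousLinearMap.opNorm_comp_le _ _).trans ?_
    have h1 : ‖f.extend e‖ ≤ 1 := by
      refine (f.opNorm_extend_le hd he).trans ?_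
      simpa using hf
    exact mul_le_one₀ h1 (norm_nonneg _) S.orthogonalProjectionOnto_norm_le
  · ext x
    have hx : A x ∈ R := LinearMap.mem_range_self _ x
    have h1 : S.orthogonalProjectionOnto (A x) = e ⟨A x, hx⟩ :=
      S.orthogonalProjectionOnto_mem_subspace_eq_self (e ⟨A x, hx⟩)
    change f.extend e (S.orthogonalProjectionOnto (A x)) = B x
    rw [h1, f.extend_eq hd hi, hfA]

theorem norm_abs_apply (T : E →L[ℂ] E) (x : E) : ‖CFC.abs T x‖ = ‖T x‖ := by
  have hsa : IsSelfAdjoint (CFC.abs T) := (CFC.abs_nonneg T).isSelfAdjoint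
  have h2 : inner ℂ (CFC.abs T x) (CFC.abs T x) = inner ℂ (T x) (T x) := by
    rw [← ContinuousLinearMap.adjoint_inner_right, ← ContinuousLinearMap.adjoint_inner_right T,
      hsa.adjoint_eq]
    exact congrArg (fun S : E →L[ℂ] E => inner ℂ x (S x)) (CFC.abs_mul_abs T)
  rw [← sq_eq_sq₀ (norm_nonneg _) (norm_nonneg _), ← inner_self_eq_norm_sq (𝕜 := ℂ),
    ← inner_self_eq_norm_sq (𝕜 := ℂ), h2]

/-- Polar decomposition. -/
theorem exists_polar (T : E →L[ℂ] E) :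
    ∃ U : E →L[ℂ] E, ‖U‖ ≤ 1 ∧ U * CFC.abs T = T ∧ U.adjoint * T = CFC.abs T := by
  obtain ⟨U, hU, hUT⟩ := exists_mul_eq_of_norm_le (CFC.abs T) T fun x => (norm_abs_apply T x).ge
  refine ⟨U, hU, hUT, ?_⟩
  ext x
  have hUx : U (CFC.abs T x) = T x := DFunLike.congr_fun hUT x
  change U.adjoint (T x) = CFC.abs T x
  -- Expanding `‖U* T x - |T| x‖²` gives at most `‖T x‖² - 2 ‖T x‖² + ‖T x‖² = 0`, so it is enough
  -- that `U` is a contraction.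
  have h1 : ‖U.adjoint (T x)‖ ≤ ‖T x‖ := by
    refine (U.adjoint.le_opNorm _).trans ?_
    rw [LinearIsometryEquiv.norm_map]
    exact mul_le_of_le_one_left (norm_nonneg _) hU
  have h2 : RCLike.re (inner ℂ (U.adjoint (T x)) (CFC.abs T x)) = ‖T x‖ ^ 2 := by
    rw [ContinuousLinearMap.adjoint_inner_left, hUx, inner_self_eq_norm_sq]
  have h3 := norm_sub_sq (𝕜 := ℂ) (U.adjoint (T x)) (CFC.abs T x)
  rw [h2, norm_abs_apply] at h3
  rw [← sub_eq_zero, ← norm_eq_zero, ← sq_eq_zero_iff]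
  nlinarith [sq_nonneg ‖U.adjoint (T x) - CFC.abs T x‖, norm_nonneg (U.adjoint (T x))]

end Douglas

/-! ### Hilbert–Schmidt factorization and compactness of trace class operators. -/

section HilbertSchmidt

variable {E : Type*} [NormedAddCommGroup E] [InnerProductSpace ℂ E]
  {ι κ : Type*} (b : HilbertBasis ι ℂ E) (c : HilbertBasis κ ℂ E)

theorem _root_.HilbertBasis.hasSum_norm_inner_sq (x : E) :
    HasSum (fun i => ‖inner ℂ (b i) x‖ ^ 2) (‖x‖ ^ 2) := by
  have h := (b.hasSum_inner_mul_inner x x).mapL Complex.reCLM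
  have h1 : Complex.reCLM (inner ℂ x x) = ‖x‖ ^ 2 := inner_self_eq_norm_sq (𝕜 := ℂ) x
  rw [h1] at h
  refine h.congr_fun fun i => ?_
  rw [← inner_conj_symm x (b i)]
  change _ = ((starRingEnd ℂ) (inner ℂ (b i) x) * inner ℂ (b i) x).re
  rw [mul_comm, Complex.mul_conj, Complex.ofReal_re, Complex.normSq_eq_norm_sq]

/-- The square of the Hilbert–Schmidt norm. -/
noncomputable def hsq (T : E →L[ℂ] E) : ENNReal := ∑' i, ENNReal.ofReal (‖T (b i)‖ ^ 2)

/-- Both sides are the double sum of `|⟨c k, T* b i⟩|²`, in the two orders. For self-adjoint `T`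
this is independence of the basis; values in `ENNReal` avoid any summability hypothesis. -/
theorem hsq_adjoint [CompleteSpace E] (T : E →L[ℂ] E) : hsq b T.adjoint = hsq c T := by
  have h1 (i : ι) : ENNReal.ofReal (‖T.adjoint (b i)‖ ^ 2) =
      ∑' k, ENNReal.ofReal (‖inner ℂ (c k) (T.adjoint (b i))‖ ^ 2) := by
    have := c.hasSum_norm_inner_sq (T.adjoint (b i))
    rw [← this.tsum_eq, ENNReal.ofReal_tsum_of_nonneg (fun _ => by positivity) this.summable]
  have h2 (k : κ) : ENNReal.ofReal (‖T (c k)‖ ^ 2) =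
      ∑' i, ENNReal.ofReal (‖inner ℂ (b i) (T (c k))‖ ^ 2) := by
    have := b.hasSum_norm_inner_sq (T (c k))
    rw [← this.tsum_eq, ENNReal.ofReal_tsum_of_nonneg (fun _ => by positivity) this.summable]
  simp_rw [hsq, h1, h2]
  rw [ENNReal.tsum_comm]
  congr! 5 with k i
  rw [ContinuousLinearMap.adjoint_inner_right, ← inner_conj_symm, RCLike.norm_conj]

theorem hsq_mul_le (S T : E →L[ℂ] E) : hsq b (S * T) ≤ ENNReal.ofReal (‖S‖ ^ 2) * hsq b T := by
  rw [hsq, hsq, ← ENNReal.tsum_mul_left]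
  refine ENNReal.tsum_le_tsum fun i => ?_
  rw [← ENNReal.ofReal_mul (by positivity), ← mul_pow]
  exact ENNReal.ofReal_le_ofReal (pow_le_pow_left₀ (norm_nonneg _) (S.le_opNorm _) 2)

/-- A trace class operator factors through a self-adjoint Hilbert–Schmidt operator. -/
theorem IsTraceClass.exists_factor [CompleteSpace E] {V : E →L[ℂ] E} (hV : IsTraceClass V) :
    ∃ U B : E →L[ℂ] E, ‖U‖ ≤ 1 ∧ IsSelfAdjoint B ∧ V = U * B * B ∧ hsq (basis E) B ≠ ⊤ := by
  obtain ⟨w, b, hb⟩ := hV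
  obtain ⟨U, hU, hUV, -⟩ := exists_polar V
  have hnn := CFC.abs_nonneg V
  have hsa : IsSelfAdjoint (CFC.sqrt (CFC.abs V)) := (CFC.sqrt_nonneg _).isSelfAdjoint
  refine ⟨U, CFC.sqrt (CFC.abs V), hU, hsa, ?_, ?_⟩
  · rw [mul_assoc, CFC.sqrt_mul_sqrt_self _ hnn, hUV]
  -- Self-adjointness of `|V|^(1/2)` permits the passage from `basis E` to the basis `b` supplied by
  -- `IsTraceClass`.
  · rw [← hsa.adjoint_eq, hsq_adjoint (basis E) b, hsq]
    have (i : w) : ‖CFC.sqrt (CFC.abs V) (b i)‖ ^ 2 =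
        (inner ℂ (b i) ((CFC.abs V) (b i))).re := by
      have h1 : CFC.abs V (b i) = CFC.sqrt (CFC.abs V) (CFC.sqrt (CFC.abs V) (b i)) :=
        DFunLike.congr_fun (CFC.sqrt_mul_sqrt_self _ hnn).symm (b i)
      rw [h1]
      nth_rw 2 [← hsa.adjoint_eq]
      rw [ContinuousLinearMap.adjoint_inner_right]
      exact (inner_self_eq_norm_sq (𝕜 := ℂ) _).symm
    simp_rw [this]
    exact hb.tsum_ofReal_ne_top

/-- `B` is the norm limit of its finite rank truncations `P s`, the projection of `B x` to the
coordinates in `s`: by Parseval the squared error is at most the tail of `∑ ‖B (b i)‖²`. -/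
theorem isCompactOperator_of_hsq_ne_top [CompleteSpace E] {B : E →L[ℂ] E} (hB : IsSelfAdjoint B)
    (h : hsq b B ≠ ⊤) : IsCompactOperator B := by
  classical
  have hsum : Summable fun i => ‖B (b i)‖ ^ 2 := by
    have := ENNReal.summable_toReal h
    exact this.congr fun i => ENNReal.toReal_ofReal (by positivity)
  let P (s : Finset ι) : E →L[ℂ] E := ∑ i ∈ s, (innerSL ℂ (B (b i))).smulRight (b i)
  have hP (s : Finset ι) (x : E) : P s x = ∑ i ∈ s, inner ℂ (B (b i)) x • b i := by
    simp [P]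
  have hBx (i : ι) (x : E) : inner ℂ (B (b i)) x = inner ℂ (b i) (B x) := by
    nth_rw 1 [← hB.adjoint_eq]
    rw [ContinuousLinearMap.adjoint_inner_left]
  have hPc (s : Finset ι) : IsCompactOperator (P s) := by
    induction s using Finset.induction_on with
    | empty =>
      have : P ∅ = 0 := by simp [P]
      rw [this]
      exact isCompactOperator_zero
    | insert i s hi ih =>
      have : P (insert i s) = (innerSL ℂ (B (b i))).smulRight (b i) + P s := by
        simp only [P, Finset.sum_insert hi]
      rw [this]
      refine IsCompactOperator.add ?_ ih
      have h1 : IsCompactOperator (innerSL ℂ (B (b i)) : E → ℂ) :=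
        isCompactOperator_of_locallyCompactSpace_dom (innerSL ℂ (B (b i)))
      exact h1.clm_comp ((1 : ℂ →L[ℂ] ℂ).smulRight (b i))
  refine isCompactOperator_of_tendsto (l := Filter.atTop) (F := P) ?_
    (Filter.Eventually.of_forall hPc)
  rw [tendsto_iff_norm_sub_tendsto_zero]
  have ht := (tendsto_tsum_compl_atTop_zero fun i => ‖B (b i)‖ ^ 2).sqrt
  rw [Real.sqrt_zero] at ht
  refine squeeze_zero (fun _ => norm_nonneg _) (fun s => ?_) ht
  refine ContinuousLinearMap.opNorm_le_bound _ (Real.sqrt_nonneg _) fun x => ?_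
  refine le_of_sq_le_sq ?_ (by positivity)
  rw [mul_pow, Real.sq_sqrt (tsum_nonneg fun _ => by positivity)]
  have hd := b.hasSum_norm_inner_sq ((P s - B) x)
  have hco (j : ι) : ‖inner ℂ (b j) ((P s - B) x)‖ ^ 2 =
      ((↑s : Set ι)ᶜ).indicator (fun j => ‖inner ℂ (b j) (B x)‖ ^ 2) j := by
    have h1 : inner ℂ (b j) (P s x) = if j ∈ s then inner ℂ (b j) (B x) else 0 := by
      rw [hP, inner_sum]
      simp_rw [inner_smul_right, orthonormal_iff_ite.1 b.orthonormal, hBx]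
      simp
    change ‖inner ℂ (b j) (P s x - B x)‖ ^ 2 = _
    rw [inner_sub_right, h1]
    by_cases hj : j ∈ s <;> simp [hj]
  rw [← hd.tsum_eq]
  simp_rw [hco]
  rw [← tsum_subtype]
  have hs1 : Summable fun j : ↥((↑s : Set ι)ᶜ) => ‖B (b j)‖ ^ 2 * ‖x‖ ^ 2 :=
    (hsum.subtype _).mul_right _
  rw [← tsum_mul_right]
  refine Summable.tsum_le_tsum (fun j => ?_) ((b.hasSum_norm_inner_sq (B x)).summable.subtype _) hs1
  rw [← hBx, ← mul_pow]
  exact pow_le_pow_left₀ (norm_nonneg _) (norm_inner_le_norm _ _) 2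

theorem IsTraceClass.isCompactOperator [CompleteSpace E] {V : E →L[ℂ] E} (hV : IsTraceClass V) :
    IsCompactOperator V := by
  obtain ⟨U, B, -, hB, rfl, h⟩ := hV.exists_factor
  exact (isCompactOperator_of_hsq_ne_top (basis E) hB h).clm_comp (U * B)

end HilbertSchmidt

/-! ### Trace norm bounds by duality, and their behaviour under integration. -/

section TraceNorm

variable {E : Type*} [NormedAddCommGroup E] [InnerProductSpace ℂ E] [CompleteSpace E]

/-- `C` bounds the trace norm of `T`, expressed by duality. -/
def TraceNormLE (T : E →L[ℂ] E) (C : ℝ) : Prop :=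
  ∀ U : E →L[ℂ] E, ‖U‖ ≤ 1 → ∀ s : Finset (basisIndex E),
    ∑ i ∈ s, ‖inner ℂ (U (basis E i)) (T (basis E i))‖ ≤ C

theorem TraceNormLE.mono {T : E →L[ℂ] E} {C D : ℝ} (h : TraceNormLE T C) (hCD : C ≤ D) :
    TraceNormLE T D := fun U hU s => (h U hU s).trans hCD

theorem TraceNormLE.add {S T : E →L[ℂ] E} {C D : ℝ} (hS : TraceNormLE S C) (hT : TraceNormLE T D) :
    TraceNormLE (S + T) (C + D) := fun U hU s => by
  refine le_trans ?_ (add_le_add (hS U hU s) (hT U hU s))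
  rw [← Finset.sum_add_distrib]
  refine Finset.sum_le_sum fun i _ => ?_
  rw [add_apply, inner_add_right]
  exact norm_add_le _ _

theorem TraceNormLE.smul {T : E →L[ℂ] E} {C : ℝ} (hT : TraceNormLE T C) (a : ℂ) :
    TraceNormLE (a • T) (‖a‖ * C) := fun U hU s => by
  refine le_trans (le_of_eq ?_) (mul_le_mul_of_nonneg_left (hT U hU s) (norm_nonneg a))
  rw [Finset.mul_sum]
  refine Finset.sum_congr rfl fun i _ => ?_
  rw [smul_apply, inner_smul_right, norm_mul]

theorem TraceNormLE.neg {T : E →L[ℂ] E} {C : ℝ} (hT : TraceNormLE T C) : TraceNormLE (-T) C := by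
  simpa using hT.smul (-1)

/-- Testing with the `U` of the polar decomposition gives `⟨U bᵢ, T bᵢ⟩ = ⟨bᵢ, |T| bᵢ⟩`. -/
theorem TraceNormLE.isTraceClass {T : E →L[ℂ] E} {C : ℝ} (h : TraceNormLE T C) :
    IsTraceClass T := by
  obtain ⟨U, hU, -, hUT⟩ := exists_polar T
  refine ⟨basisIndex E, basis E, ?_⟩
  refine Summable.of_norm (summable_of_sum_le (c := C) (fun _ => norm_nonneg _) fun s => ?_)
  refine le_trans (Finset.sum_le_sum fun i _ => ?_) (h U hU s)
  rw [← hUT]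
  refine (Complex.abs_re_le_norm _).trans (le_of_eq ?_)
  change ‖inner ℂ (basis E i) (U.adjoint (T (basis E i)))‖ = _
  rw [ContinuousLinearMap.adjoint_inner_right]

theorem TraceNormLE.sum_norm_inner_le {T : E →L[ℂ] E} {C : ℝ} (h : TraceNormLE T C)
    (s : Finset (basisIndex E)) : ∑ i ∈ s, ‖inner ℂ (basis E i) (T (basis E i))‖ ≤ C :=
  h 1 ContinuousLinearMap.norm_id_le s

theorem TraceNormLE.summable_norm {T : E →L[ℂ] E} {C : ℝ} (h : TraceNormLE T C) :
    Summable fun i => ‖inner ℂ (basis E i) (T (basis E i))‖ :=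
  summable_of_sum_le (fun _ => norm_nonneg _) h.sum_norm_inner_le

theorem TraceNormLE.hasSum {T : E →L[ℂ] E} {C : ℝ} (h : TraceNormLE T C) :
    HasSum (fun i => inner ℂ (basis E i) (T (basis E i))) (trace T) :=
  h.summable_norm.of_norm.hasSum

theorem TraceNormLE.norm_trace_le {T : E →L[ℂ] E} {C : ℝ} (h : TraceNormLE T C) : ‖trace T‖ ≤ C :=
  (norm_tsum_le_tsum_norm h.summable_norm).trans
    (h.summable_norm.tsum_le_of_sum_le h.sum_norm_inner_le)

theorem TraceNormLE.trace_sub {S T : E →L[ℂ] E} {C D : ℝ} (hS : TraceNormLE S C)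
    (hT : TraceNormLE T D) : trace (S - T) = trace S - trace T := by
  have := hS.hasSum.sub hT.hasSum
  rw [← this.tsum_eq]
  refine tsum_congr fun i => ?_
  rw [sub_apply, inner_sub_right]

theorem trace_smul (a : ℂ) (T : E →L[ℂ] E) : trace (a • T) = a * trace T := by
  rw [trace, trace, ← tsum_mul_left]
  refine tsum_congr fun i => ?_
  rw [smul_apply, inner_smul_right]

/-- Write `V = U B B`. Each tested term is `⟨B U* A* W bᵢ, B C bᵢ⟩`, an inner product of columns of
two Hilbert–Schmidt operators, and Cauchy–Schwarz over `i` gives the bound with `K` the squared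
Hilbert–Schmidt norm of `B`. -/
theorem IsTraceClass.exists_traceNormLE {V : E →L[ℂ] E} (hV : IsTraceClass V) :
    ∃ K, 0 ≤ K ∧ ∀ A B : E →L[ℂ] E, TraceNormLE (A * V * B) (K * ‖A‖ * ‖B‖) := by
  obtain ⟨U, B, hU, hB, rfl, h⟩ := hV.exists_factor
  set K := (hsq (basis E) B).toReal
  have hK (C : E →L[ℂ] E) (s : Finset (basisIndex E)) :
      ∑ i ∈ s, ‖B (C (basis E i))‖ ^ 2 ≤ K * ‖C‖ ^ 2 := by
    have h1 : hsq (basis E) (B * C) ≤ ENNReal.ofReal (‖C‖ ^ 2) * hsq (basis E) B := by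
      -- Taking adjoints turns right multiplication by `C` into left multiplication, for which the
      -- bound holds vector by vector.
      rw [← hsq_adjoint (basis E) (basis E) (B * C)]
      change hsq (basis E) (star (B * C)) ≤ _
      rw [star_mul, hB.star_eq]
      refine (hsq_mul_le _ _ _).trans_eq ?_
      rw [norm_star]
    have h2 : ENNReal.ofReal (∑ i ∈ s, ‖B (C (basis E i))‖ ^ 2) ≤
        ENNReal.ofReal (K * ‖C‖ ^ 2) := by
      rw [ENNReal.ofReal_sum_of_nonneg fun _ _ => by positivity, mul_comm K,
        ENNReal.ofReal_mul (by positivity), ENNReal.ofReal_toReal h]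
      exact (ENNReal.sum_le_tsum s).trans h1
    exact (ENNReal.ofReal_le_ofReal_iff (by positivity)).1 h2
  refine ⟨K, by positivity, fun A C W hW s => ?_⟩
  have h1 (i : basisIndex E) : ‖inner ℂ (W (basis E i)) ((A * (U * B * B) * C) (basis E i))‖ ≤
      ‖B ((U.adjoint * A.adjoint * W) (basis E i))‖ * ‖B (C (basis E i))‖ := by
    change ‖inner ℂ (W (basis E i)) (A (U (B (B (C (basis E i))))))‖ ≤ _
    rw [← ContinuousLinearMap.adjoint_inner_left, ← ContinuousLinearMap.adjoint_inner_left,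
      ← ContinuousLinearMap.adjoint_inner_left, hB.adjoint_eq]
    exact norm_inner_le_norm _ _
  have h2 : ‖U.adjoint * A.adjoint * W‖ ≤ ‖A‖ := by
    refine (norm_mul_le _ _).trans ((mul_le_of_le_one_right (norm_nonneg _) hW).trans
      ((norm_mul_le _ _).trans ?_))
    rw [LinearIsometryEquiv.norm_map, LinearIsometryEquiv.norm_map]
    exact mul_le_of_le_one_left (norm_nonneg _) hU
  refine (Finset.sum_le_sum fun i _ => h1 i).trans ((Real.sum_mul_le_sqrt_mul_sqrt _ _ _).trans ?_)
  have hK0 : 0 ≤ K := ENNReal.toReal_nonneg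
  calc _ ≤ √(K * ‖A‖ ^ 2) * √(K * ‖C‖ ^ 2) := by
        gcongr
        · refine (hK _ s).trans ?_
          gcongr
        · exact hK _ s
    _ = K * ‖A‖ * ‖C‖ := by
        rw [Real.sqrt_mul hK0, Real.sqrt_mul hK0, Real.sqrt_sq (norm_nonneg _),
          Real.sqrt_sq (norm_nonneg _)]
        nth_rw 3 [← Real.mul_self_sqrt hK0]
        ring

/-- Orthonormal vectors are at distance `√2`, so separability allows only countably many.
Countability is needed to exchange the trace with integrals. -/
theorem countable_basisIndex [TopologicalSpace.SeparableSpace E] : Countable (basisIndex E) := by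
  have hd : Pairwise fun i j : basisIndex E =>
      Disjoint (Metric.ball (basis E i) (1 / 2)) (Metric.ball (basis E j) (1 / 2)) := by
    intro i j hij
    refine Metric.ball_disjoint_ball ?_
    have h := norm_sub_sq (𝕜 := ℂ) (basis E i) (basis E j)
    rw [(basis E).orthonormal.inner_eq_zero hij, (basis E).orthonormal.norm_eq_one,
      (basis E).orthonormal.norm_eq_one] at h
    rw [dist_eq_norm]
    norm_num at h ⊢
    nlinarith [norm_nonneg (basis E i - basis E j)]
  exact Pairwise.countable_of_isOpen_disjoint hd (fun _ => Metric.isOpen_ball)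
    fun i => ⟨_, Metric.mem_ball_self (by norm_num)⟩

open MeasureTheory in
-- Only finite sums are tested, so they commute with the integral, and no measurability of the trace
-- norm in the parameter is required.
theorem TraceNormLE.integral {α : Type*} [MeasurableSpace α] {μ : Measure α} {S : α → E →L[ℂ] E}
    {m : α → ℝ} (hS : Integrable S μ) (hm : Integrable m μ)
    (h : ∀ᵐ z ∂μ, TraceNormLE (S z) (m z)) : TraceNormLE (∫ z, S z ∂μ) (∫ z, m z ∂μ) := by
  intro U hU s
  have hint (i : basisIndex E) :
      Integrable (fun z => inner ℂ (U (basis E i)) (S z (basis E i))) μ :=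
    (innerSL ℂ (U (basis E i))).integrable_comp (hS.apply_continuousLinearMap (basis E i))
  have he (i : basisIndex E) : inner ℂ (U (basis E i)) ((∫ z, S z ∂μ) (basis E i)) =
      ∫ z, inner ℂ (U (basis E i)) (S z (basis E i)) ∂μ := by
    rw [ContinuousLinearMap.integral_apply hS]
    exact ((innerSL ℂ (U (basis E i))).integral_comp_comm
      (hS.apply_continuousLinearMap (basis E i))).symm
  calc _ ≤ ∑ i ∈ s, ∫ z, ‖inner ℂ (U (basis E i)) (S z (basis E i))‖ ∂μ := by
        refine Finset.sum_le_sum fun i _ => ?_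
        rw [he]
        exact norm_integral_le_integral_norm _
    _ = ∫ z, ∑ i ∈ s, ‖inner ℂ (U (basis E i)) (S z (basis E i))‖ ∂μ :=
        (integral_finsetSum _ fun i _ => (hint i).norm).symm
    _ ≤ ∫ z, m z ∂μ := by
        refine integral_mono_ae (integrable_finsetSum _ fun i _ => (hint i).norm) hm ?_
        filter_upwards [h] with z hz using hz U hU s

open MeasureTheory in
-- The finite partial sums of `∑ᵢ ∫ |⟨bᵢ, S bᵢ⟩|` are at most `∫ m`, so sum and integral may be
-- exchanged. The trace is measurable as a limit of finite sums along the countably generated filter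
-- of finite index sets.
theorem TraceNormLE.trace_integral [TopologicalSpace.SeparableSpace E] {α : Type*}
    [MeasurableSpace α] {μ : Measure α} {S : α → E →L[ℂ] E}
    {m : α → ℝ} (hS : Integrable S μ) (hm : Integrable m μ)
    (h : ∀ᵐ z ∂μ, TraceNormLE (S z) (m z)) :
    Integrable (fun z => trace (S z)) μ ∧ trace (∫ z, S z ∂μ) = ∫ z, trace (S z) ∂μ := by
  have : Countable (basisIndex E) := countable_basisIndex
  have hint (i : basisIndex E) :
      Integrable (fun z => inner ℂ (basis E i) (S z (basis E i))) μ :=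
    (innerSL ℂ (basis E i)).integrable_comp (hS.apply_continuousLinearMap (basis E i))
  have he (i : basisIndex E) : inner ℂ (basis E i) ((∫ z, S z ∂μ) (basis E i)) =
      ∫ z, inner ℂ (basis E i) (S z (basis E i)) ∂μ := by
    rw [ContinuousLinearMap.integral_apply hS]
    exact ((innerSL ℂ (basis E i)).integral_comp_comm
      (hS.apply_continuousLinearMap (basis E i))).symm
  have hsum : Summable fun i => ∫ z, ‖inner ℂ (basis E i) (S z (basis E i))‖ ∂μ := by
    refine summable_of_sum_le (c := ∫ z, m z ∂μ)
      (fun _ => integral_nonneg fun _ => norm_nonneg _) fun s => ?_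
    rw [← integral_finsetSum _ fun i _ => (hint i).norm]
    refine integral_mono_ae (integrable_finsetSum _ fun i _ => (hint i).norm) hm ?_
    filter_upwards [h] with z hz using hz.sum_norm_inner_le s
  refine ⟨?_, ?_⟩
  · refine hm.mono' ?_ (h.mono fun z hz => hz.norm_trace_le)
    have := aestronglyMeasurable_of_tendsto_ae (Filter.atTop : Filter (Finset (basisIndex E)))
      (f := fun s z => ∑ i ∈ s, inner ℂ (basis E i) (S z (basis E i))) (μ := μ)
      (g := fun z => trace (S z))
      (fun s => (integrable_finsetSum _ fun i _ => hint i).aestronglyMeasurable)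
      (h.mono fun z hz => hz.hasSum)
    exact this
  · have := hasSum_integral_of_summable_integral_norm hint hsum
    rw [← (show ∫ z, ∑' i, inner ℂ (basis E i) (S z (basis E i)) ∂μ =
      ∫ z, trace (S z) ∂μ from rfl), ← this.tsum_eq]
    exact tsum_congr he

end TraceNorm

/-! ### Stokes' formula for `∂_{z̄}` on the upper half plane. -/

section Stokes

open MeasureTheory Set Complex

variable {F : Type*} [NormedAddCommGroup F] [NormedSpace ℂ F]

/-- `G` is real differentiable at `z` with `∂_{z̄} G = d`. -/
def HasDbarAt (G : ℂ → F) (d : F) (z : ℂ) : Prop :=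
  ∃ G' : ℂ →L[ℝ] F, HasFDerivAt G G' z ∧ d = (1 / 2 : ℂ) • (G' 1 + I • G' I)

theorem HasDbarAt.unique {G : ℂ → F} {d d' : F} {z : ℂ} (h : HasDbarAt G d z)
    (h' : HasDbarAt G d' z) : d = d' := by
  obtain ⟨G₁, h₁, rfl⟩ := h
  obtain ⟨G₂, h₂, rfl⟩ := h'
  rw [h₁.unique h₂]

theorem HasDbarAt.eq_zero_of_eventuallyEq {G : ℂ → F} {d : F} {z : ℂ} (h : HasDbarAt G d z)
    (h0 : G =ᶠ[𝓝 z] 0) : d = 0 := by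
  refine h.unique ⟨0, ?_, by simp⟩
  exact (hasFDerivAt_const (0 : F) z).congr_of_eventuallyEq h0

theorem hasDbarAt_smul {g : ℂ → ℂ} {R : ℂ → F} {z : ℂ} (hg : DifferentiableAt ℝ g z)
    (hR : DifferentiableAt ℂ R z) : HasDbarAt (fun w => g w • R w) (dbar g z • R z) z := by
  refine ⟨_, hg.hasFDerivAt.smul (hR.hasFDerivAt.restrictScalars ℝ), ?_⟩
  have h1 : fderiv ℂ R z I = I • fderiv ℂ R z 1 := by
    rw [← map_smul, smul_eq_mul, mul_one]
  simp only [dbar, add_apply, smul_apply, ContinuousLinearMap.smulRight_apply,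
    ContinuousLinearMap.coe_restrictScalars', h1, smul_add, smul_smul]
  rw [show I * (g z * I) = -g z by linear_combination g z * I_mul_I]
  module

theorem volume_im_eq_zero : volume {z : ℂ | z.im = 0} = 0 := by
  have h : ({z : ℂ | z.im = 0} : Set ℂ) = (LinearMap.ker imLm : Submodule ℝ ℂ) := by
    ext z; simp
  rw [h]
  refine Measure.addHaar_submodule _ _ fun h => ?_
  have : I ∈ LinearMap.ker imLm := by rw [h]; trivial
  simp at this

theorem ae_im_ne_zero : ∀ᵐ z : ℂ, z.im ≠ 0 := by
  rw [ae_iff]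
  simpa using volume_im_eq_zero

theorem measurableSet_im_pos : MeasurableSet {z : ℂ | 0 < z.im} :=
  measurableSet_lt measurable_const measurable_im

/-- Stokes' formula on the upper half plane. -/
theorem integral_upperHalfPlane_dbar [CompleteSpace F] {G D : ℂ → F} {M : ℝ} (hM : 0 < M)
    (h0 : ∀ z : ℂ, M ≤ |z.re| ∨ M ≤ |z.im| → G z = 0) (hc : ContinuousOn G {z | 0 ≤ z.im})
    (hd : ∀ z : ℂ, 0 < z.im → HasDbarAt G (D z) z) (hi : IntegrableOn D {z | 0 < z.im}) :
    ∫ z in {z : ℂ | 0 < z.im}, D z = (2 * I)⁻¹ • ∫ x : ℝ, G x := by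
  -- The derivative is set to `0` off the open half plane, so that the integrand of the rectangle
  -- formula is globally the indicator of the half plane times `2 i D`.
  have hex (z : ℂ) : ∃ L : ℂ →L[ℝ] F,
      (0 < z.im → HasFDerivAt G L z ∧ I • L 1 - L I = (2 * I) • D z) ∧
        (¬ 0 < z.im → I • L 1 - L I = 0) := by
    by_cases hz : 0 < z.im
    · obtain ⟨L, h1, h2⟩ := hd z hz
      refine ⟨L, fun _ => ⟨h1, ?_⟩, fun h => absurd hz h⟩
      rw [h2, smul_smul, smul_add, smul_smul, show 2 * I * (1 / 2) = I by ring, I_mul_I,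
        neg_one_smul, sub_eq_add_neg]
    · exact ⟨0, fun h => absurd h hz, fun _ => by simp⟩
  obtain ⟨L, hLM⟩ : ∃ L, M < L := exists_gt M
  have hL : 0 < L := hM.trans hLM
  choose G' hG' hG'0 using hex
  have hD0 (z : ℂ) (hz : 0 < z.im) (h : M < |z.re| ∨ M < |z.im|) : D z = 0 := by
    refine (hd z hz).eq_zero_of_eventuallyEq ?_
    have ho : IsOpen {z : ℂ | M < |z.re| ∨ M < |z.im|} :=
      (isOpen_lt continuous_const (continuous_abs.comp continuous_re)).union
        (isOpen_lt continuous_const (continuous_abs.comp continuous_im))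
    filter_upwards [ho.mem_nhds h] with w hw
    exact h0 w (hw.imp le_of_lt le_of_lt)
  let Φ : ℂ → F := fun z => I • G' z 1 - G' z I
  have hΦ : Φ = {z : ℂ | 0 < z.im}.indicator fun z => (2 * I) • D z := by
    ext z
    by_cases hz : 0 < z.im
    · rw [indicator_of_mem (by exact hz)]
      exact (hG' z hz).2
    · rw [indicator_of_notMem (by exact hz)]
      exact hG'0 z hz
  have hΦi : Integrable Φ := by
    rw [hΦ, integrable_indicator_iff measurableSet_im_pos]
    exact hi.smul (2 * I)
  have hrect := integral_boundary_rect_of_continuousOn_of_hasFDerivAt_real G G' (⟨-L, 0⟩ : ℂ) ⟨L, L⟩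
    (hc.mono fun z hz => by
      have := (mem_reProdIm.1 hz).2
      rw [uIcc_of_le hL.le] at this
      exact this.1)
    (fun z hz => by
      have := (mem_reProdIm.1 hz).2
      simp only [min_eq_left hL.le] at this
      exact (hG' z this.1).1)
    hΦi.integrableOn
  have e1 : ∫ x : ℝ in (-L)..L, G (x + (0 : ℝ) * I) = ∫ x : ℝ, G x := by
    rw [intervalIntegral.integral_of_le (by linarith)]
    simp only [ofReal_zero, zero_mul, add_zero]
    refine setIntegral_eq_integral_of_forall_compl_eq_zero fun x hx => h0 _ (Or.inl ?_)
    rw [ofReal_re]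
    simp only [mem_Ioc, not_and_or, not_lt, not_le] at hx
    rcases hx with hx | hx
    · exact le_abs.2 (Or.inr (by linarith))
    · exact le_abs.2 (Or.inl (by linarith))
  have e2 : ∫ x : ℝ in (-L)..L, G (x + (L : ℝ) * I) = 0 := by
    refine (intervalIntegral.integral_congr fun x _ => ?_).trans intervalIntegral.integral_zero
    exact h0 _ (Or.inr (by simpa using hLM.le.trans (le_abs_self L)))
  have e3 : ∫ y : ℝ in (0 : ℝ)..L, G ((L : ℝ) + y * I) = 0 := by
    refine (intervalIntegral.integral_congr fun x _ => ?_).trans intervalIntegral.integral_zero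
    exact h0 _ (Or.inl (by simpa using hLM.le.trans (le_abs_self L)))
  have e4 : ∫ y : ℝ in (0 : ℝ)..L, G ((-L : ℝ) + y * I) = 0 := by
    refine (intervalIntegral.integral_congr fun x _ => ?_).trans intervalIntegral.integral_zero
    exact h0 _ (Or.inl (by simpa using hLM.le.trans (le_abs_self L)))
  have e5 : ∫ x : ℝ in (-L)..L, ∫ y : ℝ in (0 : ℝ)..L, Φ (x + y * I) = ∫ z, Φ z := by
    have hmp := volume_preserving_equiv_real_prod.symm
    rw [← hmp.integral_comp' (g := Φ), Measure.volume_eq_prod]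
    have hi' : Integrable (fun p : ℝ × ℝ => Φ (measurableEquivRealProd.symm p))
        (volume.prod volume) := by
      rw [← Measure.volume_eq_prod]
      exact hmp.integrable_comp_of_integrable hΦi
    rw [intervalIntegral.integral_of_le (by linarith)]
    simp_rw [intervalIntegral.integral_of_le hL.le]
    rw [← setIntegral_prod (fun p : ℝ × ℝ => Φ (p.1 + p.2 * I))]
    · have hcoe (p : ℝ × ℝ) : (p.1 + p.2 * I : ℂ) = measurableEquivRealProd.symm p := by
        apply Complex.ext <;> simp [measurableEquivRealProd]
      simp_rw [hcoe]
      refine setIntegral_eq_integral_of_forall_compl_eq_zero fun p hp => ?_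
      set z := measurableEquivRealProd.symm p with hz
      have hre : z.re = p.1 := by simp [hz, measurableEquivRealProd]
      have him : z.im = p.2 := by simp [hz, measurableEquivRealProd]
      rw [hΦ]
      by_cases hpos : 0 < z.im
      · rw [indicator_of_mem (by exact hpos)]
        rw [mem_prod, not_and_or, mem_Ioc, mem_Ioc, ← hre, ← him] at hp
        rw [hD0 z hpos, smul_zero]
        by_contra! hbd
        rw [abs_le, abs_le] at hbd
        rcases hp with hp | hp
        · exact hp ⟨by linarith, by linarith⟩
        · exact hp ⟨hpos, by linarith⟩
      · rw [indicator_of_notMem (by exact hpos)]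
    · have : (fun p : ℝ × ℝ => Φ (p.1 + p.2 * I)) =
          fun p : ℝ × ℝ => Φ (measurableEquivRealProd.symm p) := by
        ext p
        congr 1
        apply Complex.ext <;> simp [measurableEquivRealProd]
      rw [this]
      exact hi'.integrableOn
  have e6 : ∫ z, Φ z = (2 * I) • ∫ z in {z : ℂ | 0 < z.im}, D z := by
    rw [hΦ, integral_indicator measurableSet_im_pos, integral_smul]
  simp only at hrect
  rw [e1, e2, e3, e4] at hrect
  simp only [sub_zero, smul_zero, add_zero] at hrect
  rw [hrect, ← inv_smul_smul₀ (show (2 * I : ℂ) ≠ 0 by simp) (∫ z in {z : ℂ | 0 < z.im}, D z), ← e6,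
    ← e5]

end Stokes

/-! ### Stokes' formula on both half planes. -/

section HalfPlanes

open MeasureTheory Set Complex

variable {F : Type*} [NormedAddCommGroup F] [NormedSpace ℂ F]

theorem HasDbarAt.comp_neg {G : ℂ → F} {d : F} {z : ℂ} (h : HasDbarAt G d (-z)) :
    HasDbarAt (fun w => G (-w)) (-d) z := by
  obtain ⟨L, hL, rfl⟩ := h
  have hn : HasFDerivAt (fun w : ℂ => -w) (-ContinuousLinearMap.id ℝ ℂ) z :=
    (hasFDerivAt_id z).neg
  refine ⟨_, HasFDerivAt.comp z hL hn, ?_⟩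
  simp only [ContinuousLinearMap.comp_apply, neg_apply, ContinuousLinearMap.id_apply, map_neg]
  module

theorem measurableSet_halfPlane (s : ℝ) : MeasurableSet {z : ℂ | 0 < s * z.im} :=
  measurableSet_lt measurable_const (measurable_im.const_mul s)

/-- Stokes' formula on the half planes `±Im z > 0`. -/
theorem integral_halfPlane_dbar [CompleteSpace F] {s : ℝ} (hs : s = 1 ∨ s = -1) {G D : ℂ → F}
    {M : ℝ} (hM : 0 < M) (h0 : ∀ z : ℂ, M ≤ |z.re| ∨ M ≤ |z.im| → G z = 0)
    (hc : ContinuousOn G {z | 0 ≤ s * z.im})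
    (hd : ∀ z : ℂ, 0 < s * z.im → HasDbarAt G (D z) z)
    (hi : IntegrableOn D {z | 0 < s * z.im}) :
    ∫ z in {z : ℂ | 0 < s * z.im}, D z = (s : ℂ) • (2 * I)⁻¹ • ∫ x : ℝ, G x := by
  rcases hs with rfl | rfl
  · simp only [one_mul] at *
    rw [ofReal_one, one_smul]
    exact integral_upperHalfPlane_dbar hM h0 hc hd hi
  -- The lower half plane is reflected by `z ↦ -z`. This preserves area and the integral over the
  -- real line and reverses `∂_{z̄}`, whence the sign `s`.
  · simp only [neg_mul, one_mul, Left.neg_pos_iff, Left.nonneg_neg_iff] at *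
    have hpre : (fun z : ℂ => -z) ⁻¹' {z : ℂ | z.im < 0} = {z : ℂ | 0 < z.im} := by
      ext z; simp
    have hmp : MeasurePreserving (fun z : ℂ => -z) volume volume := Measure.measurePreserving_neg _
    have hme : MeasurableEmbedding (fun z : ℂ => -z) := (Homeomorph.neg ℂ).measurableEmbedding
    have hi' : IntegrableOn (fun z => -D (-z)) {z : ℂ | 0 < z.im} := by
      have := (hmp.integrableOn_comp_preimage hme (f := D) (s := {z : ℂ | z.im < 0})).2 hi
      rw [hpre] at this
      exact this.neg
    have := integral_upperHalfPlane_dbar (G := fun z => G (-z)) (D := fun z => -D (-z)) hM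
      (fun z hz => h0 _ (by simpa using hz))
      (hc.comp continuous_neg.continuousOn fun z hz => by simpa using hz)
      (fun z hz => (hd (-z) (by simpa using hz)).comp_neg) hi'
    rw [integral_neg] at this
    have e1 := hmp.setIntegral_preimage_emb hme D {z : ℂ | z.im < 0}
    rw [hpre] at e1
    have e2 : ∫ x : ℝ, G (-(x : ℂ)) = ∫ x : ℝ, G x := by
      simpa using integral_neg_eq_self (fun x : ℝ => G x) volume
    rw [← e1, ← neg_inj, this, e2]
    simp

theorem integral_eq_add_halfPlanes {D : ℂ → F} (hi : Integrable D) :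
    ∫ z, D z = (∫ z in {z : ℂ | 0 < (1 : ℝ) * z.im}, D z) +
      ∫ z in {z : ℂ | 0 < (-1 : ℝ) * z.im}, D z := by
  rw [← integral_add_compl (measurableSet_halfPlane 1) hi]
  congr 1
  refine setIntegral_congr_set ?_
  filter_upwards [ae_im_ne_zero] with z hz
  simp only [one_mul, neg_mul, Left.neg_pos_iff, eq_iff_iff]
  change ¬ (0 < z.im) ↔ z.im < 0
  rw [not_lt]
  exact ⟨fun h => lt_of_le_of_ne h hz, le_of_lt⟩

/-- The boundary terms of the two half planes are opposite. Continuity across the axis is enough;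
`G` need not be differentiable there. -/
theorem integral_dbar_eq_zero [CompleteSpace F] {G D : ℂ → F} {M : ℝ} (hM : 0 < M)
    (h0 : ∀ z : ℂ, M ≤ |z.re| ∨ M ≤ |z.im| → G z = 0) (hc : Continuous G)
    (hd : ∀ z : ℂ, z.im ≠ 0 → HasDbarAt G (D z) z) (hi : Integrable D) :
    ∫ z, D z = 0 := by
  rw [integral_eq_add_halfPlanes hi,
    integral_halfPlane_dbar (Or.inl rfl) hM h0 hc.continuousOn
      (fun z hz => hd z (fun h => by simp [h] at hz)) hi.integrableOn,
    integral_halfPlane_dbar (Or.inr rfl) hM h0 hc.continuousOn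
      (fun z hz => hd z (fun h => by simp [h] at hz)) hi.integrableOn]
  simp

end HalfPlanes

/-! ### Integrability of powers of `|Im z|`. -/

section IntegrablePowers

open MeasureTheory Set Complex

theorem integrableOn_abs_rpow {r : ℝ} (hr : -1 < r) (M : ℝ) :
    IntegrableOn (fun y : ℝ => |y| ^ r) (Ioc (-M) M) := by
  rcases le_or_gt M 0 with hM | hM
  · rw [Ioc_eq_empty (by linarith)]
    exact integrableOn_empty
  have h1 : IntegrableOn (fun y : ℝ => |y| ^ r) (Ioc 0 M) := by
    have := (intervalIntegrable_iff_integrableOn_Ioc_of_le hM.le).1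
      (intervalIntegral.intervalIntegrable_rpow' (a := 0) (b := M) hr)
    refine this.congr_fun (fun y hy => ?_) measurableSet_Ioc
    simp only [abs_of_pos hy.1]
  have h2 : IntegrableOn (fun y : ℝ => |y| ^ r) (Ico (-M) 0) := by
    have h := (Measure.measurePreserving_neg (volume : Measure ℝ)).integrableOn_comp_preimage
      (Homeomorph.neg ℝ).measurableEmbedding (f := fun y : ℝ => |y| ^ r) (s := Ioc 0 M)
    have hp : Neg.neg ⁻¹' Ioc (0 : ℝ) M = Ico (-M) 0 := by
      ext y
      simp only [mem_preimage, mem_Ioc, mem_Ico]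
      constructor <;> rintro ⟨a, b⟩ <;> constructor <;> linarith
    have h' := h.2 h1
    rw [hp] at h'
    simpa [Function.comp_def] using h'
  have h3 : IntegrableOn (fun y : ℝ => |y| ^ r) {0} := by simp
  refine ((h1.union h2).union h3).mono_set fun y hy => ?_
  rcases lt_trichotomy y 0 with h | h | h
  · exact Or.inl (Or.inr ⟨hy.1.le, h⟩)
  · exact Or.inr h
  · exact Or.inl (Or.inl ⟨h, hy.2⟩)

theorem integrableOn_box_abs_im_rpow {r : ℝ} (hr : -1 < r) (M : ℝ) :
    IntegrableOn (fun z : ℂ => |z.im| ^ r) (Ioc (-M) M ×ℂ Ioc (-M) M) := by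
  have hmp := volume_preserving_equiv_real_prod
  have h1 : Integrable (fun p : ℝ × ℝ => (1 : ℝ) * |p.2| ^ r)
      ((volume.restrict (Ioc (-M) M)).prod (volume.restrict (Ioc (-M) M))) :=
    Integrable.mul_prod (f := fun _ : ℝ => (1 : ℝ))
      (integrableOn_const (by simp) (by simp)) (integrableOn_abs_rpow hr M)
  rw [Measure.prod_restrict] at h1
  have h2 := (hmp.integrableOn_comp_preimage measurableEquivRealProd.measurableEmbedding).2 h1
  simp only [one_mul] at h2
  exact h2

theorem integrable_of_norm_le_abs_im_rpow {Y : Type*} [NormedAddCommGroup Y] {ψ : ℂ → Y}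
    (hm : AEStronglyMeasurable ψ volume)
    {r C M : ℝ} (hr : -1 < r) (h0 : ∀ z : ℂ, M ≤ |z.re| ∨ M ≤ |z.im| → ψ z = 0)
    (h : ∀ z : ℂ, z.im ≠ 0 → ‖ψ z‖ ≤ C * |z.im| ^ r) : Integrable ψ := by
  have hs : Function.support ψ ⊆ Ioc (-M) M ×ℂ Ioc (-M) M := by
    intro z hz
    have : ¬ (M ≤ |z.re| ∨ M ≤ |z.im|) := fun h => hz (h0 z h)
    simp only [not_or, not_le, abs_lt] at this
    exact ⟨⟨this.1.1, this.1.2.le⟩, ⟨this.2.1, this.2.2.le⟩⟩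
  rw [← integrableOn_iff_integrable_of_support_subset hs]
  refine Integrable.mono' ((integrableOn_box_abs_im_rpow hr M).const_mul C) hm.restrict ?_
  exact ae_restrict_of_ae (ae_im_ne_zero.mono h)

end IntegrablePowers

/-! ### The `∂_{z̄}` calculus and the almost analytic extension. -/

section Dbar

open Complex

theorem hasDbarAt_dbar {g : ℂ → ℂ} {z : ℂ} (hg : DifferentiableAt ℝ g z) :
    HasDbarAt g (dbar g z) z := ⟨_, hg.hasFDerivAt, rfl⟩

theorem HasDbarAt.dbar_eq {g : ℂ → ℂ} {d z : ℂ} (h : HasDbarAt g d z) : dbar g z = d := by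
  have hd : DifferentiableAt ℝ g z := h.choose_spec.1.differentiableAt
  exact (hasDbarAt_dbar hd).unique h

theorem HasDbarAt.add {F : Type*} [NormedAddCommGroup F] [NormedSpace ℂ F] {g h : ℂ → F} {d e : F}
    {z : ℂ} (hg : HasDbarAt g d z) (hh : HasDbarAt h e z) :
    HasDbarAt (fun w => g w + h w) (d + e) z := by
  obtain ⟨L, hL, rfl⟩ := hg
  obtain ⟨L', hL', rfl⟩ := hh
  refine ⟨_, hL.add hL', ?_⟩
  simp only [add_apply]
  module

theorem HasDbarAt.mul {g h : ℂ → ℂ} {d e z : ℂ} (hg : HasDbarAt g d z) (hh : HasDbarAt h e z) :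
    HasDbarAt (fun w => g w * h w) (d * h z + g z * e) z := by
  obtain ⟨L, hL, rfl⟩ := hg
  obtain ⟨L', hL', rfl⟩ := hh
  refine ⟨_, hL.mul hL', ?_⟩
  simp only [add_apply, smul_apply, smul_eq_mul]
  ring

theorem HasDbarAt.comp_re {u : ℝ → ℂ} {u' z : ℂ} (hu : HasDerivAt u u' z.re) :
    HasDbarAt (fun w => u w.re) (1 / 2 * u') z := by
  have h1 : HasFDerivAt (fun w : ℂ => w.re) reCLM z := reCLM.hasFDerivAt
  refine ⟨_, HasFDerivAt.comp z hu.hasFDerivAt h1, ?_⟩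
  simp

theorem hasDbarAt_I_mul_im (z : ℂ) : HasDbarAt (fun w => I * (w.im : ℂ)) (-(1 / 2)) z := by
  have h1 : HasFDerivAt (fun w : ℂ => (w.im : ℂ)) (ofRealCLM.comp imCLM) z :=
    (ofRealCLM.comp imCLM).hasFDerivAt
  refine ⟨_, h1.const_mul I, ?_⟩
  simp

theorem HasDbarAt.pow_succ {g : ℂ → ℂ} {d z : ℂ} (hg : HasDbarAt g d z) (k : ℕ) :
    HasDbarAt (fun w => g w ^ (k + 1)) ((k + 1) * g z ^ k * d) z := by
  obtain ⟨L, hL, rfl⟩ := hg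
  refine ⟨_, hL.pow (k + 1), ?_⟩
  simp only [smul_apply, smul_eq_mul]
  push_cast
  simp
  ring

/-- The Taylor polynomial part of the almost analytic extension. -/
noncomputable def taylorExt (f : ℝ → ℂ) (N : ℕ) (z : ℂ) : ℂ :=
  ∑ k ∈ Finset.range (N + 1),
    iteratedDeriv k f z.re / (k.factorial : ℂ) * (I * (z.im : ℂ)) ^ k

theorem almostAnalyticExt_eq (f : ℝ → ℂ) (N : ℕ) (τ : ℝ → ℂ) (z : ℂ) :
    almostAnalyticExt f N τ z = taylorExt f N z * chi τ z := rfl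

theorem taylorExt_succ (f : ℝ → ℂ) (N : ℕ) (z : ℂ) :
    taylorExt f (N + 1) z = taylorExt f N z +
      iteratedDeriv (N + 1) f z.re / ((N + 1).factorial : ℂ) * (I * (z.im : ℂ)) ^ (N + 1) := by
  rw [taylorExt, Finset.sum_range_succ, taylorExt]

theorem hasDerivAt_iteratedDeriv {f : ℝ → ℂ} (hf : ContDiff ℝ ∞ f) (k : ℕ) (x : ℝ) :
    HasDerivAt (iteratedDeriv k f) (iteratedDeriv (k + 1) f x) x := by
  rw [iteratedDeriv_succ]
  exact (hf.differentiable_iteratedDeriv k (mod_cast ENat.natCast_lt_top k) x).hasDerivAt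

/-- The sum telescopes: differentiating `f^(k)(x)` in the term of degree `k` cancels against
differentiating `(iy)^(k+1)` in the next, because `∂_{z̄} x = 1/2` and `∂_{z̄}(iy) = -1/2`. -/
theorem hasDbarAt_taylorExt {f : ℝ → ℂ} (hf : ContDiff ℝ ∞ f) (N : ℕ) (z : ℂ) :
    HasDbarAt (taylorExt f N)
      (1 / 2 * (iteratedDeriv (N + 1) f z.re / (N.factorial : ℂ) * (I * (z.im : ℂ)) ^ N)) z := by
  induction N with
  | zero =>
    have : taylorExt f 0 = fun w => f w.re := by
      ext w; simp [taylorExt]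
    rw [this]
    have h := HasDbarAt.comp_re (hasDerivAt_iteratedDeriv hf 0 z.re)
    simpa using h
  | succ N ih =>
    have h1 := (HasDbarAt.comp_re
      ((hasDerivAt_iteratedDeriv hf (N + 1) z.re).div_const ((N + 1).factorial : ℂ))).mul
      ((hasDbarAt_I_mul_im z).pow_succ N)
    have h2 := ih.add h1
    have e : taylorExt f (N + 1) = fun w => taylorExt f N w +
        iteratedDeriv (N + 1) f w.re / ((N + 1).factorial : ℂ) * (I * (w.im : ℂ)) ^ (N + 1) :=
      funext fun w => taylorExt_succ f N w
    rw [e]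
    convert h2 using 1
    have hN : ((N + 1).factorial : ℂ) = (N + 1) * N.factorial := by
      rw [Nat.factorial_succ]; push_cast; ring
    have h3 : (N.factorial : ℂ) ≠ 0 := by exact_mod_cast N.factorial_ne_zero
    have h4 : (N + 1 : ℂ) ≠ 0 := by exact_mod_cast N.succ_ne_zero
    rw [hN]
    field_simp
    ring

theorem contDiff_iteratedDeriv {f : ℝ → ℂ} (hf : ContDiff ℝ ∞ f) (k : ℕ) :
    ContDiff ℝ ∞ (iteratedDeriv k f) := by
  rw [iteratedDeriv_eq_iterate]
  exact hf.iterate_deriv k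

theorem contDiff_taylorExt {f : ℝ → ℂ} (hf : ContDiff ℝ ∞ f) (N : ℕ) :
    ContDiff ℝ ∞ (taylorExt f N) := by
  refine ContDiff.sum fun k _ => ?_
  have h1 : ContDiff ℝ ∞ fun z : ℂ => iteratedDeriv k f z.re :=
    (contDiff_iteratedDeriv hf k).comp reCLM.contDiff
  have h2 : ContDiff ℝ ∞ fun z : ℂ => I * (z.im : ℂ) :=
    contDiff_const.mul (ofRealCLM.comp imCLM).contDiff
  exact (h1.div_const _).mul (h2.pow k)

theorem contDiff_bracket : ContDiff ℝ ∞ bracket :=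
  ContDiff.sqrt (by fun_prop) fun x => by positivity

theorem bracket_pos (x : ℝ) : 0 < bracket x := one_pos.trans_le (one_le_bracket x)

theorem contDiff_chi {τ : ℝ → ℂ} (hτ : IsCutoff τ) : ContDiff ℝ ∞ (chi τ) := by
  have h1 : ContDiff ℝ ∞ fun z : ℂ => z.im / bracket z.re :=
    imCLM.contDiff.div (contDiff_bracket.comp reCLM.contDiff) fun z => (bracket_pos _).ne'
  exact hτ.1.comp h1

theorem contDiff_almostAnalyticExt {f : ℝ → ℂ} (hf : ContDiff ℝ ∞ f) (N : ℕ) {τ : ℝ → ℂ}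
    (hτ : IsCutoff τ) : ContDiff ℝ ∞ (almostAnalyticExt f N τ) :=
  (contDiff_taylorExt hf N).mul (contDiff_chi hτ)

theorem continuous_dbar {g : ℂ → ℂ} (hg : ContDiff ℝ ∞ g) : Continuous (dbar g) := by
  have h := hg.continuous_fderiv (by simp)
  unfold dbar
  fun_prop

theorem dbar_almostAnalyticExt {f : ℝ → ℂ} (hf : ContDiff ℝ ∞ f) (N : ℕ) {τ : ℝ → ℂ}
    (hτ : IsCutoff τ) (z : ℂ) :
    dbar (almostAnalyticExt f N τ) z =
      1 / 2 * (iteratedDeriv (N + 1) f z.re / (N.factorial : ℂ) * (I * (z.im : ℂ)) ^ N) * chi τ z +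
        taylorExt f N z * dbar (chi τ) z :=
  ((hasDbarAt_taylorExt hf N z).mul
    (hasDbarAt_dbar ((contDiff_chi hτ).differentiable (by simp) z))).dbar_eq

end Dbar

/-! ### Bounds for the cut-off and for `∂_{z̄} f̃`. -/

section Bounds

open Complex Set

theorem IsCutoff.exists_bounds {τ : ℝ → ℂ} (hτ : IsCutoff τ) :
    ∃ δ > 0, ∃ R > 0, (∀ s, |s| < δ → τ s = 1) ∧ ∀ s, R ≤ |s| → τ s = 0 := by
  obtain ⟨-, hc, h1⟩ := hτ
  obtain ⟨δ, hδ, h⟩ := Metric.eventually_nhds_iff.1 h1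
  obtain ⟨R, hR, h'⟩ := hc.isCompact.isBounded.subset_ball_lt 0 0
  refine ⟨δ, hδ, R, hR, fun s hs => h (by simpa using hs), fun s hs => ?_⟩
  by_contra hne
  have := h' (subset_tsupport τ hne)
  simp at this
  linarith

theorem chi_eq_one {τ : ℝ → ℂ} {δ : ℝ} (h : ∀ s, |s| < δ → τ s = 1) {z : ℂ} (hz : |z.im| < δ) :
    chi τ z = 1 := by
  refine h _ (lt_of_le_of_lt ?_ hz)
  rw [abs_div, abs_of_pos (bracket_pos _)]
  exact div_le_self (abs_nonneg _) (one_le_bracket _)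

theorem chi_eq_zero {τ : ℝ → ℂ} {R : ℝ} (h : ∀ s, R ≤ |s| → τ s = 0) {z : ℂ}
    (hz : R * bracket z.re ≤ |z.im|) : chi τ z = 0 := by
  refine h _ ?_
  rwa [abs_div, abs_of_pos (bracket_pos _), le_div_iff₀ (bracket_pos _)]

theorem continuous_bracket : Continuous bracket := contDiff_bracket.continuous

theorem exists_bracket_le {K : Set ℝ} (hK : IsCompact K) : ∃ B > 0, ∀ x ∈ K, bracket x ≤ B := by
  obtain ⟨B, hB⟩ := hK.exists_bound_of_continuousOn continuous_bracket.continuousOn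
  refine ⟨max B 1, by positivity, fun x hx => ?_⟩
  exact (le_abs_self _).trans ((hB x hx).trans (le_max_left _ _))

/-- Where `h` does not vanish, `|Im z| ≥ δ`, so a bound on a compact set is a bound by any power of
`|Im z|`. It handles `∂_{z̄} χ` and differences of cut-offs, which vanish near the axis. -/
theorem exists_bound_of_flat {h : ℂ → ℂ} (hc : Continuous h) {δ Y : ℝ} (hδ : 0 < δ) {K : Set ℝ}
    (hK : IsCompact K) (h0 : ∀ z : ℂ, |z.im| < δ → h z = 0)
    (hY : ∀ z : ℂ, z.re ∈ K → Y ≤ |z.im| → h z = 0) (m : ℕ) :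
    ∃ C ≥ 0, ∀ z : ℂ, z.re ∈ K → ‖h z‖ ≤ C * |z.im| ^ m := by
  have hQ : IsCompact (K ×ℂ Icc (-Y) Y) := hK.reProdIm isCompact_Icc
  obtain ⟨B, hB⟩ := hQ.exists_bound_of_continuousOn hc.continuousOn
  refine ⟨max B 0 / δ ^ m, by positivity, fun z hz => ?_⟩
  rcases lt_or_ge |z.im| δ with h1 | h1
  · rw [h0 z h1, norm_zero]; positivity
  · rcases le_or_gt Y |z.im| with h2 | h2
    · rw [hY z hz h2, norm_zero]; positivity
    · rw [div_mul_eq_mul_div, le_div_iff₀ (by positivity)]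
      have h3 := (hB z ⟨hz, abs_le.1 h2.le⟩).trans (le_max_left B 0)
      gcongr

theorem exists_dbar_chi_bound {τ : ℝ → ℂ} (hτ : IsCutoff τ) {K : Set ℝ} (hK : IsCompact K) :
    ∃ Y > 0, (∀ z : ℂ, z.re ∈ K → Y ≤ |z.im| → chi τ z = 0 ∧ dbar (chi τ) z = 0) ∧
      ∀ m : ℕ, ∃ C ≥ 0, ∀ z : ℂ, z.re ∈ K → ‖dbar (chi τ) z‖ ≤ C * |z.im| ^ m := by
  obtain ⟨δ, hδ, R, hR, h1, h2⟩ := hτ.exists_bounds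
  obtain ⟨B, hB, hKB⟩ := exists_bracket_le hK
  have hd (z : ℂ) := hasDbarAt_dbar ((contDiff_chi hτ).differentiable (by simp) z)
  have hY (z : ℂ) (hz : z.re ∈ K) (hz' : R * B + 1 ≤ |z.im|) :
      chi τ z = 0 ∧ dbar (chi τ) z = 0 := by
    have h3 : R * bracket z.re < |z.im| := by
      have := mul_le_mul_of_nonneg_left (hKB _ hz) hR.le
      linarith
    refine ⟨chi_eq_zero h2 h3.le, (hd z).eq_zero_of_eventuallyEq ?_⟩
    have ho : IsOpen {z : ℂ | R * bracket z.re < |z.im|} :=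
      isOpen_lt (continuous_const.mul (continuous_bracket.comp continuous_re))
        (continuous_abs.comp continuous_im)
    filter_upwards [ho.mem_nhds h3] with w hw using chi_eq_zero h2 (le_of_lt hw)
  refine ⟨R * B + 1, by positivity, hY, fun m => ?_⟩
  refine exists_bound_of_flat (continuous_dbar (contDiff_chi hτ)) hδ hK (fun z hz => ?_)
    (fun z hz h => (hY z hz h).2) m
  have ho : IsOpen {z : ℂ | |z.im| < δ} :=
    isOpen_lt (continuous_abs.comp continuous_im) continuous_const
  refine (hd z).unique ⟨0, ?_, by simp⟩
  refine (hasFDerivAt_const (1 : ℂ) z).congr_of_eventuallyEq ?_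
  filter_upwards [ho.mem_nhds hz] with w hw using chi_eq_one h1 hw

theorem norm_taylorExt_le (f : ℝ → ℂ) (N : ℕ) {z : ℂ} {Y : ℝ} (hz : |z.im| ≤ Y) :
    ‖taylorExt f N z‖ ≤
      (1 + Y) ^ N * ∑ k ∈ Finset.range (N + 1), ‖iteratedDeriv k f z.re‖ := by
  rw [Finset.mul_sum]
  refine norm_sum_le_of_le _ fun k hk => ?_
  rw [norm_mul, norm_div, norm_pow, norm_mul, norm_I, one_mul, norm_real, Real.norm_eq_abs,
    mul_comm]
  have hY : 0 ≤ Y := (abs_nonneg _).trans hz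
  have hk' : k ≤ N := Nat.lt_succ_iff.1 (Finset.mem_range.1 hk)
  refine mul_le_mul ?_ ?_ (by positivity) (by positivity)
  · calc |z.im| ^ k ≤ (1 + Y) ^ k := by gcongr; linarith
      _ ≤ _ := pow_le_pow_right₀ (by linarith) hk'
  · refine div_le_self (norm_nonneg _) ?_
    rw [Complex.norm_natCast]
    exact_mod_cast k.factorial_pos

/-- The constant does not depend on `f`; this uniformity is what makes the trace functional
continuous on test functions. -/
theorem exists_dbar_bound {τ : ℝ → ℂ} (hτ : IsCutoff τ) {K : Set ℝ} (hK : IsCompact K) (N : ℕ) :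
    ∃ C ≥ 0, ∀ f : ℝ → ℂ, ContDiff ℝ ∞ f → ∀ z : ℂ, z.re ∈ K →
      ‖dbar (almostAnalyticExt f N τ) z‖ ≤
        C * (∑ k ∈ Finset.range (N + 2), ‖iteratedDeriv k f z.re‖) * |z.im| ^ N := by
  obtain ⟨Y, hY, h0, hb⟩ := exists_dbar_chi_bound hτ hK
  obtain ⟨C, hC, hb⟩ := hb N
  obtain ⟨T, hT⟩ := hτ.1.continuous.bounded_above_of_compact_support hτ.2.1
  have hT0 : 0 ≤ T := (norm_nonneg _).trans (hT 0)
  refine ⟨T + (1 + Y) ^ N * C, by positivity, fun f hf z hz => ?_⟩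
  rw [dbar_almostAnalyticExt hf N hτ]
  set S := ∑ k ∈ Finset.range (N + 2), ‖iteratedDeriv k f z.re‖
  have hS1 : ‖iteratedDeriv (N + 1) f z.re‖ ≤ S :=
    Finset.single_le_sum (f := fun k => ‖iteratedDeriv k f z.re‖) (fun _ _ => norm_nonneg _)
      (Finset.self_mem_range_succ (N + 1))
  have hS2 : ∑ k ∈ Finset.range (N + 1), ‖iteratedDeriv k f z.re‖ ≤ S :=
    Finset.sum_le_sum_of_subset_of_nonneg (Finset.range_subset_range.2 (by omega))
      fun _ _ _ => norm_nonneg _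
  have hS0 : 0 ≤ S := (norm_nonneg _).trans hS1
  have t1 : ‖1 / 2 * (iteratedDeriv (N + 1) f z.re / (N.factorial : ℂ) *
      (I * (z.im : ℂ)) ^ N) * chi τ z‖ ≤ S * |z.im| ^ N * T := by
    rw [norm_mul, norm_mul, norm_mul, norm_div, norm_div, norm_pow, norm_mul, norm_I, one_mul,
      norm_real, Real.norm_eq_abs, Complex.norm_natCast]
    have a1 : ‖(1 : ℂ)‖ / ‖(2 : ℂ)‖ ≤ 1 := by norm_num
    have a2 : ‖iteratedDeriv (N + 1) f z.re‖ / (N.factorial : ℝ) ≤ S :=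
      (div_le_self (norm_nonneg _) (by exact_mod_cast N.factorial_pos)).trans hS1
    calc _ ≤ 1 * (S * |z.im| ^ N) * T := by
          gcongr
          exact hT _
      _ = _ := by ring
  have t2 : ‖taylorExt f N z * dbar (chi τ) z‖ ≤ (1 + Y) ^ N * C * S * |z.im| ^ N := by
    rcases le_or_gt Y |z.im| with h | h
    · rw [(h0 z hz h).2, mul_zero, norm_zero]; positivity
    · rw [norm_mul]
      calc _ ≤ ((1 + Y) ^ N * S) * (C * |z.im| ^ N) := by
            gcongr
            · exact (norm_taylorExt_le f N h.le).trans (by gcongr)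
            · exact hb z hz
        _ = _ := by ring
  calc _ ≤ S * |z.im| ^ N * T + (1 + Y) ^ N * C * S * |z.im| ^ N :=
        (norm_add_le _ _).trans (add_le_add t1 t2)
    _ = _ := by ring

end Bounds

/-! ### Supports, admissible cut-offs and comparison of two extensions. -/

section Supports

open Complex Set

theorem iteratedDeriv_eq_zero_of_notMem_tsupport {f : ℝ → ℂ} {x : ℝ} (hx : x ∉ tsupport f)
    (k : ℕ) : iteratedDeriv k f x = 0 := by
  have h : f =ᶠ[𝓝 x] fun _ => (0 : ℂ) := notMem_tsupport_iff_eventuallyEq.1 hx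
  rw [h.iteratedDeriv_eq k]
  simp

theorem exists_norm_iteratedDeriv_le {f : ℝ → ℂ} (hf : ContDiff ℝ ∞ f) (hc : HasCompactSupport f)
    (k : ℕ) : ∃ B ≥ 0, ∀ x, ‖iteratedDeriv k f x‖ ≤ B := by
  have h : HasCompactSupport (iteratedDeriv k f) := by
    refine HasCompactSupport.intro hc.isCompact fun x hx => ?_
    exact iteratedDeriv_eq_zero_of_notMem_tsupport hx k
  obtain ⟨B, hB⟩ := (contDiff_iteratedDeriv hf k).continuous.bounded_above_of_compact_support h
  exact ⟨B, (norm_nonneg _).trans (hB 0), hB⟩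

theorem taylorExt_eq_zero {f : ℝ → ℂ} {z : ℂ} (hz : z.re ∉ tsupport f) (N : ℕ) :
    taylorExt f N z = 0 :=
  Finset.sum_eq_zero fun k _ => by simp [iteratedDeriv_eq_zero_of_notMem_tsupport hz k]

theorem tsupport_almostAnalyticExt_subset (f : ℝ → ℂ) (N : ℕ) (τ : ℝ → ℂ) :
    tsupport (almostAnalyticExt f N τ) ⊆ re ⁻¹' tsupport f ∩ tsupport (chi τ) := by
  refine subset_inter ?_ (closure_mono fun z hz => right_ne_zero_of_mul hz)
  refine closure_minimal (fun z hz => ?_) ((isClosed_tsupport f).preimage continuous_re)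
  by_contra h
  exact hz (by rw [almostAnalyticExt_eq, taylorExt_eq_zero h, zero_mul])

theorem tsupport_chi_subset {τ : ℝ → ℂ} {R : ℝ} (h : ∀ s, R ≤ |s| → τ s = 0) :
    tsupport (chi τ) ⊆ {z | |z.im| ≤ R * bracket z.re} := by
  refine closure_minimal (fun z hz => ?_) ?_
  · by_contra hlt
    exact hz (chi_eq_zero h (le_of_lt (not_le.1 hlt)))
  · exact isClosed_le (continuous_abs.comp continuous_im)
      (continuous_const.mul (continuous_bracket.comp continuous_re))

theorem hasCompactSupport_almostAnalyticExt {f : ℝ → ℂ} (hf : HasCompactSupport f) (N : ℕ)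
    {τ : ℝ → ℂ} (hτ : IsCutoff τ) : HasCompactSupport (almostAnalyticExt f N τ) := by
  obtain ⟨δ, hδ, R, hR, -, h⟩ := hτ.exists_bounds
  obtain ⟨B, hB, hKB⟩ := exists_bracket_le hf.isCompact
  refine (hf.isCompact.reProdIm (isCompact_Icc (a := -(R * B)) (b := R * B))).of_isClosed_subset
    (isClosed_tsupport _) fun z hz => ?_
  obtain ⟨h1, h2⟩ := tsupport_almostAnalyticExt_subset f N τ hz
  refine ⟨h1, abs_le.1 ?_⟩
  exact (tsupport_chi_subset h h2).trans (mul_le_mul_of_nonneg_left (hKB _ h1) hR.le)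

theorem exists_box {g : ℂ → ℂ} (hg : HasCompactSupport g) :
    ∃ M > 0, ∀ z : ℂ, M ≤ |z.re| ∨ M ≤ |z.im| → z ∉ tsupport g := by
  obtain ⟨M, hM, h⟩ := hg.isCompact.isBounded.subset_ball_lt 0 0
  refine ⟨M, hM, fun z hz hmem => ?_⟩
  have := h hmem
  rw [mem_ball_zero_iff] at this
  rcases hz with hz | hz
  · exact absurd (hz.trans (abs_re_le_norm z)) (not_le.2 this)
  · exact absurd (hz.trans (abs_im_le_norm z)) (not_le.2 this)

theorem dbar_eq_zero_of_notMem_tsupport {g : ℂ → ℂ} {z : ℂ} (hz : z ∉ tsupport g) :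
    dbar g z = 0 := by
  have h : g =ᶠ[𝓝 z] 0 := notMem_tsupport_iff_eventuallyEq.1 hz
  have : fderiv ℝ g z = 0 := by
    rw [h.fderiv_eq]
    exact fderiv_const_apply (0 : ℂ)
  simp [dbar, this]

theorem exists_cutoff {r : ℝ} (hr : 0 < r) : ∃ τ, IsCutoff τ ∧ ∀ s, r ≤ |s| → τ s = 0 := by
  let φ : ContDiffBump (0 : ℝ) := ⟨r / 2, r, by positivity, by linarith⟩
  refine ⟨fun s => (φ s : ℂ), ⟨?_, ?_, ?_⟩, fun s hs => ?_⟩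
  · exact ofRealCLM.contDiff.comp φ.contDiff
  · exact φ.hasCompactSupport.comp_left (g := ((↑) : ℝ → ℂ)) ofReal_zero
  · filter_upwards [φ.eventuallyEq_one] with s hs
    rw [hs]; simp
  · change ((φ s : ℝ) : ℂ) = 0
    rw [φ.zero_of_le_dist (by simpa using hs), ofReal_zero]

/-- Finitely many non-real eigenvalues have `|Im z| / ⟨Re z⟩` bounded below by a positive number,
and `χ` lives where this ratio is at most `r`. -/
theorem exists_admissible {E : Type*} [NormedAddCommGroup E] [InnerProductSpace ℂ E]
    {A : E →ₗ.[ℂ] E} {I : Set ℝ} (h : (nonrealEigenvalues A I).Finite) :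
    ∃ r₀ > 0, ∀ r, 0 < r → r < r₀ → ∀ τ, IsCutoff τ → (∀ s, r ≤ |s| → τ s = 0) →
      IsAdmissible A I τ := by
  have h1 : ∀ᶠ r in 𝓝 (0 : ℝ), ∀ z ∈ nonrealEigenvalues A I, r * bracket z.re < |z.im| := by
    rw [Filter.eventually_all_finite h]
    intro z hz
    have hc : Continuous fun r : ℝ => r * bracket z.re := by fun_prop
    have := hc.tendsto 0
    rw [zero_mul] at this
    exact this.eventually_lt_const (abs_pos.2 hz.2.1)
  obtain ⟨r₀, hr₀, h2⟩ := Metric.eventually_nhds_iff.1 h1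
  refine ⟨r₀, hr₀, fun r hr hr' τ hτ hs => ⟨hτ, ?_⟩⟩
  rw [Set.disjoint_left]
  intro z hz hz'
  have h3 := h2 (y := r) (by rwa [Real.dist_eq, sub_zero, abs_of_pos hr]) z hz'
  exact absurd (tsupport_chi_subset hs hz) (not_le.2 h3)

theorem exists_taylorExt_sub_bound {f : ℝ → ℂ} (hf : ContDiff ℝ ∞ f) (hc : HasCompactSupport f)
    {Y : ℝ} (hY : 0 < Y) {N N' : ℕ} (h : N ≤ N') :
    ∃ C ≥ 0, ∀ z : ℂ, |z.im| ≤ Y →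
      ‖taylorExt f N' z - taylorExt f N z‖ ≤ C * |z.im| ^ (N + 1) := by
  induction N', h using Nat.le_induction with
  | base => exact ⟨0, le_rfl, fun z _ => by simp⟩
  | succ m hm ih =>
    obtain ⟨C, hC, h⟩ := ih
    obtain ⟨B, hB, hfB⟩ := exists_norm_iteratedDeriv_le hf hc (m + 1)
    refine ⟨C + B * Y ^ (m - N), by positivity, fun z hz => ?_⟩
    rw [taylorExt_succ, add_sub_right_comm, add_mul]
    refine (norm_add_le _ _).trans (add_le_add (h z hz) ?_)
    rw [norm_mul, norm_div, norm_pow, norm_mul, norm_I, one_mul, norm_real, Real.norm_eq_abs,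
      Complex.norm_natCast, mul_assoc]
    have e : |z.im| ^ (m + 1) = |z.im| ^ (m - N) * |z.im| ^ (N + 1) := by
      rw [← pow_add]; congr 1; omega
    rw [e]
    gcongr
    exact (div_le_self (norm_nonneg _) (by exact_mod_cast (m + 1).factorial_pos)).trans (hfB _)

/-- The additional Taylor terms start at degree `N + 1`, and the two cut-offs agree near the axis.
The gain of one order over `∂_{z̄} f̃` makes the difference times the resolvent continuous at the
axis. -/
theorem exists_almostAnalyticExt_sub_bound {f : ℝ → ℂ} (hf : ContDiff ℝ ∞ f)
    (hc : HasCompactSupport f) {N N' : ℕ} (h : N ≤ N') {τ τ' : ℝ → ℂ} (hτ : IsCutoff τ)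
    (hτ' : IsCutoff τ') :
    ∃ C ≥ 0, ∀ z : ℂ, ‖almostAnalyticExt f N' τ' z - almostAnalyticExt f N τ z‖ ≤
      C * |z.im| ^ (N + 1) := by
  obtain ⟨Y₁, hY₁, h₁, -⟩ := exists_dbar_chi_bound hτ hc.isCompact
  obtain ⟨Y₂, hY₂, h₂, -⟩ := exists_dbar_chi_bound hτ' hc.isCompact
  obtain ⟨δ₁, hδ₁, -, -, h₁', -⟩ := hτ.exists_bounds
  obtain ⟨δ₂, hδ₂, -, -, h₂', -⟩ := hτ'.exists_bounds
  set Y := max Y₁ Y₂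
  have hY : 0 < Y := hY₁.trans_le (le_max_left _ _)
  obtain ⟨C₁, hC₁, b₁⟩ := exists_taylorExt_sub_bound hf hc hY h
  obtain ⟨C₂, hC₂, b₂⟩ := exists_bound_of_flat (h := fun z => chi τ' z - chi τ z)
    ((contDiff_chi hτ').continuous.sub (contDiff_chi hτ).continuous) (lt_min hδ₁ hδ₂)
    (K := tsupport f) hc.isCompact (Y := Y)
    (fun z hz => by
      rw [chi_eq_one h₁' (hz.trans_le (min_le_left _ _)),
        chi_eq_one h₂' (hz.trans_le (min_le_right _ _)), sub_self])
    (fun z hz hz' => by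
      rw [(h₁ z hz ((le_max_left _ _).trans hz')).1, (h₂ z hz ((le_max_right _ _).trans hz')).1,
        sub_self]) (N + 1)
  obtain ⟨T, hT⟩ := hτ'.1.continuous.bounded_above_of_compact_support hτ'.2.1
  have hT0 : 0 ≤ T := (norm_nonneg _).trans (hT 0)
  choose B hB hfB using exists_norm_iteratedDeriv_le hf hc
  set S := ∑ k ∈ Finset.range (N + 1), B k
  have hS : 0 ≤ S := Finset.sum_nonneg fun k _ => hB k
  refine ⟨C₁ * T + (1 + Y) ^ N * S * C₂, by positivity, fun z => ?_⟩
  by_cases hz : z.re ∈ tsupport f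
  · rcases le_or_gt |z.im| Y with hy | hy
    · have e : almostAnalyticExt f N' τ' z - almostAnalyticExt f N τ z =
          (taylorExt f N' z - taylorExt f N z) * chi τ' z +
            taylorExt f N z * (chi τ' z - chi τ z) := by
        rw [almostAnalyticExt_eq, almostAnalyticExt_eq]; ring
      rw [e]
      refine (norm_add_le _ _).trans ?_
      rw [norm_mul, norm_mul]
      have hS' : ‖taylorExt f N z‖ ≤ (1 + Y) ^ N * S := by
        refine (norm_taylorExt_le f N hy).trans ?_
        gcongr
        exact Finset.sum_le_sum fun k _ => hfB k _
      calc _ ≤ (C₁ * |z.im| ^ (N + 1)) * T + ((1 + Y) ^ N * S) * (C₂ * |z.im| ^ (N + 1)) := by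
            gcongr
            · exact b₁ z hy
            · exact hT _
            · exact b₂ z hz
        _ = _ := by ring
    · rw [almostAnalyticExt_eq, almostAnalyticExt_eq, (h₁ z hz ((le_max_left _ _).trans hy.le)).1,
        (h₂ z hz ((le_max_right _ _).trans hy.le)).1, mul_zero, mul_zero, sub_self, norm_zero]
      positivity
  · rw [almostAnalyticExt_eq, almostAnalyticExt_eq, taylorExt_eq_zero hz, taylorExt_eq_zero hz]
    simp only [zero_mul, sub_self, norm_zero]
    positivity

theorem exists_dbar_almostAnalyticExt_bound {f : ℝ → ℂ} (hf : ContDiff ℝ ∞ f)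
    (hc : HasCompactSupport f) (N : ℕ) {τ : ℝ → ℂ} (hτ : IsCutoff τ) :
    ∃ C ≥ 0, ∀ z : ℂ, ‖dbar (almostAnalyticExt f N τ) z‖ ≤ C * |z.im| ^ N := by
  obtain ⟨C, hC, h⟩ := exists_dbar_bound hτ hc.isCompact N
  choose B hB hfB using exists_norm_iteratedDeriv_le hf hc
  have hS : 0 ≤ ∑ k ∈ Finset.range (N + 2), B k := Finset.sum_nonneg fun k _ => hB k
  refine ⟨C * ∑ k ∈ Finset.range (N + 2), B k, by positivity, fun z => ?_⟩
  by_cases hz : z.re ∈ tsupport f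
  · refine (h f hf z hz).trans ?_
    gcongr
    exact hfB _ _
  · rw [dbar_eq_zero_of_notMem_tsupport fun h' =>
      hz (tsupport_almostAnalyticExt_subset f N τ h').1, norm_zero]
    positivity

end Supports

/-! ### Products of a scalar function with a singular operator function. -/

section StokesSmul

open MeasureTheory Complex Set

variable {F : Type*} [NormedAddCommGroup F] [NormedSpace ℂ F]

theorem aestronglyMeasurable_smul_of_continuousOn {ψ : ℂ → ℂ} (hψ : Continuous ψ) {R : ℂ → F}
    {U : Set ℂ} (hU : IsOpen U) (hR : ContinuousOn R U)
    (h : ∀ z : ℂ, z.im ≠ 0 → ψ z ≠ 0 → z ∈ U) :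
    AEStronglyMeasurable (fun z => ψ z • R z) volume := by
  have h1 : AEStronglyMeasurable (U.indicator fun z => ψ z • R z) volume := by
    rw [aestronglyMeasurable_indicator_iff hU.measurableSet]
    exact (hψ.continuousOn.smul hR).aestronglyMeasurable hU.measurableSet
  refine h1.congr ?_
  filter_upwards [ae_im_ne_zero] with z hz
  by_cases hzU : z ∈ U
  · rw [indicator_of_mem hzU]
  · rw [indicator_of_notMem hzU]
    have : ψ z = 0 := by
      by_contra hne
      exact hzU (h z hz hne)
    rw [this, zero_smul]

theorem integrable_smul_of_bounds {ψ : ℂ → ℂ} (hψ : Continuous ψ) {M : ℝ}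
    (hM : ∀ z : ℂ, M ≤ |z.re| ∨ M ≤ |z.im| → ψ z = 0) {R : ℂ → F} {U : Set ℂ} (hU : IsOpen U)
    (hR : ContinuousOn R U) {m : ℕ} {p C C' : ℝ} (hC : 0 ≤ C)
    (hC' : 0 ≤ C') (hψb : ∀ z : ℂ, ‖ψ z‖ ≤ C * |z.im| ^ m)
    (hRb : ∀ z : ℂ, z.im ≠ 0 → ψ z ≠ 0 → z ∈ U ∧ ‖R z‖ ≤ C' * |z.im| ^ (-p)) (hp : p < m + 1) :
    Integrable (fun z => ψ z • R z) := by
  refine integrable_of_norm_le_abs_im_rpow (r := m - p) (C := C * C') (M := M)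
    (aestronglyMeasurable_smul_of_continuousOn hψ hU hR fun z hz h => (hRb z hz h).1)
    (by linarith) (fun z hz => by rw [hM z hz, zero_smul]) fun z hz => ?_
  have hpos : 0 < |z.im| := abs_pos.2 hz
  by_cases h0 : ψ z = 0
  · rw [h0, zero_smul, norm_zero]
    positivity
  · rw [norm_smul, sub_eq_add_neg, Real.rpow_add hpos, Real.rpow_natCast]
    calc _ ≤ (C * |z.im| ^ m) * (C' * |z.im| ^ (-p)) :=
          mul_le_mul (hψb z) (hRb z hz h0).2 (norm_nonneg _) (by positivity)
      _ = _ := by ring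

/-- `g R` is continuous across the real axis if `g` vanishes there fast enough. -/
theorem continuous_smul_of_bounds {g : ℂ → ℂ} (hg : Continuous g) {R : ℂ → F}
    (hR : ∀ z ∈ tsupport g, z.im ≠ 0 → ContinuousAt R z) {m : ℕ} {p C C' : ℝ} (hC : 0 ≤ C)
    (hC' : 0 ≤ C') (hgb : ∀ z : ℂ, ‖g z‖ ≤ C * |z.im| ^ (m + 1))
    (hRb : ∀ z ∈ tsupport g, z.im ≠ 0 → ‖R z‖ ≤ C' * |z.im| ^ (-p)) (hp : p < m + 1) :
    Continuous fun z => g z • R z := by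
  rw [continuous_iff_continuousAt]
  intro z
  by_cases hz : z.im = 0
  · have hb (w : ℂ) : ‖g w • R w‖ ≤ C * C' * |w.im| ^ (((m + 1 : ℕ) : ℝ) - p) := by
      by_cases hw : w.im = 0
      · have := hgb w
        rw [hw, abs_zero, zero_pow (Nat.succ_ne_zero m), mul_zero] at this
        rw [norm_le_zero_iff.1 this, zero_smul, norm_zero]
        positivity
      · have hpos : 0 < |w.im| := abs_pos.2 hw
        by_cases hws : w ∈ tsupport g
        · rw [norm_smul, sub_eq_add_neg, Real.rpow_add hpos, Real.rpow_natCast]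
          calc _ ≤ (C * |w.im| ^ (m + 1)) * (C' * |w.im| ^ (-p)) :=
                mul_le_mul (hgb w) (hRb w hws hw) (norm_nonneg _) (by positivity)
            _ = _ := by ring
        · rw [image_eq_zero_of_notMem_tsupport hws, zero_smul, norm_zero]
          positivity
    have hexp : 0 < ((m + 1 : ℕ) : ℝ) - p := by push_cast; linarith
    have h0 : g z • R z = 0 := by
      have := hb z
      rw [hz, abs_zero, Real.zero_rpow hexp.ne', mul_zero] at this
      exact norm_le_zero_iff.1 this
    rw [ContinuousAt, h0]
    refine squeeze_zero_norm hb ?_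
    have hcont : Continuous fun w : ℂ => C * C' * |w.im| ^ (((m + 1 : ℕ) : ℝ) - p) :=
      continuous_const.mul ((continuous_abs.comp continuous_im).rpow_const
        fun _ => Or.inr hexp.le)
    have := hcont.tendsto z
    rwa [hz, abs_zero, Real.zero_rpow hexp.ne', mul_zero] at this
  · by_cases hzs : z ∈ tsupport g
    · exact hg.continuousAt.smul (hR z hzs hz)
    · have h : g =ᶠ[𝓝 z] 0 := notMem_tsupport_iff_eventuallyEq.1 hzs
      refine (continuousAt_const (y := (0 : F))).congr ?_
      filter_upwards [h] with w hw
      rw [hw, Pi.zero_apply, zero_smul]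

/-- Off the support of `g` the product is locally zero, so `R` may be arbitrary there, for instance
at eigenvalues outside the support. -/
theorem hasDbarAt_smul_of_tsupport {g : ℂ → ℂ} (hg : Differentiable ℝ g) {R : ℂ → F} {z : ℂ}
    (hR : z ∈ tsupport g → DifferentiableAt ℂ R z) :
    HasDbarAt (fun w => g w • R w) (dbar g z • R z) z := by
  by_cases hz : z ∈ tsupport g
  · exact hasDbarAt_smul (hg z) (hR hz)
  · rw [dbar_eq_zero_of_notMem_tsupport hz, zero_smul]
    have h : g =ᶠ[𝓝 z] 0 := notMem_tsupport_iff_eventuallyEq.1 hz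
    refine ⟨0, ?_, by simp⟩
    refine (hasFDerivAt_const (0 : F) z).congr_of_eventuallyEq ?_
    filter_upwards [h] with w hw
    rw [hw, Pi.zero_apply, zero_smul]

theorem integral_dbar_smul_eq_zero [CompleteSpace F] {g : ℂ → ℂ} (hg : Differentiable ℝ g)
    (hgc : HasCompactSupport g) {R : ℂ → F}
    (hR : ∀ z ∈ tsupport g, z.im ≠ 0 → DifferentiableAt ℂ R z)
    (hc : Continuous fun z => g z • R z) (hi : Integrable fun z => dbar g z • R z) :
    ∫ z, dbar g z • R z = 0 := by
  obtain ⟨M, hM, hb⟩ := exists_box hgc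
  exact integral_dbar_eq_zero hM (fun z hz => by
    rw [image_eq_zero_of_notMem_tsupport (hb z hz), zero_smul]) hc
    (fun z hz => hasDbarAt_smul_of_tsupport hg fun h => hR z h hz) hi

end StokesSmul

/-! ### The Helffer–Sjöstrand integral is well defined. -/

section FunctionalCalculusWellDefined

open MeasureTheory Complex Set

variable {E : Type*} [NormedAddCommGroup E] [InnerProductSpace ℂ E] [CompleteSpace E]
  {A : E →ₗ.[ℂ] E} {I : Set ℝ} {n : ℝ}

/-- Near the axis this is the hypothesis with `⟨Re z⟩` bounded on `Q`. Where `|Im z| ≥ a` the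
resolvent is continuous on a compact set, and `|Im z| ≤ Y` converts its bound into the required
power. -/
theorem ResolventEstimate.exists_bound (hE : ResolventEstimate A I n) (hn : 0 < n) {Q : Set ℂ}
    (hQ : IsCompact Q) (hQI : ∀ z ∈ Q, z.re ∈ I)
    (hQρ : ∀ z ∈ Q, z.im ≠ 0 → z ∈ resolventSet A) :
    ∃ C ≥ 0, ∀ z ∈ Q, z.im ≠ 0 → ‖resolvent A z‖ ≤ C * |z.im| ^ (-(n + 1)) := by
  obtain ⟨a, ha, c, hc, -, hb⟩ := hE
  obtain ⟨B, hB, hQB⟩ := exists_bracket_le (hQ.image continuous_re)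
  obtain ⟨Y, hY, hQY⟩ := hQ.isBounded.subset_ball_lt 0 0
  have hfar : IsCompact (Q ∩ {z : ℂ | a ≤ |z.im|}) :=
    hQ.inter_right (isClosed_le continuous_const (continuous_abs.comp continuous_im))
  obtain ⟨D, hD⟩ := hfar.exists_bound_of_continuousOn
    ((continuousOn_resolvent A).mono fun z hz => hQρ z hz.1 fun h => by
      have : a ≤ |z.im| := hz.2
      rw [h, abs_zero] at this
      linarith)
  refine ⟨c * B ^ n + max D 0 * Y ^ (n + 1), by positivity, fun z hz hz0 => ?_⟩
  have hpos : 0 < |z.im| := abs_pos.2 hz0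
  have hp : 0 ≤ |z.im| ^ (-(n + 1)) := by positivity
  rw [add_mul]
  rcases lt_or_ge |z.im| a with h | h
  · refine le_add_of_le_of_nonneg ?_ (by positivity)
    refine (hb z ⟨hQI z hz, hpos, h⟩).trans ?_
    rw [Real.div_rpow (bracket_pos _).le hpos.le, neg_add, Real.rpow_add hpos, Real.rpow_neg_one,
      Real.rpow_neg hpos.le, div_eq_mul_inv]
    have h1 : bracket z.re ^ n ≤ B ^ n :=
      Real.rpow_le_rpow (bracket_pos _).le (hQB _ (mem_image_of_mem _ hz)) hn.le
    calc _ = c * bracket z.re ^ n * ((|z.im| ^ n)⁻¹ * |z.im|⁻¹) := by ring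
      _ ≤ _ := by gcongr
  · refine le_add_of_nonneg_of_le (by positivity) ?_
    have h1 : |z.im| ≤ Y := by
      have := hQY hz
      rw [mem_ball_zero_iff] at this
      exact (abs_im_le_norm z).trans this.le
    have h2 : 1 ≤ Y ^ (n + 1) * |z.im| ^ (-(n + 1)) := by
      rw [Real.rpow_neg hpos.le, ← div_eq_mul_inv, one_le_div (by positivity)]
      exact Real.rpow_le_rpow hpos.le h1 (by linarith)
    rw [mul_assoc]
    exact ((hD z ⟨hz, h⟩).trans (le_max_left _ _)).trans
      (le_mul_of_one_le_right (le_max_right _ _) h2)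

/-- Non-real points over `I` which are not eigenvalues belong to the resolvent set. -/
def NonrealSpectrumDiscrete (A : E →ₗ.[ℂ] E) (I : Set ℝ) : Prop :=
  ∀ z : ℂ, z.im ≠ 0 → z.re ∈ I → z ∉ nonrealEigenvalues A I → z ∈ resolventSet A

theorem IsAdmissible.mem_resolventSet {E : Type*} [NormedAddCommGroup E] [InnerProductSpace ℂ E]
    {A : E →ₗ.[ℂ] E} (hA : NonrealSpectrumDiscrete A I) {τ : ℝ → ℂ}
    (hτ : IsAdmissible A I τ) {f : ℝ → ℂ} (hfI : tsupport f ⊆ I) {N : ℕ} {z : ℂ}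
    (hz : z ∈ tsupport (almostAnalyticExt f N τ)) (hz0 : z.im ≠ 0) : z ∈ resolventSet A := by
  obtain ⟨h1, h2⟩ := tsupport_almostAnalyticExt_subset f N τ hz
  exact hA z hz0 (hfI h1) fun h => Set.disjoint_left.1 hτ.2 h2 h

/-- The integrand is `O(|Im z|^(N - (n+1)))`, and `N > n` says exactly that this exponent exceeds
`-1`. -/
theorem integrable_hsIntegrand (hE : ResolventEstimate A I n) (hn : 0 < n)
    (hA : NonrealSpectrumDiscrete A I) {τ : ℝ → ℂ} (hτ : IsAdmissible A I τ) {f : ℝ → ℂ}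
    (hf : ContDiff ℝ ∞ f) (hfc : HasCompactSupport f) (hfI : tsupport f ⊆ I) {N : ℕ} (hN : n < N) :
    Integrable (hsIntegrand A f N τ) := by
  have hgc := hasCompactSupport_almostAnalyticExt hfc N hτ.1
  obtain ⟨M, hM, hbox⟩ := exists_box hgc
  obtain ⟨C, hC, hCb⟩ := exists_dbar_almostAnalyticExt_bound hf hfc N hτ.1
  obtain ⟨C', hC', hCb'⟩ := hE.exists_bound hn hgc.isCompact
    (fun z hz => hfI (tsupport_almostAnalyticExt_subset f N τ hz).1)
    (fun z hz hz0 => hτ.mem_resolventSet hA hfI hz hz0)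
  have hs {z : ℂ} (h : dbar (almostAnalyticExt f N τ) z ≠ 0) :
      z ∈ tsupport (almostAnalyticExt f N τ) := by
    by_contra h'
    exact h (dbar_eq_zero_of_notMem_tsupport h')
  exact integrable_smul_of_bounds (continuous_dbar (contDiff_almostAnalyticExt hf N hτ.1))
    (fun z hz => dbar_eq_zero_of_notMem_tsupport (hbox z hz)) (isOpen_resolventSet A)
    (continuousOn_resolvent A) hC hC' hCb
    (fun z hz h => ⟨hτ.mem_resolventSet hA hfI (hs h) hz, hCb' z (hs h) hz⟩) (by linarith)

theorem dbar_sub {g h : ℂ → ℂ} {z : ℂ} (hg : DifferentiableAt ℝ g z)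
    (hh : DifferentiableAt ℝ h z) : dbar (fun w => g w - h w) z = dbar g z - dbar h z := by
  simp only [dbar, fderiv_fun_sub hg hh, sub_apply]
  ring

/-- The difference `k` of the extensions is `O(|Im z|^(N+1))` and the resolvent is `O(|Im
z|^(-(n+1)))`, so their product is continuous across the axis and Stokes' formula applies. -/
theorem integral_hsIntegrand_eq_of_le (hE : ResolventEstimate A I n) (hn : 0 < n)
    (hA : NonrealSpectrumDiscrete A I) {τ τ' : ℝ → ℂ} (hτ : IsAdmissible A I τ)
    (hτ' : IsAdmissible A I τ') {f : ℝ → ℂ}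
    (hf : ContDiff ℝ ∞ f) (hfc : HasCompactSupport f) (hfI : tsupport f ⊆ I) {N N' : ℕ}
    (hN : n < N) (hNN : N ≤ N') :
    ∫ z, hsIntegrand A f N τ z = ∫ z, hsIntegrand A f N' τ' z := by
  have hN' : n < N' := hN.trans_le (by exact_mod_cast hNN)
  have hi := integrable_hsIntegrand hE hn hA hτ hf hfc hfI hN
  have hi' := integrable_hsIntegrand hE hn hA hτ' hf hfc hfI hN'
  have hd := (contDiff_almostAnalyticExt hf N hτ.1).differentiable (by simp)
  have hd' := (contDiff_almostAnalyticExt hf N' hτ'.1).differentiable (by simp)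
  set g := almostAnalyticExt f N τ
  set g' := almostAnalyticExt f N' τ'
  set k : ℂ → ℂ := fun z => g' z - g z
  have hgc : HasCompactSupport g := hasCompactSupport_almostAnalyticExt hfc N hτ.1
  have hgc' : HasCompactSupport g' := hasCompactSupport_almostAnalyticExt hfc N' hτ'.1
  have hkc : HasCompactSupport k := hgc'.sub hgc
  have hks : tsupport k ⊆ tsupport g' ∪ tsupport g := tsupport_sub g' g
  have hkρ : ∀ z ∈ tsupport k, z.im ≠ 0 → z ∈ resolventSet A := fun z hz h0 =>
    (hks hz).elim (fun h => hτ'.mem_resolventSet hA hfI h h0)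
      fun h => hτ.mem_resolventSet hA hfI h h0
  have hkI : ∀ z ∈ tsupport k, z.re ∈ I := fun z hz =>
    (hks hz).elim (fun h => hfI (tsupport_almostAnalyticExt_subset f N' τ' h).1)
      fun h => hfI (tsupport_almostAnalyticExt_subset f N τ h).1
  obtain ⟨C, hC, hCb⟩ := exists_almostAnalyticExt_sub_bound hf hfc hNN hτ.1 hτ'.1
  obtain ⟨C', hC', hCb'⟩ := hE.exists_bound hn hkc.isCompact hkI hkρ
  have hdk : Differentiable ℝ k := hd'.sub hd
  have he (z : ℂ) : dbar k z • resolvent A z = hsIntegrand A f N' τ' z - hsIntegrand A f N τ z := by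
    rw [dbar_sub (hd' z) (hd z), sub_smul]
    rfl
  have h0 : ∫ z, dbar k z • resolvent A z = 0 := by
    refine integral_dbar_smul_eq_zero hdk hkc
      (fun z hz hz0 => differentiableAt_resolvent (hkρ z hz hz0)) ?_ ?_
    · exact continuous_smul_of_bounds hdk.continuous
        (fun z hz hz0 => (differentiableAt_resolvent (hkρ z hz hz0)).continuousAt) hC hC' hCb hCb'
        (by linarith)
    · simp_rw [he]
      exact hi'.sub hi
  simp_rw [he] at h0
  rw [integral_sub hi' hi, sub_eq_zero] at h0
  exact h0.symm

theorem exists_isHSValue (hE : ResolventEstimate A I n) (hn : 0 < n)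
    (hA : NonrealSpectrumDiscrete A I) (hfin : (nonrealEigenvalues A I).Finite) {f : ℝ → ℂ}
    (hf : ContDiff ℝ ∞ f) (hfc : HasCompactSupport f) (hfI : tsupport f ⊆ I) :
    ∃ F, IsHSValue A I n f F := by
  obtain ⟨r₀, hr₀, hr⟩ := exists_admissible hfin
  obtain ⟨τ₀, hτ₀, hs⟩ := exists_cutoff (half_pos hr₀)
  have hτ := hr _ (half_pos hr₀) (half_lt_self hr₀) τ₀ hτ₀ hs
  obtain ⟨N₀, hN₀⟩ := exists_nat_gt n
  refine ⟨(Real.pi : ℂ)⁻¹ • ∫ z : ℂ, hsIntegrand A f N₀ τ₀ z, ⟨τ₀, hτ⟩, fun N hN τ' hτ' =>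
    ⟨integrable_hsIntegrand hE hn hA hτ' hf hfc hfI hN, ?_⟩⟩
  congr 1
  rcases le_total N₀ N with h | h
  · exact integral_hsIntegrand_eq_of_le hE hn hA hτ hτ' hf hfc hfI hN₀ h
  · exact (integral_hsIntegrand_eq_of_le hE hn hA hτ' hτ hf hfc hfI hN h).symm

/-- The exponents may differ, since `funcCalc` quantifies over them; an order above both and one
admissible cut-off compare the values. -/
theorem IsHSValue.unique {E : Type*} [NormedAddCommGroup E] [InnerProductSpace ℂ E]
    {A : E →ₗ.[ℂ] E} {m : ℝ} {f : ℝ → ℂ} {F G : E →L[ℂ] E} (hF : IsHSValue A I n f F)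
    (hG : IsHSValue A I m f G) : F = G := by
  obtain ⟨⟨τ, hτ⟩, hF⟩ := hF
  obtain ⟨N, hN⟩ := exists_nat_gt (max n m)
  rw [(hF N ((le_max_left _ _).trans_lt hN) τ hτ).2,
    (hG.2 N ((le_max_right _ _).trans_lt hN) τ hτ).2]

theorem IsHSValue.funcCalc_eq {E : Type*} [NormedAddCommGroup E] [InnerProductSpace ℂ E]
    {A : E →ₗ.[ℂ] E} {I : Set ℝ} {n : ℝ} {f : ℝ → ℂ} {F : E →L[ℂ] E} (hF : IsHSValue A I n f F) :
    funcCalc A I f = F := by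
  have h : ∃ F : E →L[ℂ] E, ∃ n : ℝ, IsHSValue A I n f F := ⟨F, n, hF⟩
  rw [funcCalc, dif_pos h]
  obtain ⟨m, hm⟩ := h.choose_spec
  exact hm.unique hF

theorem isHSValue_funcCalc (hE : ResolventEstimate A I n) (hn : 0 < n)
    (hA : NonrealSpectrumDiscrete A I) (hfin : (nonrealEigenvalues A I).Finite) {f : ℝ → ℂ}
    (hf : ContDiff ℝ ∞ f) (hfc : HasCompactSupport f) (hfI : tsupport f ⊆ I) :
    IsHSValue A I n f (funcCalc A I f) := by
  obtain ⟨F, hF⟩ := exists_isHSValue hE hn hA hfin hf hfc hfI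
  rw [hF.funcCalc_eq]
  exact hF

/-- The resolvent is now holomorphic at every point of the support of `f̃`, real points included, so
Stokes' formula applies to `f̃` itself. -/
theorem funcCalc_eq_zero (hE : ResolventEstimate A I n) (hn : 0 < n)
    (hA : NonrealSpectrumDiscrete A I) (hfin : (nonrealEigenvalues A I).Finite) {f : ℝ → ℂ}
    (hf : ContDiff ℝ ∞ f) (hfc : HasCompactSupport f) (hfI : tsupport f ⊆ I)
    (hρ : ∀ x ∈ tsupport f, (x : ℂ) ∈ resolventSet A) : funcCalc A I f = 0 := by
  obtain ⟨⟨τ, hτ⟩, h⟩ := isHSValue_funcCalc hE hn hA hfin hf hfc hfI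
  obtain ⟨N, hN⟩ := exists_nat_gt n
  obtain ⟨hi, e⟩ := h N hN τ hτ
  have hd := (contDiff_almostAnalyticExt hf N hτ.1).differentiable (by simp)
  have hR : ∀ z ∈ tsupport (almostAnalyticExt f N τ), DifferentiableAt ℂ (resolvent A) z := by
    intro z hz
    by_cases h0 : z.im = 0
    · have h1 := hρ z.re (tsupport_almostAnalyticExt_subset f N τ hz).1
      have h2 : ((z.re : ℝ) : ℂ) = z := Complex.ext (by simp) (by simp [h0])
      rw [h2] at h1
      exact differentiableAt_resolvent h1
    · exact differentiableAt_resolvent (hτ.mem_resolventSet hA hfI hz h0)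
  rw [e]
  have : ∫ z, dbar (almostAnalyticExt f N τ) z • resolvent A z = 0 := by
    refine integral_dbar_smul_eq_zero hd (hasCompactSupport_almostAnalyticExt hfc N hτ.1)
      (fun z hz _ => hR z hz) ?_ hi
    rw [continuous_iff_continuousAt]
    intro z
    obtain ⟨L, hL, -⟩ := hasDbarAt_smul_of_tsupport hd (hR z)
    exact hL.continuousAt
  unfold hsIntegrand
  rw [this, smul_zero]

end FunctionalCalculusWellDefined

/-! ### Trace norm of the resolvent difference and the trace formula. -/

section TraceControl

open MeasureTheory Complex Set

variable {E : Type*} [NormedAddCommGroup E] [InnerProductSpace ℂ E] [CompleteSpace E]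
  {H H₀ : E →ₗ.[ℂ] E} {V : E →L[ℂ] E}

theorem exists_traceNormLE_resolvent_sub (hV : IsTraceClass V) (hH : H = perturb H₀ V) :
    ∃ K ≥ 0, ∀ z ∈ resolventSet H ∩ resolventSet H₀,
      TraceNormLE (resolvent H z - resolvent H₀ z) (K * ‖resolvent H z‖ * ‖resolvent H₀ z‖) := by
  obtain ⟨K, hK, h⟩ := hV.exists_traceNormLE
  subst hH
  refine ⟨K, hK, fun z hz => ?_⟩
  rw [resolvent_perturb_sub hz.2 hz.1]
  exact (h _ _).neg

/-- By the resolvent identity the increment of `R_H V R₀` splits into `(R_H(z) - R_H(w)) V R₀(z)`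
and `R_H(w) V (R₀(z) - R₀(w))`; both are small in trace norm. -/
theorem continuousOn_sigma (hV : IsTraceClass V) (hH : H = perturb H₀ V) :
    ContinuousOn (sigma H H₀) (resolventSet H ∩ resolventSet H₀) := by
  obtain ⟨K, hK, h⟩ := hV.exists_traceNormLE
  obtain ⟨K', -, h'⟩ := exists_traceNormLE_resolvent_sub hV hH
  subst hH
  set H := perturb H₀ V
  intro w hw
  have hc := (continuousOn_resolvent H).mono (inter_subset_left (t := resolventSet H₀)) w hw
  have hc₀ := (continuousOn_resolvent H₀).mono (inter_subset_right (s := resolventSet H)) w hw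
  rw [ContinuousWithinAt, tendsto_iff_norm_sub_tendsto_zero] at *
  have hb : Filter.Tendsto (fun z => K * ‖resolvent H z - resolvent H w‖ * ‖resolvent H₀ z‖ +
      K * ‖resolvent H w‖ * ‖resolvent H₀ z - resolvent H₀ w‖)
      (𝓝[resolventSet H ∩ resolventSet H₀] w) (𝓝 0) := by
    have h1 := (hc.const_mul K).mul
      ((continuousOn_resolvent H₀).mono (inter_subset_right (s := resolventSet H)) w hw).norm
    have h2 := hc₀.const_mul (K * ‖resolvent H w‖)
    simpa using h1.add h2
  refine squeeze_zero' (Filter.Eventually.of_forall fun _ => norm_nonneg _) ?_ hb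
  filter_upwards [self_mem_nhdsWithin] with z hz
  rw [sigma, sigma, ← (h' z hz).trace_sub (h' w hw)]
  have e : resolvent H z - resolvent H₀ z - (resolvent H w - resolvent H₀ w) =
      -((resolvent H z - resolvent H w) * V * resolvent H₀ z) +
        -(resolvent H w * V * (resolvent H₀ z - resolvent H₀ w)) := by
    rw [resolvent_perturb_sub hz.2 hz.1, resolvent_perturb_sub hw.2 hw.1]
    noncomm_ring
  rw [e]
  exact ((h _ _).neg.add (h _ _).neg).norm_trace_le

/-- Near `K` the trace norm of the resolvent difference is `O(|Im z|⁻ᵖ)`. -/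
def TraceControl (H H₀ : E →ₗ.[ℂ] E) (K : Set ℝ) (p a C : ℝ) : Prop :=
  ∀ z : ℂ, z.re ∈ K → 0 < |z.im| → |z.im| < a → z ∈ resolventSet H ∩ resolventSet H₀ ∧
    TraceNormLE (resolvent H z - resolvent H₀ z) (C * |z.im| ^ (-p))

/-- In the exponent, `n + 1` comes from `R_H` and `1` from the self-adjoint resolvent `R₀`. -/
theorem exists_traceControl (hH₀ : IsSelfAdjoint H₀) (hV : IsTraceClass V)
    (hH : H = perturb H₀ V) {I : Set ℝ} {n : ℝ} (hn : 0 < n) (hE : ResolventEstimate H I n)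
    {K : Set ℝ} (hK : IsCompact K) (hKI : K ⊆ I) :
    ∃ a > 0, ∃ C ≥ 0, TraceControl H H₀ K (n + 2) a C := by
  obtain ⟨L, hL, h⟩ := exists_traceNormLE_resolvent_sub hV hH
  obtain ⟨B, hB, hKB⟩ := exists_bracket_le hK
  obtain ⟨a, ha, c, hc, hρ, hb⟩ := hE
  refine ⟨a, ha, L * (c * B ^ n), by positivity, fun z hz h0 hza => ?_⟩
  have hs : z ∈ strip a I := ⟨hKI hz, h0, hza⟩
  obtain ⟨h₀, hb₀⟩ := hH₀.isResolventAt_of_im_ne_zero (abs_pos.1 h0)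
  refine ⟨⟨hρ hs, h₀⟩, (h z ⟨hρ hs, h₀⟩).mono ?_⟩
  have h1 : ‖resolvent H z‖ ≤ c * |z.im|⁻¹ * (B / |z.im|) ^ n := by
    refine (hb z hs).trans ?_
    have := (bracket_pos z.re).le
    gcongr
    exact hKB _ hz
  calc _ ≤ L * (c * |z.im|⁻¹ * (B / |z.im|) ^ n) * |z.im|⁻¹ := by gcongr
    _ = _ := by
      rw [Real.div_rpow hB.le h0.le, show -(n + 2) = -n + (-1) + (-1) by ring,
        Real.rpow_add h0, Real.rpow_add h0, Real.rpow_neg_one, Real.rpow_neg h0.le]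
      ring

/-- A cut-off `τ` such that `f̃` is supported in `|Im z| ≤ a / 2` when `f` is supported in `K`. -/
theorem exists_admissible_narrow {E : Type*} [NormedAddCommGroup E] [InnerProductSpace ℂ E]
    {H H₀ : E →ₗ.[ℂ] E} {I : Set ℝ} (hfin : (nonrealEigenvalues H I).Finite)
    (hfin₀ : (nonrealEigenvalues H₀ I).Finite) {K : Set ℝ} (hK : IsCompact K) {a : ℝ}
    (ha : 0 < a) :
    ∃ τ, IsAdmissible H I τ ∧ IsAdmissible H₀ I τ ∧
      ∀ z ∈ tsupport (chi τ), z.re ∈ K → |z.im| ≤ a / 2 := by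
  obtain ⟨r₁, hr₁, h₁⟩ := exists_admissible hfin
  obtain ⟨r₂, hr₂, h₂⟩ := exists_admissible hfin₀
  obtain ⟨B, hB, hKB⟩ := exists_bracket_le hK
  -- On the support of `χ` over `K` one has `|Im z| ≤ r ⟨Re z⟩ ≤ r B`. Stopping at `a / 2` leaves
  -- room for translations by `ε < a / 2`.
  obtain ⟨r, hr, hlt⟩ := exists_between (lt_min (lt_min hr₁ hr₂) (show 0 < a / 2 / B by positivity))
  rw [lt_min_iff, lt_min_iff] at hlt
  obtain ⟨τ, hτ, hs⟩ := exists_cutoff hr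
  refine ⟨τ, h₁ r hr hlt.1.1 τ hτ hs, h₂ r hr hlt.1.2 τ hτ hs, fun z hz hzK => ?_⟩
  refine (tsupport_chi_subset hs hz).trans ?_
  rw [lt_div_iff₀ hB] at hlt
  exact (mul_le_mul_of_nonneg_left (hKB _ hzK) hr.le).trans hlt.2.le

section Formula

variable {K : Set ℝ} {p a C : ℝ} {τ : ℝ → ℂ} {f : ℝ → ℂ} {N : ℕ}

theorem mem_of_mem_tsupport_ext (hτK : ∀ z ∈ tsupport (chi τ), z.re ∈ K → |z.im| ≤ a / 2)
    (hfK : tsupport f ⊆ K) {z : ℂ} (hz : z ∈ tsupport (almostAnalyticExt f N τ)) :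
    z.re ∈ K ∧ |z.im| ≤ a / 2 := by
  obtain ⟨h1, h2⟩ := tsupport_almostAnalyticExt_subset f N τ hz
  exact ⟨hfK h1, hτK z h2 (hfK h1)⟩

theorem mem_tsupport_of_dbar_ne_zero {g : ℂ → ℂ} {z : ℂ} (h : dbar g z ≠ 0) : z ∈ tsupport g := by
  by_contra h'
  exact h (dbar_eq_zero_of_notMem_tsupport h')

/-- This majorant serves twice: for convergence in trace norm, and for the dominated convergence as
`ε → 0`. -/
theorem integrable_dbar_mul_rpow (hτ : IsCutoff τ) (hf : ContDiff ℝ ∞ f)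
    (hfc : HasCompactSupport f) (hC : 0 ≤ C) (hp : p < N + 1) :
    Integrable fun z : ℂ => ‖dbar (almostAnalyticExt f N τ) z‖ * (C * |z.im| ^ (-p)) := by
  obtain ⟨M, hM, hbox⟩ := exists_box (hasCompactSupport_almostAnalyticExt hfc N hτ)
  obtain ⟨B, hB, hb⟩ := exists_dbar_almostAnalyticExt_bound hf hfc N hτ
  have h := integrable_smul_of_bounds (ψ := dbar (almostAnalyticExt f N τ))
    (continuous_dbar (contDiff_almostAnalyticExt hf N hτ))
    (fun z hz => dbar_eq_zero_of_notMem_tsupport (hbox z hz))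
    (R := fun z : ℂ => ((C * |z.im| ^ (-p) : ℝ) : ℂ)) (U := {z : ℂ | z.im ≠ 0})
    (isOpen_ne_fun continuous_im continuous_const) ?_ hB hC hb
    (fun z hz _ => ⟨hz, ?_⟩) hp
  · refine h.norm.congr (Filter.Eventually.of_forall fun z => ?_)
    simp only [norm_smul, norm_real, Real.norm_eq_abs]
    rw [abs_of_nonneg (a := C * |z.im| ^ (-p)) (by positivity)]
  · refine continuous_ofReal.comp_continuousOn (continuousOn_const.mul ?_)
    exact (continuous_abs.comp continuous_im).continuousOn.rpow_const
      fun z hz => Or.inl (abs_ne_zero.2 hz)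
  · rw [norm_real, Real.norm_eq_abs, abs_of_nonneg (by positivity)]

theorem funcCalc_sub_eq {E : Type*} [NormedAddCommGroup E] [InnerProductSpace ℂ E]
    {H H₀ : E →ₗ.[ℂ] E} {I : Set ℝ} {n : ℝ} (hv : IsHSValue H I n f (funcCalc H I f))
    (hv₀ : IsHSValue H₀ I n f (funcCalc H₀ I f)) (hN : n < N) (hτ : IsAdmissible H I τ)
    (hτ₀ : IsAdmissible H₀ I τ) :
    Integrable (fun z => dbar (almostAnalyticExt f N τ) z • (resolvent H z - resolvent H₀ z)) ∧
    funcCalc H I f - funcCalc H₀ I f = (Real.pi : ℂ)⁻¹ •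
      ∫ z, dbar (almostAnalyticExt f N τ) z • (resolvent H z - resolvent H₀ z) := by
  obtain ⟨hi, e⟩ := hv.2 N hN τ hτ
  obtain ⟨hi₀, e₀⟩ := hv₀.2 N hN τ hτ₀
  have he (z : ℂ) : dbar (almostAnalyticExt f N τ) z • (resolvent H z - resolvent H₀ z) =
      hsIntegrand H f N τ z - hsIntegrand H₀ f N τ z := smul_sub _ _ _
  simp_rw [he]
  refine ⟨hi.sub hi₀, ?_⟩
  rw [e, e₀, integral_sub hi hi₀, smul_sub]

theorem TraceControl.smul_dbar (h : TraceControl H H₀ K p a C) (ha : 0 < a)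
    (hτK : ∀ z ∈ tsupport (chi τ), z.re ∈ K → |z.im| ≤ a / 2) (hfK : tsupport f ⊆ K) {z : ℂ}
    (hz : z.im ≠ 0) :
    TraceNormLE (dbar (almostAnalyticExt f N τ) z • (resolvent H z - resolvent H₀ z))
      (‖dbar (almostAnalyticExt f N τ) z‖ * (C * |z.im| ^ (-p))) := by
  by_cases h0 : dbar (almostAnalyticExt f N τ) z = 0
  · rw [h0, zero_smul, norm_zero, zero_mul]
    intro U _ s
    simp
  · obtain ⟨h1, h2⟩ := mem_of_mem_tsupport_ext hτK hfK (mem_tsupport_of_dbar_ne_zero h0)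
    exact (h z h1 (abs_pos.2 hz) (by linarith)).2.smul _

theorem TraceControl.traceNormLE_funcCalc (h : TraceControl H H₀ K p a C) (ha : 0 < a) (hC : 0 ≤ C)
    (hτK : ∀ z ∈ tsupport (chi τ), z.re ∈ K → |z.im| ≤ a / 2) (hfK : tsupport f ⊆ K)
    (hf : ContDiff ℝ ∞ f) (hfc : HasCompactSupport f) (hp : p < N + 1)
    {I : Set ℝ} {n : ℝ} (hv : IsHSValue H I n f (funcCalc H I f))
    (hv₀ : IsHSValue H₀ I n f (funcCalc H₀ I f)) (hN : n < N) (hτ : IsAdmissible H I τ)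
    (hτ₀ : IsAdmissible H₀ I τ) :
    TraceNormLE (funcCalc H I f - funcCalc H₀ I f) (‖(Real.pi : ℂ)⁻¹‖ *
      ∫ z : ℂ, ‖dbar (almostAnalyticExt f N τ) z‖ * (C * |z.im| ^ (-p))) := by
  obtain ⟨hi, e⟩ := funcCalc_sub_eq hv hv₀ hN hτ hτ₀
  rw [e]
  exact (TraceNormLE.integral hi (integrable_dbar_mul_rpow hτ.1 hf hfc hC hp)
    (ae_im_ne_zero.mono fun z hz => h.smul_dbar ha hτK hfK hz)).smul _

theorem TraceControl.trace_funcCalc [TopologicalSpace.SeparableSpace E]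
    (h : TraceControl H H₀ K p a C) (ha : 0 < a) (hC : 0 ≤ C)
    (hτK : ∀ z ∈ tsupport (chi τ), z.re ∈ K → |z.im| ≤ a / 2) (hfK : tsupport f ⊆ K)
    (hf : ContDiff ℝ ∞ f) (hfc : HasCompactSupport f) (hp : p < N + 1)
    {I : Set ℝ} {n : ℝ} (hv : IsHSValue H I n f (funcCalc H I f))
    (hv₀ : IsHSValue H₀ I n f (funcCalc H₀ I f)) (hN : n < N) (hτ : IsAdmissible H I τ)
    (hτ₀ : IsAdmissible H₀ I τ) :
    Integrable (fun z => dbar (almostAnalyticExt f N τ) z * sigma H H₀ z) ∧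
    trace (funcCalc H I f - funcCalc H₀ I f) = (Real.pi : ℂ)⁻¹ *
      ∫ z, dbar (almostAnalyticExt f N τ) z * sigma H H₀ z := by
  obtain ⟨hi, e⟩ := funcCalc_sub_eq hv hv₀ hN hτ hτ₀
  obtain ⟨h1, h2⟩ := TraceNormLE.trace_integral hi (integrable_dbar_mul_rpow hτ.1 hf hfc hC hp)
    (ae_im_ne_zero.mono fun z hz => h.smul_dbar ha hτK hfK hz)
  simp_rw [trace_smul] at h1 h2
  rw [e, trace_smul, h2]
  exact ⟨h1, rfl⟩

/-- All extensions of functions supported in `K` live in one box, where `|Im z|^(N - p)` is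
integrable; `N + 2` counts the derivatives involved. -/
theorem exists_integral_dbar_le (hτ : IsCutoff τ) (hK : IsCompact K) (hC : 0 ≤ C)
    (hτK : ∀ z ∈ tsupport (chi τ), z.re ∈ K → |z.im| ≤ a / 2) (hp : p < N + 1) :
    ∃ W ≥ 0, ∀ f : ℝ → ℂ, ContDiff ℝ ∞ f → HasCompactSupport f → tsupport f ⊆ K → ∀ B : ℝ,
      (∀ k ≤ N + 1, ∀ x, ‖iteratedDeriv k f x‖ ≤ B) →
        ∫ z : ℂ, ‖dbar (almostAnalyticExt f N τ) z‖ * (C * |z.im| ^ (-p)) ≤ W * B := by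
  obtain ⟨D, hD, hb⟩ := exists_dbar_bound hτ hK N
  obtain ⟨M, hM, hKM⟩ := hK.isBounded.subset_ball_lt (a / 2) 0
  set Q : Set ℂ := Ioc (-M) M ×ℂ Ioc (-M) M
  have hQm : MeasurableSet Q :=
    (measurable_re measurableSet_Ioc).inter (measurable_im measurableSet_Ioc)
  have hQ : IntegrableOn (fun z : ℂ => |z.im| ^ ((N : ℝ) - p)) Q :=
    integrableOn_box_abs_im_rpow (by linarith) M
  have hpos : 0 ≤ ∫ z in Q, |z.im| ^ ((N : ℝ) - p) := integral_nonneg fun z => by positivity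
  refine ⟨D * (N + 2) * C * ∫ z in Q, |z.im| ^ ((N : ℝ) - p), by positivity,
    fun f hf hfc hfK B hB => ?_⟩
  have hB0 : 0 ≤ B := (norm_nonneg _).trans (hB 0 (by omega) 0)
  have e : D * (N + 2) * C * (∫ z in Q, |z.im| ^ ((N : ℝ) - p)) * B =
      ∫ z : ℂ, Q.indicator (fun z => D * (N + 2) * C * B * |z.im| ^ ((N : ℝ) - p)) z := by
    rw [integral_indicator hQm, integral_const_mul]
    ring
  rw [e]
  refine integral_mono_ae (integrable_dbar_mul_rpow hτ hf hfc hC hp)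
    ((integrable_indicator_iff hQm).2 (hQ.const_mul _)) ?_
  filter_upwards [ae_im_ne_zero] with z hz
  have hz' : 0 < |z.im| := abs_pos.2 hz
  by_cases h0 : dbar (almostAnalyticExt f N τ) z = 0
  · rw [h0, norm_zero, zero_mul]
    exact indicator_nonneg (fun w _ => by positivity) z
  · obtain ⟨h1, h2⟩ := mem_of_mem_tsupport_ext hτK hfK (mem_tsupport_of_dbar_ne_zero h0)
    have hzQ : z ∈ Q := by
      have h3 := hKM h1
      rw [mem_ball_zero_iff, Real.norm_eq_abs, abs_lt] at h3
      have h4 := abs_lt.1 (h2.trans_lt hM)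
      exact ⟨⟨h3.1, h3.2.le⟩, ⟨h4.1, h4.2.le⟩⟩
    rw [indicator_of_mem hzQ]
    have hS : ∑ k ∈ Finset.range (N + 2), ‖iteratedDeriv k f z.re‖ ≤ (N + 2) * B := by
      refine (Finset.sum_le_card_nsmul _ _ B fun k hk => hB k ?_ _).trans ?_
      · have := Finset.mem_range.1 hk; omega
      · simp
    calc _ ≤ (D * ((N + 2) * B) * |z.im| ^ N) * (C * |z.im| ^ (-p)) := by
          gcongr
          exact (hb f hf z h1).trans (by gcongr)
      _ = _ := by
          rw [sub_eq_add_neg, Real.rpow_add hz', Real.rpow_natCast]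
          ring

end Formula

end TraceControl

/-! ### Boundary values of `σ`. -/

section BoundaryLimit

open MeasureTheory Complex Set

variable {E : Type*} [NormedAddCommGroup E] [InnerProductSpace ℂ E] [CompleteSpace E]
  {H H₀ : E →ₗ.[ℂ] E} {K : Set ℝ} {p a C : ℝ} {τ : ℝ → ℂ} {f : ℝ → ℂ} {N : ℕ}

theorem almostAnalyticExt_ofReal (hτ : IsCutoff τ) (f : ℝ → ℂ) (N : ℕ) (x : ℝ) :
    almostAnalyticExt f N τ x = f x := by
  obtain ⟨δ, hδ, -, -, h, -⟩ := hτ.exists_bounds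
  rw [almostAnalyticExt_eq, chi_eq_one h (by simpa using hδ), mul_one, taylorExt,
    Finset.sum_range_succ']
  simp

theorem abs_im_add_shift {s : ℝ} (hs : s = 1 ∨ s = -1) {z : ℂ} (hz : 0 ≤ s * z.im) {ε : ℝ}
    (hε : 0 < ε) : |(z + ((s * ε : ℝ) : ℂ) * I).im| = |z.im| + ε := by
  have : (z + ((s * ε : ℝ) : ℂ) * I).im = z.im + s * ε := by simp
  rw [this]
  rcases hs with rfl | rfl
  · rw [abs_of_nonneg (by linarith), abs_of_nonneg (by linarith), one_mul]
  · rw [abs_of_nonpos (by linarith), abs_of_nonpos (by linarith)]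
    ring

theorem re_add_shift (z : ℂ) (s ε : ℝ) : (z + ((s * ε : ℝ) : ℂ) * I).re = z.re := by simp

/-- Translation away from the axis replaces `|Im z|` by `|Im z| + ε`, which stays below `a`. -/
theorem TraceControl.shift (h : TraceControl H H₀ K p a C) {s : ℝ}
    (hs : s = 1 ∨ s = -1) {ε : ℝ} (hε : 0 < ε) (hεa : ε < a / 2) {z : ℂ} (hzK : z.re ∈ K)
    (hza : |z.im| ≤ a / 2) (hz : 0 ≤ s * z.im) :
    z + ((s * ε : ℝ) : ℂ) * I ∈ resolventSet H ∩ resolventSet H₀ ∧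
      TraceNormLE (resolvent H (z + ((s * ε : ℝ) : ℂ) * I) -
        resolvent H₀ (z + ((s * ε : ℝ) : ℂ) * I)) (C * (|z.im| + ε) ^ (-p)) := by
  have h1 := abs_im_add_shift hs hz hε
  have h2 := h (z + ((s * ε : ℝ) : ℂ) * I) (by rwa [re_add_shift])
    (by rw [h1]; positivity) (by rw [h1]; linarith)
  rwa [h1] at h2

theorem differentiableAt_resolvent_sub {z : ℂ} (hz : z ∈ resolventSet H ∩ resolventSet H₀) :
    DifferentiableAt ℂ (fun w => resolvent H w - resolvent H₀ w) z :=
  (differentiableAt_resolvent hz.1).sub (differentiableAt_resolvent hz.2)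

/-- The translated resolvents are holomorphic on the part of the support of `f̃` in the closed half
plane, so Stokes' formula meets no singularity, and `f̃ = f` on the axis. -/
theorem TraceControl.integral_shift (h : TraceControl H H₀ K p a C)
    (hτ : IsCutoff τ)
    (hτK : ∀ z ∈ tsupport (chi τ), z.re ∈ K → |z.im| ≤ a / 2) (hfK : tsupport f ⊆ K)
    (hf : ContDiff ℝ ∞ f) (hfc : HasCompactSupport f)
    {s : ℝ} (hs : s = 1 ∨ s = -1) {ε : ℝ} (hε : 0 < ε) (hεa : ε < a / 2) :
    IntegrableOn (fun z => dbar (almostAnalyticExt f N τ) z •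
      (resolvent H (z + ((s * ε : ℝ) : ℂ) * I) - resolvent H₀ (z + ((s * ε : ℝ) : ℂ) * I)))
      {z | 0 < s * z.im} ∧
    ∫ z in {z : ℂ | 0 < s * z.im}, dbar (almostAnalyticExt f N τ) z •
      (resolvent H (z + ((s * ε : ℝ) : ℂ) * I) - resolvent H₀ (z + ((s * ε : ℝ) : ℂ) * I)) =
    (s : ℂ) • (2 * I)⁻¹ • ∫ x : ℝ, f x •
      (resolvent H (x + ((s * ε : ℝ) : ℂ) * I) - resolvent H₀ (x + ((s * ε : ℝ) : ℂ) * I)) := by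
  set g := almostAnalyticExt f N τ with hg
  have hgs : ContDiff ℝ ∞ g := contDiff_almostAnalyticExt hf N hτ
  have hgd : Differentiable ℝ g := hgs.differentiable (by simp)
  have hgc : HasCompactSupport g := hasCompactSupport_almostAnalyticExt hfc N hτ
  obtain ⟨M, hM, hbox⟩ := exists_box hgc
  set D : ℂ → E →L[ℂ] E := fun z => resolvent H (z + ((s * ε : ℝ) : ℂ) * I) -
    resolvent H₀ (z + ((s * ε : ℝ) : ℂ) * I) with hD
  have hdiff {z : ℂ} (hz : z ∈ tsupport g) (h0 : 0 ≤ s * z.im) : DifferentiableAt ℂ D z := by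
    obtain ⟨h1, h2⟩ := mem_of_mem_tsupport_ext hτK hfK hz
    have h3 := differentiableAt_resolvent_sub (h.shift hs hε hεa h1 h2 h0).1
    have h4 : DifferentiableAt ℂ (fun z : ℂ => z + ((s * ε : ℝ) : ℂ) * I) z := by fun_prop
    exact DifferentiableAt.comp z h3 h4
  have hi : IntegrableOn (fun z => dbar g z • D z) {z | 0 < s * z.im} := by
    have hQ : IsCompact (tsupport g ∩ {z : ℂ | 0 ≤ s * z.im}) :=
      hgc.isCompact.inter_right (isClosed_le continuous_const (continuous_const.mul continuous_im))
    have h1 : IntegrableOn (fun z => dbar g z • D z) (tsupport g ∩ {z : ℂ | 0 ≤ s * z.im}) := by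
      refine ContinuousOn.integrableOn_compact hQ ?_
      exact (continuous_dbar hgs).continuousOn.smul fun z hz =>
        (hdiff hz.1 hz.2).continuousAt.continuousWithinAt
    refine h1.of_forall_sdiff_eq_zero (measurableSet_halfPlane s) fun z hz => ?_
    have : z ∉ tsupport g := fun h' => hz.2 ⟨h', show (0 : ℝ) ≤ s * z.im from le_of_lt hz.1⟩
    rw [dbar_eq_zero_of_notMem_tsupport this, zero_smul]
  refine ⟨hi, ?_⟩
  have hst := integral_halfPlane_dbar hs (G := fun z => g z • D z) (D := fun z => dbar g z • D z) hM
    (fun z hz => by rw [image_eq_zero_of_notMem_tsupport (hbox z hz), zero_smul])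
    (fun z hz => by
      refine ContinuousAt.continuousWithinAt ?_
      obtain ⟨L, hL, -⟩ := hasDbarAt_smul_of_tsupport hgd (R := D) fun h' => hdiff h' hz
      exact hL.continuousAt)
    (fun z hz => hasDbarAt_smul_of_tsupport hgd fun h' => hdiff h' (le_of_lt hz)) hi
  rw [hst]
  simp only [hg, almostAnalyticExt_ofReal hτ, hD]

/-- Traces are taken on both sides of the operator identity, in the area integral and in the line
integral; the majorant does not depend on `ε`. -/
theorem TraceControl.integral_shift_sigma [TopologicalSpace.SeparableSpace E]
    (h : TraceControl H H₀ K p a C) (hp : 0 < p) (hC : 0 ≤ C)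
    (hτ : IsCutoff τ)
    (hτK : ∀ z ∈ tsupport (chi τ), z.re ∈ K → |z.im| ≤ a / 2) (hfK : tsupport f ⊆ K)
    (hf : ContDiff ℝ ∞ f) (hfc : HasCompactSupport f) (hpN : p < N + 1)
    {s : ℝ} (hs : s = 1 ∨ s = -1) {ε : ℝ} (hε : 0 < ε) (hεa : ε < a / 2) :
    IntegrableOn (fun z => dbar (almostAnalyticExt f N τ) z *
      sigma H H₀ (z + ((s * ε : ℝ) : ℂ) * I)) {z | 0 < s * z.im} ∧
    Integrable (fun x : ℝ => f x * sigma H H₀ (x + ((s * ε : ℝ) : ℂ) * I)) ∧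
    (∀ z : ℂ, 0 < s * z.im → ‖dbar (almostAnalyticExt f N τ) z *
      sigma H H₀ (z + ((s * ε : ℝ) : ℂ) * I)‖ ≤
        ‖dbar (almostAnalyticExt f N τ) z‖ * (C * |z.im| ^ (-p))) ∧
    ∫ z in {z : ℂ | 0 < s * z.im}, dbar (almostAnalyticExt f N τ) z *
      sigma H H₀ (z + ((s * ε : ℝ) : ℂ) * I) =
    (s : ℂ) * (2 * I)⁻¹ * ∫ x : ℝ, f x * sigma H H₀ (x + ((s * ε : ℝ) : ℂ) * I) := by
  obtain ⟨hi, e⟩ := h.integral_shift (N := N) hτ hτK hfK hf hfc hs hε hεa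
  have hb {z : ℂ} (hz : 0 < s * z.im) : TraceNormLE (dbar (almostAnalyticExt f N τ) z •
      (resolvent H (z + ((s * ε : ℝ) : ℂ) * I) - resolvent H₀ (z + ((s * ε : ℝ) : ℂ) * I)))
      (‖dbar (almostAnalyticExt f N τ) z‖ * (C * |z.im| ^ (-p))) := by
    by_cases h0 : dbar (almostAnalyticExt f N τ) z = 0
    · rw [h0, zero_smul, norm_zero, zero_mul]
      intro U _ t
      simp
    · obtain ⟨h1, h2⟩ := mem_of_mem_tsupport_ext hτK hfK (mem_tsupport_of_dbar_ne_zero h0)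
      refine ((h.shift hs hε hεa h1 h2 hz.le).2.mono ?_).smul _
      have hpos : 0 < |z.im| := abs_pos.2 fun h' => by simp [h'] at hz
      gcongr ?_ * ?_
      -- `(|Im z| + ε)^(-p) ≤ |Im z|^(-p)` is what makes the domination uniform in `ε`.
      exact Real.rpow_le_rpow_of_nonpos hpos (by linarith) (by linarith)
  obtain ⟨h1, h2⟩ := TraceNormLE.trace_integral hi
    (integrable_dbar_mul_rpow (N := N) hτ hf hfc hC hpN).integrableOn
    ((ae_restrict_iff' (measurableSet_halfPlane s)).2
      (Filter.Eventually.of_forall fun z hz => hb hz))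
  simp_rw [trace_smul] at h1 h2
  have hxs {x : ℝ} (hx : x ∈ tsupport f) :
      ((x : ℂ) + ((s * ε : ℝ) : ℂ) * I) ∈ resolventSet H ∩ resolventSet H₀ ∧
      TraceNormLE (resolvent H (x + ((s * ε : ℝ) : ℂ) * I) -
        resolvent H₀ (x + ((s * ε : ℝ) : ℂ) * I)) (C * ε ^ (-p)) := by
    have := h.shift hs hε hεa (z := (x : ℂ)) (by simpa using hfK hx)
      (by simp; linarith) (by simp)
    simpa using this
  have hfi : Integrable (fun x : ℝ => f x •
      (resolvent H (x + ((s * ε : ℝ) : ℂ) * I) - resolvent H₀ (x + ((s * ε : ℝ) : ℂ) * I))) := by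
    have : IntegrableOn (fun x : ℝ => f x •
        (resolvent H (x + ((s * ε : ℝ) : ℂ) * I) - resolvent H₀ (x + ((s * ε : ℝ) : ℂ) * I)))
        (tsupport f) := by
      refine ContinuousOn.integrableOn_compact hfc.isCompact ?_
      refine hf.continuous.continuousOn.smul fun x hx => ?_
      have h4 : ContinuousAt (fun x : ℝ => (x : ℂ) + ((s * ε : ℝ) : ℂ) * I) x := by fun_prop
      exact (ContinuousAt.comp (f := fun x : ℝ => (x : ℂ) + ((s * ε : ℝ) : ℂ) * I)
        (differentiableAt_resolvent_sub (hxs hx).1).continuousAt h4).continuousWithinAt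
    rw [← integrableOn_iff_integrable_of_support_subset (s := tsupport f)]
    · exact this
    · intro x hx
      refine subset_tsupport f fun h' => hx ?_
      simp only [h', zero_smul]
  obtain ⟨h3, h4⟩ := TraceNormLE.trace_integral hfi
    (m := fun x => ‖f x‖ * (C * ε ^ (-p)))
    ((hf.continuous.integrable_of_hasCompactSupport hfc).norm.mul_const _)
    (Filter.Eventually.of_forall fun x => by
      by_cases hx : x ∈ tsupport f
      · exact (hxs hx).2.smul _
      · rw [image_eq_zero_of_notMem_tsupport hx, zero_smul, norm_zero, zero_mul]
        intro U _ t
        simp)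
  simp_rw [trace_smul] at h3 h4
  refine ⟨h1, h3, fun z hz => ?_, ?_⟩
  · have := (hb hz).norm_trace_le
    rwa [trace_smul] at this
  · refine h2.symm.trans ?_
    rw [e, trace_smul, trace_smul, h4, mul_assoc]
    rfl

theorem TraceControl.tendsto_integral_halfPlane [TopologicalSpace.SeparableSpace E]
    (h : TraceControl H H₀ K p a C) (hp : 0 < p) (ha : 0 < a) (hC : 0 ≤ C)
    (hσ : ContinuousOn (sigma H H₀) (resolventSet H ∩ resolventSet H₀))
    (hτ : IsCutoff τ)
    (hτK : ∀ z ∈ tsupport (chi τ), z.re ∈ K → |z.im| ≤ a / 2) (hfK : tsupport f ⊆ K)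
    (hf : ContDiff ℝ ∞ f) (hfc : HasCompactSupport f) (hpN : p < N + 1)
    {s : ℝ} (hs : s = 1 ∨ s = -1) :
    Filter.Tendsto (fun ε : ℝ => (s : ℂ) * (2 * I)⁻¹ *
      ∫ x : ℝ, f x * sigma H H₀ (x + ((s * ε : ℝ) : ℂ) * I)) (𝓝[>] 0)
      (𝓝 (∫ z in {z : ℂ | 0 < s * z.im}, dbar (almostAnalyticExt f N τ) z * sigma H H₀ z)) := by
  have hev : ∀ᶠ ε : ℝ in 𝓝[>] 0, 0 < ε ∧ ε < a / 2 := Ioo_mem_nhdsGT (by positivity)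
  have hlim := tendsto_integral_filter_of_dominated_convergence
    (μ := volume.restrict {z : ℂ | 0 < s * z.im}) (l := 𝓝[>] (0 : ℝ))
    (F := fun ε z => dbar (almostAnalyticExt f N τ) z * sigma H H₀ (z + ((s * ε : ℝ) : ℂ) * I))
    (f := fun z => dbar (almostAnalyticExt f N τ) z * sigma H H₀ z)
    (fun z => ‖dbar (almostAnalyticExt f N τ) z‖ * (C * |z.im| ^ (-p)))
    (hev.mono fun ε hε => (h.integral_shift_sigma hp hC hτ hτK hfK hf hfc hpN hs
      hε.1 hε.2).1.aestronglyMeasurable)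
    (hev.mono fun ε hε => (ae_restrict_iff' (measurableSet_halfPlane s)).2
      (Filter.Eventually.of_forall (h.integral_shift_sigma hp hC hτ hτK hfK hf hfc hpN hs
        hε.1 hε.2).2.2.1))
    (integrable_dbar_mul_rpow (N := N) hτ hf hfc hC hpN).integrableOn
    ((ae_restrict_iff' (measurableSet_halfPlane s)).2 (Filter.Eventually.of_forall fun z hz => by
      by_cases h0 : dbar (almostAnalyticExt f N τ) z = 0
      · simp [h0]
      · refine Filter.Tendsto.const_mul _ ?_
        obtain ⟨h1, h2⟩ := mem_of_mem_tsupport_ext hτK hfK (mem_tsupport_of_dbar_ne_zero h0)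
        have hpos : 0 < |z.im| := abs_pos.2 fun h' => by
          have : 0 < s * z.im := hz
          simp [h'] at this
        have hzρ := (h z h1 hpos (by linarith)).1
        have hca : ContinuousAt (sigma H H₀) z := hσ.continuousAt
          (((isOpen_resolventSet H).inter (isOpen_resolventSet H₀)).mem_nhds hzρ)
        have hcs : Continuous fun ε : ℝ => z + ((s * ε : ℝ) : ℂ) * I := by fun_prop
        have ht := (hcs.tendsto 0).mono_left (nhdsWithin_le_nhds (s := Ioi (0 : ℝ)))
        simp only [mul_zero, ofReal_zero, zero_mul, add_zero] at ht
        exact hca.tendsto.comp ht))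
  refine hlim.congr' (hev.mono fun ε hε => ?_)
  exact (h.integral_shift_sigma hp hC hτ hτK hfK hf hfc hpN hs hε.1 hε.2).2.2.2

/-- The factor `s = ±1` of the two half planes produces the jump, and `π⁻¹ (2i)⁻¹ = (2πi)⁻¹`. -/
theorem TraceControl.tendsto_integral_jump [TopologicalSpace.SeparableSpace E]
    (h : TraceControl H H₀ K p a C) (hp : 0 < p) (ha : 0 < a) (hC : 0 ≤ C)
    (hσ : ContinuousOn (sigma H H₀) (resolventSet H ∩ resolventSet H₀))
    (hτ : IsCutoff τ)
    (hτK : ∀ z ∈ tsupport (chi τ), z.re ∈ K → |z.im| ≤ a / 2) (hfK : tsupport f ⊆ K)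
    (hf : ContDiff ℝ ∞ f) (hfc : HasCompactSupport f) (hpN : p < N + 1)
    (hi : Integrable fun z => dbar (almostAnalyticExt f N τ) z * sigma H H₀ z) :
    Filter.Tendsto (fun ε : ℝ => (2 * Real.pi * I)⁻¹ *
      ∫ x : ℝ, f x * (sigma H H₀ (x + ε * I) - sigma H H₀ (x - ε * I))) (𝓝[>] 0)
      (𝓝 ((Real.pi : ℂ)⁻¹ * ∫ z, dbar (almostAnalyticExt f N τ) z * sigma H H₀ z)) := by
  have hev : ∀ᶠ ε : ℝ in 𝓝[>] 0, 0 < ε ∧ ε < a / 2 := Ioo_mem_nhdsGT (by positivity)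
  have h1 := h.tendsto_integral_halfPlane (N := N) hp ha hC hσ hτ hτK hfK hf hfc hpN (Or.inl rfl)
  have h2 := h.tendsto_integral_halfPlane (N := N) hp ha hC hσ hτ hτK hfK hf hfc hpN (Or.inr rfl)
  have h3 := (h1.add h2).const_mul (Real.pi : ℂ)⁻¹
  rw [← integral_eq_add_halfPlanes hi] at h3
  refine h3.congr' (hev.mono fun ε hε => ?_)
  have i1 := (h.integral_shift_sigma hp hC hτ hτK hfK hf hfc hpN (Or.inl rfl) hε.1 hε.2).2.1
  have i2 := (h.integral_shift_sigma hp hC hτ hτK hfK hf hfc hpN (Or.inr rfl) hε.1 hε.2).2.1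
  simp only [one_mul, neg_mul, ofReal_neg, ← sub_eq_add_neg, ofReal_one] at i1 i2 ⊢
  simp_rw [mul_sub]
  rw [integral_sub i1 i2]
  have hpi : (Real.pi : ℂ) ≠ 0 := by exact_mod_cast Real.pi_ne_zero
  field_simp

end BoundaryLimit

/-! ### Distributions on an interval and their primitives. -/

section Distributions

open MeasureTheory Set TopologicalSpace

variable {Ω : Opens ℝ}

/-- Semi-norm estimates on compact subsets, with plain iterated derivatives. -/
def HasOrderBound (L : 𝓓(Ω, ℂ) → ℂ) : Prop :=
  ∀ K : Set ℝ, IsCompact K → K ⊆ Ω → ∃ (m : ℕ) (W : ℝ), 0 ≤ W ∧ ∀ f : 𝓓(Ω, ℂ), tsupport f ⊆ K →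
    ∀ B : ℝ, (∀ k ≤ m, ∀ x, ‖iteratedDeriv k f x‖ ≤ B) → ‖L f‖ ≤ W * B

/-- A linear form on test functions is continuous once it is so on the functions supported in each
compact `K`, where finitely many derivative seminorms control it. -/
theorem HasOrderBound.exists_clm {L : 𝓓(Ω, ℂ) → ℂ} (h : HasOrderBound L)
    (hadd : ∀ f g, L (f + g) = L f + L g) (hsmul : ∀ (c : ℂ) f, L (c • f) = c • L f) :
    ∃ T : 𝓓(Ω, ℂ) →L[ℂ] ℂ, ∀ f, T f = L f := by
  refine ⟨TestFunction.mkCLM ℂ L hadd hsmul fun K hK => ?_, fun f => rfl⟩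
  obtain ⟨m, W, hW, hb⟩ := h K K.isCompact hK
  let Φ := ContDiffMapSupportedIn.mkCLMtoNormedSpace (𝕜 := ℂ) (n := ⊤) (K := K) (E := ℝ) (F := ℂ)
    (L ∘ TestFunction.ofSupportedIn hK)
    (fun f g => hadd (TestFunction.ofSupportedIn hK f) (TestFunction.ofSupportedIn hK g))
    (fun c f => hsmul c (TestFunction.ofSupportedIn hK f))
    ⟨Finset.range (m + 1), W, hW, fun f => by
      refine hb _ f.tsupport_subset _ fun k hk x => ?_
      rw [← norm_iteratedFDeriv_eq_norm_iteratedDeriv]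
      refine (ContDiffMapSupportedIn.norm_iteratedFDeriv_apply_le_seminorm_top (𝕜 := ℂ) (i := k)
        (f := f) (x := x)).trans ?_
      exact Finset.le_sup (f := fun i => N[ℂ; ℂ]_{K, i}) (Finset.mem_range.2 (by omega)) f⟩
  exact Φ.continuous

/-- Integral from `-∞`. -/
noncomputable def primitive (g : ℝ → ℂ) (x : ℝ) : ℂ := ∫ t in Iic x, g t

theorem hasDerivAt_primitive {g : ℝ → ℂ} (hg : Continuous g) (hgc : HasCompactSupport g) (x : ℝ) :
    HasDerivAt (primitive g) (g x) x := by
  have hi := hg.integrable_of_hasCompactSupport hgc (μ := volume)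
  have e : primitive g = fun x => (∫ t in (0 : ℝ)..x, g t) + ∫ t in Iic (0 : ℝ), g t := by
    ext x
    rw [← intervalIntegral.integral_Iic_sub_Iic hi.integrableOn hi.integrableOn]
    simp [primitive]
  rw [e]
  exact (intervalIntegral.integral_hasDerivAt_right (hg.intervalIntegrable _ _)
    (hg.stronglyMeasurableAtFilter _ _) hg.continuousAt).add_const _

theorem contDiff_primitive {g : ℝ → ℂ} (hg : ContDiff ℝ ∞ g) (hgc : HasCompactSupport g) :
    ContDiff ℝ ∞ (primitive g) := by
  rw [contDiff_infty_iff_deriv]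
  refine ⟨fun x => (hasDerivAt_primitive hg.continuous hgc x).differentiableAt, ?_⟩
  rwa [show deriv (primitive g) = g from
    funext fun x => (hasDerivAt_primitive hg.continuous hgc x).deriv]

/-- To the left of the support nothing has been integrated yet; to the right one sees the whole
integral, which is zero. -/
theorem support_primitive_subset {g : ℝ → ℂ} {l u : ℝ} (hs : tsupport g ⊆ Icc l u)
    (h0 : ∫ x, g x = 0) : Function.support (primitive g) ⊆ Icc l u := by
  intro x hx
  by_contra hxn
  refine hx ?_
  have hz {t : ℝ} (ht : t ∉ Icc l u) : g t = 0 :=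
    image_eq_zero_of_notMem_tsupport fun h => ht (hs h)
  rw [mem_Icc, not_and_or, not_le, not_le] at hxn
  rcases hxn with h | h
  · exact setIntegral_eq_zero_of_forall_eq_zero fun t ht => hz fun h' =>
      absurd (h'.1.trans ht) (not_le.2 h)
  · rw [primitive, setIntegral_eq_integral_of_forall_compl_eq_zero, h0]
    intro t ht
    exact hz fun h' => ht (h'.2.trans h.le)

theorem norm_integral_le_of_tsupport {g : ℝ → ℂ} {l u B : ℝ} (hlu : l ≤ u)
    (hs : tsupport g ⊆ Icc l u) (hB : ∀ x, ‖g x‖ ≤ B) (s : Set ℝ) :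
    ‖∫ x in s, g x‖ ≤ (u - l) * B := by
  have hB0 : 0 ≤ B := (norm_nonneg _).trans (hB 0)
  have hz {t : ℝ} (ht : t ∉ Icc l u) : g t = 0 :=
    image_eq_zero_of_notMem_tsupport fun h => ht (hs h)
  have e : ∫ x in s, g x = ∫ x in Icc l u, g x ∂(volume.restrict s) :=
    (setIntegral_eq_integral_of_forall_compl_eq_zero fun t ht => hz ht).symm
  have hlt : (volume.restrict s) (Icc l u) < ⊤ :=
    (Measure.restrict_apply_le s _).trans_lt (by simp)
  rw [e]
  refine (norm_setIntegral_le_of_norm_le_const hlt fun x _ => hB x).trans ?_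
  rw [mul_comm]
  refine mul_le_mul_of_nonneg_right ?_ hB0
  have : (volume.restrict s).real (Icc l u) ≤ volume.real (Icc l u) :=
    ENNReal.toReal_mono (by simp) (Measure.restrict_apply_le s _)
  refine this.trans ?_
  simp [hlu]

theorem exists_Icc_of_compact {s K : Set ℝ} (hs : s.OrdConnected) (hK : IsCompact K)
    (hKs : K ⊆ s) (hne : K.Nonempty) : ∃ l u, l ≤ u ∧ K ⊆ Icc l u ∧ Icc l u ⊆ s := by
  obtain ⟨l, hl⟩ := hK.exists_isLeast hne
  obtain ⟨u, hu⟩ := hK.exists_isGreatest hne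
  exact ⟨l, u, hl.2 hu.1, fun x hx => ⟨hl.2 hx, hu.2 hx⟩, hs.out (hKs hl.1) (hKs hu.1)⟩

/-- The primitive may be non-zero between components of the support of `g`, so the convex hull of
that support must stay in `Ω`. -/
theorem exists_primitive (hΩ : (Ω : Set ℝ).OrdConnected) (g : 𝓓(Ω, ℂ)) (h0 : ∫ x, g x = 0) :
    ∃ G : 𝓓(Ω, ℂ), (G : ℝ → ℂ) = primitive g := by
  by_cases hne : (tsupport g).Nonempty
  · obtain ⟨l, u, hlu, h1, h2⟩ :=
      exists_Icc_of_compact hΩ g.hasCompactSupport.isCompact g.tsupport_subset hne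
    have h3 : tsupport (primitive g) ⊆ Icc l u :=
      closure_minimal (support_primitive_subset h1 h0) isClosed_Icc
    exact ⟨⟨primitive g, contDiff_primitive g.contDiff g.hasCompactSupport,
      isCompact_Icc.of_isClosed_subset (isClosed_tsupport _) h3, h3.trans h2⟩, rfl⟩
  · have hg : (g : ℝ → ℂ) = 0 := tsupport_eq_empty_iff.1 (not_nonempty_iff_eq_empty.1 hne)
    refine ⟨0, ?_⟩
    rw [hg]
    ext x
    simp [primitive]

theorem exists_integral_eq_one (hne : (Ω : Set ℝ).Nonempty) : ∃ f₀ : 𝓓(Ω, ℂ), ∫ x, f₀ x = 1 := by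
  obtain ⟨x, hx⟩ := hne
  obtain ⟨r, hr, hrΩ⟩ := Metric.isOpen_iff.1 Ω.isOpen x hx
  let φ : ContDiffBump x := ⟨r / 4, r / 2, by positivity, by linarith⟩
  have hs : tsupport (fun y => ((φ.normed volume y : ℝ) : ℂ)) ⊆ Metric.closedBall x (r / 2) := by
    rw [← φ.tsupport_normed_eq (μ := volume)]
    exact closure_mono fun y hy h => hy (by simp only [h, Complex.ofReal_zero])
  refine ⟨⟨fun y => ((φ.normed volume y : ℝ) : ℂ),
    Complex.ofRealCLM.contDiff.comp φ.contDiff_normed,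
    (isCompact_closedBall x (r / 2)).of_isClosed_subset (isClosed_tsupport _) hs,
    hs.trans ((Metric.closedBall_subset_ball (by linarith)).trans hrΩ)⟩, ?_⟩
  change ∫ y, ((φ.normed volume y : ℝ) : ℂ) = 1
  refine integral_complex_ofReal.trans ?_
  rw [φ.integral_normed, Complex.ofReal_one]

theorem integrable_testFunction (f : 𝓓(Ω, ℂ)) : Integrable f :=
  f.continuous.integrable_of_hasCompactSupport f.hasCompactSupport

theorem integral_deriv_testFunction (f : 𝓓(Ω, ℂ)) : ∫ x, deriv f x = 0 := by
  have hd : Differentiable ℝ f := f.contDiff.differentiable (by simp)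
  have hc : Continuous (deriv f) := f.contDiff.continuous_deriv (by simp)
  exact integral_eq_zero_of_hasDerivAt_of_integrable (fun x => (hd x).hasDerivAt)
    (hc.integrable_of_hasCompactSupport f.hasCompactSupport.deriv) (integrable_testFunction f)

theorem primitive_deriv (f : 𝓓(Ω, ℂ)) : primitive (deriv f) = f := by
  have hd : Differentiable ℝ f := f.contDiff.differentiable (by simp)
  have hc : Continuous (deriv f) := f.contDiff.continuous_deriv (by simp)
  ext x
  have hlim : Filter.Tendsto f Filter.atBot (𝓝 0) :=
    f.hasCompactSupport.is_zero_at_infty.mono_left atBot_le_cocompact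
  have := integral_Iic_of_hasDerivAt_of_tendsto' (a := x) (fun y _ => (hd y).hasDerivAt)
    (hc.integrable_of_hasCompactSupport f.hasCompactSupport.deriv).integrableOn hlim
  rw [primitive, this, sub_zero]

theorem distDeriv_apply (η : 𝓓(Ω, ℂ) →L[ℂ] ℂ) (f : 𝓓(Ω, ℂ)) :
    distDeriv η f = -η (TestFunction.lineDerivCLM ℂ (1 : ℝ) f : 𝓓(Ω, ℂ)) := rfl

theorem coe_lineDerivCLM (f : 𝓓(Ω, ℂ)) :
    ((TestFunction.lineDerivCLM ℂ (1 : ℝ) f : 𝓓(Ω, ℂ)) : ℝ → ℂ) = deriv f := by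
  ext x
  rw [TestFunction.lineDerivCLM_apply_of_le (by simp)]
  have hd : DifferentiableAt ℝ f x := f.contDiff.differentiable (by simp) x
  rw [hd.lineDeriv_eq_fderiv, fderiv_eq_smul_deriv, one_smul]

/-- Fix `f₀` with integral one. Every `f` is `(P f)' + (∫ f) f₀` with `P f` a test function, so `η'
= T` forces `η f = -T(P f) + η(f₀) ∫ f`. Hence `ξ = -T ∘ P`, and `C = 0` in the equivalence gives
existence. -/
theorem exists_distribution_primitive (hΩ : (Ω : Set ℝ).OrdConnected) (T : 𝓓(Ω, ℂ) →L[ℂ] ℂ)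
    (hT : HasOrderBound T) :
    ∃ ξ : 𝓓(Ω, ℂ) →L[ℂ] ℂ, ∀ η : 𝓓(Ω, ℂ) →L[ℂ] ℂ,
      distDeriv η = T ↔ ∃ C : ℂ, ∀ f : 𝓓(Ω, ℂ), η f = ξ f + C * ∫ x, f x := by
  by_cases hne : (Ω : Set ℝ).Nonempty
  swap
  · have hz (f : 𝓓(Ω, ℂ)) : f = 0 := by
      ext x
      refine image_eq_zero_of_notMem_tsupport fun h => hne ⟨x, f.tsupport_subset h⟩
    refine ⟨0, fun η => ⟨fun _ => ⟨0, fun f => ?_⟩, fun _ => ?_⟩⟩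
    · rw [hz f]; simp
    · ext f
      rw [hz f, map_zero, map_zero]
  obtain ⟨f₀, hf₀⟩ := exists_integral_eq_one hne
  have h0 (f : 𝓓(Ω, ℂ)) : ∫ x, (f - (∫ y, f y) • f₀) x = 0 := by
    change ∫ x, (f x - (∫ y, f y) * f₀ x) = 0
    rw [integral_sub (integrable_testFunction f) ((integrable_testFunction f₀).const_mul _),
      integral_const_mul, hf₀, mul_one, sub_self]
  choose P hP using fun f : 𝓓(Ω, ℂ) => exists_primitive hΩ _ (h0 f)
  have hPd (f : 𝓓(Ω, ℂ)) (x : ℝ) : HasDerivAt (P f) (f x - (∫ y, f y) * f₀ x) x := by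
    rw [hP]
    exact hasDerivAt_primitive (f - (∫ y, f y) • f₀).continuous
      (f - (∫ y, f y) • f₀).hasCompactSupport x
  have hPx (f : 𝓓(Ω, ℂ)) (x : ℝ) : P f x = (∫ t in Iic x, f t) -
      (∫ y, f y) * ∫ t in Iic x, f₀ t := by
    rw [hP]
    change ∫ t in Iic x, (f t - (∫ y, f y) * f₀ t) = _
    rw [integral_sub (integrable_testFunction f).integrableOn
      ((integrable_testFunction f₀).const_mul _).integrableOn, integral_const_mul]
  have hadd (f g : 𝓓(Ω, ℂ)) : P (f + g) = P f + P g := by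
    ext x
    change P (f + g) x = P f x + P g x
    have e1 (μ : Measure ℝ) (hf : Integrable f μ) (hg : Integrable g μ) :
      ∫ t, (f + g) t ∂μ = ∫ t, f t ∂μ + ∫ t, g t ∂μ := integral_add hf hg
    rw [hPx, hPx, hPx, e1 _ (integrable_testFunction f) (integrable_testFunction g),
      e1 _ (integrable_testFunction f).integrableOn (integrable_testFunction g).integrableOn]
    ring
  have hsmul (c : ℂ) (f : 𝓓(Ω, ℂ)) : P (c • f) = c • P f := by
    ext x
    change P (c • f) x = c * P f x
    have e1 (μ : Measure ℝ) : ∫ t, (c • f) t ∂μ = c * ∫ t, f t ∂μ := integral_const_mul c _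
    rw [hPx, hPx, e1, e1]
    ring
  have hbound : HasOrderBound fun f => -T (P f) := by
    intro K hK hKΩ
    obtain ⟨x₀, hx₀⟩ : (tsupport f₀).Nonempty := by
      by_contra h
      have hz : (f₀ : ℝ → ℂ) = 0 := tsupport_eq_empty_iff.1 (not_nonempty_iff_eq_empty.1 h)
      rw [hz] at hf₀
      simp at hf₀
    obtain ⟨l, u, hlu, h1, h2⟩ := exists_Icc_of_compact hΩ
      (hK.union f₀.hasCompactSupport.isCompact) (union_subset hKΩ f₀.tsupport_subset)
      ⟨x₀, Or.inr hx₀⟩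
    obtain ⟨m, W, hW, hb⟩ := hT (Icc l u) isCompact_Icc h2
    choose D hD hfD using exists_norm_iteratedDeriv_le f₀.contDiff f₀.hasCompactSupport
    set S := ∑ k ∈ Finset.range (m + 1), D k
    have hS : 0 ≤ S := Finset.sum_nonneg fun k _ => hD k
    have hul : 0 ≤ u - l := by linarith
    refine ⟨m, W * ((1 + (u - l)) * (1 + (u - l) * S)), by positivity, fun f hfK B hB => ?_⟩
    have hB0 : 0 ≤ B := (norm_nonneg _).trans (hB 0 (by omega) 0)
    rw [norm_neg, mul_assoc]
    have hfs : tsupport f ⊆ Icc l u := hfK.trans (subset_union_left.trans h1)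
    have hc : ‖∫ y, f y‖ ≤ (u - l) * B := by
      have := norm_integral_le_of_tsupport hlu hfs (fun x => by simpa using hB 0 (by omega) x) univ
      rwa [Measure.restrict_univ] at this
    have hgs : tsupport (f - (∫ y, f y) • f₀ : 𝓓(Ω, ℂ)) ⊆ Icc l u := by
      refine (tsupport_sub _ _).trans (union_subset hfs ?_)
      exact (tsupport_smul_subset_right (fun _ => ∫ y, f y) f₀).trans (subset_union_right.trans h1)
    have hgb (k : ℕ) (hk : k ≤ m) (x : ℝ) :
        ‖iteratedDeriv k (fun y => f y - (∫ y, f y) * f₀ y) x‖ ≤ (1 + (u - l) * S) * B := by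
      have c1 : ContDiffAt ℝ k f x := f.contDiff.contDiffAt.of_le (mod_cast le_top)
      have c2 : ContDiffAt ℝ k f₀ x := f₀.contDiff.contDiffAt.of_le (mod_cast le_top)
      rw [iteratedDeriv_fun_sub c1 (contDiffAt_const.mul c2), iteratedDeriv_const_mul_field]
      refine (norm_sub_le _ _).trans ?_
      rw [norm_mul, add_mul, one_mul]
      refine add_le_add (hB k hk x) ?_
      have : ‖iteratedDeriv k f₀ x‖ ≤ S := (hfD k x).trans
        (Finset.single_le_sum (f := D) (fun i _ => hD i) (Finset.mem_range.2 (by omega)))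
      calc _ ≤ ((u - l) * B) * S := by gcongr
        _ = _ := by ring
    refine hb (P f) ?_ _ fun k hk x => ?_
    · rw [hP]
      exact closure_minimal (support_primitive_subset hgs (h0 f)) isClosed_Icc
    · rw [mul_assoc, add_mul, one_mul]
      have hnn : 0 ≤ (1 + (u - l) * S) * B := by positivity
      -- Integration costs a factor of the length `u - l` at order zero only. Derivatives of `P f`
      -- are those of `f - (∫ f) f₀` of one order less, so the same `m` suffices.
      cases k with
      | zero =>
        rw [iteratedDeriv_zero, hP]
        refine le_add_of_nonneg_of_le hnn ?_
        refine norm_integral_le_of_tsupport hlu hgs (fun y => ?_) _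
        simpa using hgb 0 (by omega) y
      | succ k =>
        rw [iteratedDeriv_succ', show deriv (P f) = fun y => f y - (∫ y, f y) * f₀ y from
          funext fun y => (hPd f y).deriv]
        exact le_add_of_le_of_nonneg (hgb k (by omega) x) (by positivity)
  obtain ⟨ξ, hξ⟩ := hbound.exists_clm (fun f g => by simp only [hadd, map_add, neg_add])
    (fun c f => by simp only [hsmul, map_smul, smul_neg])
  refine ⟨ξ, fun η => ⟨fun h => ⟨η f₀, fun f => ?_⟩, ?_⟩⟩
  · have e : f = (TestFunction.lineDerivCLM ℂ (1 : ℝ) (P f) : 𝓓(Ω, ℂ)) + (∫ y, f y) • f₀ := by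
      ext x
      change f x = (TestFunction.lineDerivCLM ℂ (1 : ℝ) (P f) : 𝓓(Ω, ℂ)) x + (∫ y, f y) * f₀ x
      rw [coe_lineDerivCLM, (hPd f x).deriv]
      ring
    have h1 := distDeriv_apply η (P f)
    rw [h] at h1
    rw [hξ, h1]
    nth_rw 1 [e]
    rw [map_add, map_smul, neg_neg, smul_eq_mul, mul_comm]
  · rintro ⟨C, hC⟩
    ext f
    rw [distDeriv_apply, hC, hξ, coe_lineDerivCLM, integral_deriv_testFunction, mul_zero, add_zero,
      neg_neg]
    -- `P (f') = f`: the correction by `f₀` disappears because `f'` has integral zero.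
    congr 1
    ext x
    rw [hPx, coe_lineDerivCLM, integral_deriv_testFunction, zero_mul, sub_zero]
    exact congrFun (primitive_deriv f) x

end Distributions

/-! ### Linearity of the almost analytic extension in `f`. -/

section Linearity

variable {f g : ℝ → ℂ} {N : ℕ} {τ : ℝ → ℂ}

theorem almostAnalyticExt_add (hf : ContDiff ℝ ∞ f) (hg : ContDiff ℝ ∞ g) :
    almostAnalyticExt (f + g) N τ = almostAnalyticExt f N τ + almostAnalyticExt g N τ := by
  ext z
  simp only [almostAnalyticExt, Pi.add_apply, ← add_mul, ← Finset.sum_add_distrib]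
  congr 1
  refine Finset.sum_congr rfl fun k _ => ?_
  rw [iteratedDeriv_add (hf.contDiffAt.of_le (mod_cast le_top))
    (hg.contDiffAt.of_le (mod_cast le_top))]
  ring

theorem almostAnalyticExt_smul (c : ℂ) :
    almostAnalyticExt (c • f) N τ = c • almostAnalyticExt f N τ := by
  ext z
  have e : c • f = fun x => c * f x := rfl
  simp only [almostAnalyticExt, Pi.smul_apply, smul_eq_mul, ← mul_assoc, Finset.mul_sum]
  congr 1
  refine Finset.sum_congr rfl fun k _ => ?_
  rw [e, iteratedDeriv_const_mul_field]
  ring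

theorem dbar_almostAnalyticExt_add (hf : ContDiff ℝ ∞ f) (hg : ContDiff ℝ ∞ g) (hτ : IsCutoff τ)
    (z : ℂ) : dbar (almostAnalyticExt (f + g) N τ) z =
      dbar (almostAnalyticExt f N τ) z + dbar (almostAnalyticExt g N τ) z := by
  rw [almostAnalyticExt_add hf hg]
  exact ((hasDbarAt_dbar ((contDiff_almostAnalyticExt hf N hτ).differentiable (by simp) z)).add
    (hasDbarAt_dbar ((contDiff_almostAnalyticExt hg N hτ).differentiable (by simp) z))).dbar_eq

theorem dbar_almostAnalyticExt_smul (hf : ContDiff ℝ ∞ f) (hτ : IsCutoff τ) (c : ℂ) (z : ℂ) :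
    dbar (almostAnalyticExt (c • f) N τ) z = c * dbar (almostAnalyticExt f N τ) z := by
  have hd := (contDiff_almostAnalyticExt hf N hτ).differentiable (by simp) z
  rw [almostAnalyticExt_smul, dbar, dbar, fderiv_const_smul hd]
  simp only [smul_apply, smul_eq_mul]
  ring

end Linearity

/-! ### Assembly of the theorem. -/

section MainTheorem

open MeasureTheory Complex Set

variable {E : Type*} [NormedAddCommGroup E] [InnerProductSpace ℂ E] [CompleteSpace E]
  {H H₀ : E →ₗ.[ℂ] E} {V : E →L[ℂ] E}

theorem nonrealSpectrumDiscrete_of_isSelfAdjoint (hH₀ : IsSelfAdjoint H₀) (I : Set ℝ) :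
    NonrealSpectrumDiscrete H₀ I :=
  fun _ hz _ _ => (hH₀.isResolventAt_of_im_ne_zero hz).1

theorem nonrealSpectrumDiscrete_perturb (hH₀ : IsSelfAdjoint H₀) (hV : IsCompactOperator V)
    (I : Set ℝ) : NonrealSpectrumDiscrete (perturb H₀ V) I :=
  fun _ hz hzI hn => mem_resolventSet_perturb_of_not_isEigenvalue hV
    (hH₀.isResolventAt_of_im_ne_zero hz).1 fun h => hn ⟨h, hz, hzI⟩

/-- Constants and a cut-off for which the trace formula holds for all test functions supported in
`K`. -/
theorem exists_traceControl_cutoff (hH₀ : IsSelfAdjoint H₀) (hV : IsTraceClass V)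
    (hH : H = perturb H₀ V) {I : Set ℝ} (hfin : (nonrealEigenvalues H I).Finite) {n : ℝ}
    (hn : 0 < n) (hE : ResolventEstimate H I n) {K : Set ℝ} (hK : IsCompact K) (hKI : K ⊆ I) :
    ∃ a > 0, ∃ C ≥ 0, ∃ τ, ∃ N : ℕ, TraceControl H H₀ K (n + 2) a C ∧ IsAdmissible H I τ ∧
      IsAdmissible H₀ I τ ∧ (∀ z ∈ tsupport (chi τ), z.re ∈ K → |z.im| ≤ a / 2) ∧
      n + 2 < N + 1 := by
  obtain ⟨a, ha, C, hC, h⟩ := exists_traceControl hH₀ hV hH hn hE hK hKI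
  obtain ⟨τ, hτ, hτ₀, hτK⟩ := exists_admissible_narrow (H := H) (H₀ := H₀) hfin
    (by rw [hH₀.nonrealEigenvalues_eq_empty]; exact finite_empty) hK ha
  -- Convergence in trace norm needs one order more than convergence in operator norm.
  obtain ⟨N, hN⟩ := exists_nat_gt (n + 1)
  exact ⟨a, ha, C, hC, τ, N, h, hτ, hτ₀, hτK, by linarith⟩

variable [TopologicalSpace.SeparableSpace E]

/-- Additivity is read off the trace formula, with one `τ` and one `N` for all functions supported
in `K`. -/
theorem trace_funcCalc_sub_add {K : Set ℝ} {p a C : ℝ} {τ : ℝ → ℂ} {N : ℕ}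
    (h : TraceControl H H₀ K p a C) (ha : 0 < a) (hC : 0 ≤ C)
    (hτK : ∀ z ∈ tsupport (chi τ), z.re ∈ K → |z.im| ≤ a / 2) (hp : p < N + 1) {I : Set ℝ} {n : ℝ}
    (hv : ∀ f, ContDiff ℝ ∞ f → HasCompactSupport f → tsupport f ⊆ K →
      IsHSValue H I n f (funcCalc H I f) ∧ IsHSValue H₀ I n f (funcCalc H₀ I f))
    (hN : n < N) (hτ : IsAdmissible H I τ) (hτ₀ : IsAdmissible H₀ I τ) {f g : ℝ → ℂ}
    (hf : ContDiff ℝ ∞ f) (hfc : HasCompactSupport f) (hfK : tsupport f ⊆ K)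
    (hg : ContDiff ℝ ∞ g) (hgc : HasCompactSupport g) (hgK : tsupport g ⊆ K) :
    trace (funcCalc H I (f + g) - funcCalc H₀ I (f + g)) =
      trace (funcCalc H I f - funcCalc H₀ I f) + trace (funcCalc H I g - funcCalc H₀ I g) := by
  have key (u : ℝ → ℂ) (hu : ContDiff ℝ ∞ u) (huc : HasCompactSupport u) (huK : tsupport u ⊆ K) :=
    h.trace_funcCalc ha hC hτK huK hu huc hp (hv u hu huc huK).1 (hv u hu huc huK).2 hN hτ hτ₀
  obtain ⟨i1, e1⟩ := key f hf hfc hfK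
  obtain ⟨i2, e2⟩ := key g hg hgc hgK
  rw [e1, e2, (key (f + g) (hf.add hg) (hfc.add hgc)
    ((tsupport_add f g).trans (union_subset hfK hgK))).2]
  simp_rw [dbar_almostAnalyticExt_add hf hg hτ.1, add_mul]
  rw [integral_add i1 i2, mul_add]

theorem trace_funcCalc_sub_smul {K : Set ℝ} {p a C : ℝ} {τ : ℝ → ℂ} {N : ℕ}
    (h : TraceControl H H₀ K p a C) (ha : 0 < a) (hC : 0 ≤ C)
    (hτK : ∀ z ∈ tsupport (chi τ), z.re ∈ K → |z.im| ≤ a / 2) (hp : p < N + 1) {I : Set ℝ} {n : ℝ}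
    (hv : ∀ f, ContDiff ℝ ∞ f → HasCompactSupport f → tsupport f ⊆ K →
      IsHSValue H I n f (funcCalc H I f) ∧ IsHSValue H₀ I n f (funcCalc H₀ I f))
    (hN : n < N) (hτ : IsAdmissible H I τ) (hτ₀ : IsAdmissible H₀ I τ) {f : ℝ → ℂ}
    (hf : ContDiff ℝ ∞ f) (hfc : HasCompactSupport f) (hfK : tsupport f ⊆ K) (c : ℂ) :
    trace (funcCalc H I (c • f) - funcCalc H₀ I (c • f)) =
      c * trace (funcCalc H I f - funcCalc H₀ I f) := by
  have key (u : ℝ → ℂ) (hu : ContDiff ℝ ∞ u) (huc : HasCompactSupport u) (huK : tsupport u ⊆ K) :=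
    h.trace_funcCalc ha hC hτK huK hu huc hp (hv u hu huc huK).1 (hv u hu huc huK).2 hN hτ hτ₀
  rw [(key f hf hfc hfK).2, (key (c • f) (hf.const_smul c) (hfc.smul_left (f := fun _ => c))
    ((tsupport_smul_subset_right (fun _ => c) f).trans hfK)).2]
  simp_rw [dbar_almostAnalyticExt_smul hf hτ.1, mul_assoc]
  rw [integral_const_mul]
  ring

end MainTheorem

end SSF

theorem mainTheorem1 {E : Type*} [NormedAddCommGroup E] [InnerProductSpace ℂ E] [CompleteSpace E]
    [TopologicalSpace.SeparableSpace E]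
    (H₀ H : E →ₗ.[ℂ] E) (V : E →L[ℂ] E)
    (hH₀ : IsSelfAdjoint H₀) (hbelow : SSF.IsBoundedBelow H₀) (hH : H = SSF.perturb H₀ V)
    (I : TopologicalSpace.Opens ℝ) (hI : (I : Set ℝ).OrdConnected)
    (hyp1 : (SSF.nonrealEigenvalues H I).Finite)
    (n : ℝ) (hn : 0 < n) (hyp2 : SSF.ResolventEstimate H I n)
    (hyp3 : SSF.IsTraceClass V) :
    -- `f(H)` and `f(H₀)` are well defined by the Helffer–Sjöstrand formula
    (∀ f : 𝓓(I, ℂ), SSF.IsHSValue H I n f (SSF.funcCalc H I f) ∧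
      SSF.IsHSValue H₀ I n f (SSF.funcCalc H₀ I f)) ∧
    -- their difference is trace class
    (∀ f : 𝓓(I, ℂ), SSF.IsTraceClass (SSF.funcCalc H I f - SSF.funcCalc H₀ I f)) ∧
    -- the resolvent difference is trace class, so that `σ` is well defined
    (∀ z ∈ SSF.resolventSet H ∩ SSF.resolventSet H₀,
      SSF.IsTraceClass (SSF.resolvent H z - SSF.resolvent H₀ z)) ∧
    -- `f ↦ Tr (f(H) - f(H₀))` is a distribution `T` on `I`
    ∃ T : 𝓓(I, ℂ) →L[ℂ] ℂ,
      (∀ f : 𝓓(I, ℂ), T f = SSF.trace (SSF.funcCalc H I f - SSF.funcCalc H₀ I f)) ∧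
      -- which vanishes on `I ∩ ρ(H) ∩ ρ(H₀)`
      (∀ f : 𝓓(I, ℂ),
        (∀ x ∈ tsupport f, (x : ℂ) ∈ SSF.resolventSet H ∩ SSF.resolventSet H₀) → T f = 0) ∧
      -- it has a primitive `ξ`, unique up to an additive constant
      (∃ ξ : 𝓓(I, ℂ) →L[ℂ] ℂ, ∀ η : 𝓓(I, ℂ) →L[ℂ] ℂ,
        SSF.distDeriv η = T ↔ ∃ C : ℂ, ∀ f : 𝓓(I, ℂ), η f = ξ f + C * ∫ x, f x) ∧
      -- for small `ε` the functions `σ(· ± iε)` are locally integrable functions on `I`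
      (∀ᶠ ε : ℝ in 𝓝[>] 0,
        (∀ x ∈ I, (x + ε * Complex.I : ℂ) ∈ SSF.resolventSet H ∩ SSF.resolventSet H₀ ∧
          (x - ε * Complex.I : ℂ) ∈ SSF.resolventSet H ∩ SSF.resolventSet H₀) ∧
        MeasureTheory.LocallyIntegrableOn
          (fun x : ℝ => SSF.sigma H H₀ (x + ε * Complex.I)) I ∧
        MeasureTheory.LocallyIntegrableOn
          (fun x : ℝ => SSF.sigma H H₀ (x - ε * Complex.I)) I) ∧
      -- and `(2πi)⁻¹ (σ(· + iε) - σ(· - iε))` converges to `ξ' = T` in the sense of distributions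
      (∀ f : 𝓓(I, ℂ), Filter.Tendsto
        (fun ε : ℝ => (2 * Real.pi * Complex.I)⁻¹ *
          ∫ x : ℝ, f x * (SSF.sigma H H₀ (x + ε * Complex.I) -
            SSF.sigma H H₀ (x - ε * Complex.I)))
        (𝓝[>] 0) (𝓝 (T f))) := by
  have hD : SSF.NonrealSpectrumDiscrete H I := by
    rw [hH]
    exact SSF.nonrealSpectrumDiscrete_perturb hH₀ hyp3.isCompactOperator I
  have hD₀ := SSF.nonrealSpectrumDiscrete_of_isSelfAdjoint hH₀ (I : Set ℝ)
  have hE₀ : SSF.ResolventEstimate H₀ I n := hH₀.resolventEstimate I hn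
  have hfin₀ : (SSF.nonrealEigenvalues H₀ I).Finite := by
    rw [hH₀.nonrealEigenvalues_eq_empty]
    exact Set.finite_empty
  have hv (f : ℝ → ℂ) (hf : ContDiff ℝ ∞ f) (hfc : HasCompactSupport f) (hfI : tsupport f ⊆ I) :
      SSF.IsHSValue H I n f (SSF.funcCalc H I f) ∧ SSF.IsHSValue H₀ I n f (SSF.funcCalc H₀ I f) :=
    ⟨SSF.isHSValue_funcCalc hyp2 hn hD hyp1 hf hfc hfI,
      SSF.isHSValue_funcCalc hE₀ hn hD₀ hfin₀ hf hfc hfI⟩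
  have setup {K : Set ℝ} (hK : IsCompact K) (hKI : K ⊆ I) :=
    SSF.exists_traceControl_cutoff hH₀ hyp3 hH hyp1 hn hyp2 hK hKI
  have hσ := SSF.continuousOn_sigma hyp3 hH
  have hcK (f : 𝓓(I, ℂ)) : IsCompact (tsupport f) := f.hasCompactSupport
  let L : 𝓓(I, ℂ) → ℂ := fun f => SSF.trace (SSF.funcCalc H I f - SSF.funcCalc H₀ I f)
  have hadd (f g : 𝓓(I, ℂ)) : L (f + g) = L f + L g := by
    -- The union of the two supports serves as the common compact set, so that `f`, `g` and `f + g`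
    -- share the cut-off and the order.
    have hK := Set.union_subset f.tsupport_subset g.tsupport_subset
    obtain ⟨a, ha, C, hC, τ, N, h, hτ, hτ₀, hτK, hN⟩ := setup ((hcK f).union (hcK g)) hK
    exact SSF.trace_funcCalc_sub_add h ha hC hτK hN
      (fun u hu huc huK => hv u hu huc (huK.trans hK)) (by linarith) hτ hτ₀ f.contDiff
      f.hasCompactSupport Set.subset_union_left g.contDiff g.hasCompactSupport
      Set.subset_union_right
  have hsmul (c : ℂ) (f : 𝓓(I, ℂ)) : L (c • f) = c • L f := by
    obtain ⟨a, ha, C, hC, τ, N, h, hτ, hτ₀, hτK, hN⟩ := setup (hcK f) f.tsupport_subset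
    exact SSF.trace_funcCalc_sub_smul h ha hC hτK hN
      (fun u hu huc huK => hv u hu huc (huK.trans f.tsupport_subset)) (by linarith) hτ hτ₀
      f.contDiff f.hasCompactSupport subset_rfl c
  have hbound : SSF.HasOrderBound L := by
    intro K hK hKI
    obtain ⟨a, ha, C, hC, τ, N, h, hτ, hτ₀, hτK, hN⟩ := setup hK hKI
    obtain ⟨W, hW, hWb⟩ := SSF.exists_integral_dbar_le hτ.1 hK hC hτK hN
    refine ⟨N + 1, ‖(Real.pi : ℂ)⁻¹‖ * W, by positivity, fun f hfK B hB => ?_⟩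
    obtain ⟨v, v₀⟩ := hv f f.contDiff f.hasCompactSupport f.tsupport_subset
    refine (h.traceNormLE_funcCalc ha hC hτK hfK f.contDiff f.hasCompactSupport hN v v₀
      (by linarith) hτ hτ₀).norm_trace_le.trans ?_
    rw [mul_assoc]
    exact mul_le_mul_of_nonneg_left (hWb f f.contDiff f.hasCompactSupport hfK B hB)
      (norm_nonneg _)
  obtain ⟨T, hT⟩ := hbound.exists_clm hadd hsmul
  have hTL : ⇑T = L := funext hT
  refine ⟨fun f => hv f f.contDiff f.hasCompactSupport f.tsupport_subset, fun f => ?_,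
    fun z hz => ?_, T, hT, fun f hf => ?_,
    SSF.exists_distribution_primitive hI T (by rwa [hTL]), ?_, fun f => ?_⟩
  · obtain ⟨a, ha, C, hC, τ, N, h, hτ, hτ₀, hτK, hN⟩ := setup (hcK f) f.tsupport_subset
    obtain ⟨v, v₀⟩ := hv f f.contDiff f.hasCompactSupport f.tsupport_subset
    exact (h.traceNormLE_funcCalc ha hC hτK subset_rfl f.contDiff f.hasCompactSupport hN v v₀
      (by linarith) hτ hτ₀).isTraceClass
  · obtain ⟨K, -, h⟩ := SSF.exists_traceNormLE_resolvent_sub hyp3 hH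
    exact (h z hz).isTraceClass
  · rw [hT]
    simp only [L]
    rw [SSF.funcCalc_eq_zero hyp2 hn hD hyp1 f.contDiff f.hasCompactSupport f.tsupport_subset
        fun x hx => (hf x hx).1,
      SSF.funcCalc_eq_zero hE₀ hn hD₀ hfin₀ f.contDiff f.hasCompactSupport f.tsupport_subset
        fun x hx => (hf x hx).2]
    simp [SSF.trace]
  · obtain ⟨a, ha, c, hc, hρ, -⟩ := hyp2
    filter_upwards [Ioo_mem_nhdsGT ha] with ε hε
    -- Both signs are treated at once by a real shift `s` with `|s| = ε < a`; the strip then lies in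
    -- both resolvent sets for all `x ∈ I` simultaneously.
    have hm (x : ℝ) (hx : x ∈ I) (s : ℝ) (hs : |s| = ε) :
        (x + s * Complex.I : ℂ) ∈ SSF.resolventSet H ∩ SSF.resolventSet H₀ := by
      have him : (x + s * Complex.I : ℂ).im = s := by simp
      have hre : (x + s * Complex.I : ℂ).re = x := by simp
      refine ⟨hρ ⟨by rwa [hre], by rw [him, hs]; exact hε.1, by rw [him, hs]; exact hε.2⟩,
        (hH₀.isResolventAt_of_im_ne_zero ?_).1⟩
      rw [him, ← abs_pos, hs]
      exact hε.1
    have hli (s : ℝ) (hs : |s| = ε) : MeasureTheory.LocallyIntegrableOn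
        (fun x : ℝ => SSF.sigma H H₀ (x + s * Complex.I)) I := by
      refine ContinuousOn.locallyIntegrableOn (hσ.comp (by fun_prop) fun x hx => hm x hx s hs)
        I.isOpen.measurableSet
    have e1 : |ε| = ε := abs_of_pos hε.1
    have e2 : |-ε| = ε := by rw [abs_neg, e1]
    refine ⟨fun x hx => ⟨hm x hx ε e1, ?_⟩, hli ε e1, ?_⟩
    · simpa [sub_eq_add_neg] using hm x hx (-ε) e2
    · simpa [sub_eq_add_neg] using hli (-ε) e2
  · obtain ⟨a, ha, C, hC, τ, N, h, hτ, hτ₀, hτK, hN⟩ := setup (hcK f) f.tsupport_subset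
    obtain ⟨v, v₀⟩ := hv f f.contDiff f.hasCompactSupport f.tsupport_subset
    obtain ⟨hi, e⟩ := h.trace_funcCalc ha hC hτK subset_rfl f.contDiff f.hasCompactSupport hN v v₀
      (by linarith) hτ hτ₀
    rw [hT]
    simp only [L]
    rw [e]
    exact h.tendsto_integral_jump (by linarith) ha hC hσ hτ.1 hτK subset_rfl f.contDiff
      f.hasCompactSupport hN hi
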